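/- Let $\mathfrak n_n$ be the space of strictly upper-triangular complex $n\times n$ matrices, $\mathcal X_2(n)=\{x\in\mathfrak n_n : x^2=0\}$, and let $B_n\subset \mathrm{GL}_n(\mathbb C)$ be the group of invertible upper-triangular matrices; both groups act on matrices by conjugation. All topological notions refer to the Zariski topology. For an involution $\sigma\in S_n$ let $N_\sigma$ be the strictly upper-triangular part of its permutation matrix ($(N_\sigma)_{ij}=1$ if $i<j$ and $\sigma(i)=j$, and $0$ otherwise). For a partition $\lambda$ of $n$ let $\mathcal O_\lambda$ be the set of nilpotent matrices with Jordan block sizes $\lambda$, and for a standard Young tableau $T$ of shape $\lambda$ with $n$ boxes let $\mathcal V_T=\overline{\mathrm{St}^{-1}(T)}\cap\mathcal O_\lambda$ (an orbital variety), where $\mathrm{St}^{-1}(T)$ is the set of $u\in\mathfrak n_n$ such that for every $i\le n$ the upper left $i\times i$ block of $u$ has as Jordan type the shape formed by the boxes of $T$ with entries $\le i$. Tableaux are written by rows, separated by bars; "two-column" means at most two columns. (i) For $n\le 4$ and $x,y\in\mathcal X_2(n)$ in the same $\mathrm{GL}_n$-orbit, $\overline{B_n.x}\cap\overline{B_n.y}$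 is irreducible. For $n\le 3$ this holds for all $x,y\in\mathcal X_2(n)$, and for $n=4$ it holds for all $x,y\in\mathcal X_2(4)$ except exactly when the unordered pair $\{B_4.x,B_4.y\}$ is $\{B_4.N_{(2,3)},B_4.N_{(1,2)(3,4)}\}$ or $\{B_4.N_{(2,3)},B_4.N_{(1,3)(2,4)}\}$ (pairs of orbits in different $\mathrm{GL}_4$-orbits). For $n=5$ there are $x,y\in\mathcal X_2(5)$ in the same $\mathrm{GL}_5$-orbit such that $\overline{B_5.x}\cap\overline{B_5.y}$ is reducible. Let $T=(1,2|3,4|5)$ and $T'=(1,3|2,5|4)$. Among all pairs $S,S'$ of two-column standard tableaux with $5$ boxes of the same shape, $\mathcal V_S\cap\mathcal V_{S'}$ is not irreducible if and only if $\{S,S'\}=\{T,T'\}$. The variety $\mathcal V_T\cap\mathcal V_{T'}$ has exactly three irreducible components, namely $\overline{B_5.N_\varsigma}\cap\mathcal O_{(2,2,1)}$ for $\varsigma=(1,3)(2,5),\ (1,4)(3,5),\ (1,5)(2,4)$; each has dimension $4$ and codimension $2$ in $\mathcal V_T$ and in $\mathcal V_{T'}$. (ii) For $n\le5$ and all two-column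 standard tableaux $S,S'$ with $n$ boxes of the same shape, $\mathcal V_S\cap\mathcal V_{S'}$ is equidimensional. Let $T=(1,3|2,6|4|5)$ and $T'=(1,2|3,5|4|6)$. Among all pairs $S,S'$ of two-column standard tableaux with $6$ boxes of the same shape, $\mathcal V_S\cap\mathcal V_{S'}$ is not equidimensional if and only if $\{S,S'\}=\{T,T'\}$. The variety $\mathcal V_T\cap\mathcal V_{T'}$ has exactly two irreducible components: $\overline{B_6.N_{(1,3)(4,6)}}\cap\mathcal O_{(2,2,1,1)}$, of dimension $6$ and codimension $2$, and $\overline{B_6.N_{(1,6)(2,5)}}\cap\mathcal O_{(2,2,1,1)}$, of dimension $4$ and codimension $4$, the codimensions being taken in $\mathcal V_T$ and equally in $\mathcal V_{T'}$. -/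

import Mathlib

open Matrix

noncomputable section

namespace OrbVar

/-- The Zariski topology on the affine space of complex `n × n` matrices, induced from the prime
spectrum of the coordinate ring; `isClosed_zariski_iff` says that the closed sets are the zero
loci of sets of polynomials in the matrix entries. -/
@[reducible] def zariski (n : ℕ) : TopologicalSpace (Matrix (Fin n) (Fin n) ℂ) :=
  TopologicalSpace.induced
    (fun x => MvPolynomial.pointToPoint (k := ℂ) (fun p : Fin n × Fin n => x p.1 p.2))
    inferInstance

theorem isClosed_zariski_iff {n : ℕ} (S : Set (Matrix (Fin n) (Fin n) ℂ)) :
    @IsClosed _ (zariski n) S ↔ ∃ P : Set (MvPolynomial (Fin n × Fin n) ℂ),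
      S = {x | ∀ p ∈ P, MvPolynomial.eval (fun q => x q.1 q.2) p = 0} := by
  rw [isClosed_induced_iff]
  constructor
  · rintro ⟨t, ht, rfl⟩
    obtain ⟨P, rfl⟩ := (PrimeSpectrum.isClosed_iff_zeroLocus t).1 ht
    refine ⟨P, ?_⟩
    ext x
    simp [MvPolynomial.pointToPoint, PrimeSpectrum.mem_zeroLocus, Set.subset_def,
      MvPolynomial.mem_vanishingIdeal_iff, MvPolynomial.aeval_eq_eval]
  · rintro ⟨P, rfl⟩
    refine ⟨PrimeSpectrum.zeroLocus P, PrimeSpectrum.isClosed_zeroLocus P, ?_⟩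
    ext x
    simp [MvPolynomial.pointToPoint, PrimeSpectrum.mem_zeroLocus, Set.subset_def,
      MvPolynomial.mem_vanishingIdeal_iff, MvPolynomial.aeval_eq_eval]

/-- Zariski closure in the space of matrices. -/
def zclosure {n : ℕ} (S : Set (Matrix (Fin n) (Fin n) ℂ)) : Set (Matrix (Fin n) (Fin n) ℂ) :=
  @closure _ (zariski n) S

/-- `S` is irreducible (in particular nonempty) in the Zariski topology. -/
def ZIrreducible {n : ℕ} (S : Set (Matrix (Fin n) (Fin n) ℂ)) : Prop :=
  @IsIrreducible _ (zariski n) S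

/-- The irreducible components of `S` with its induced Zariski topology, as sets of matrices. -/
def zcomponents {n : ℕ} (S : Set (Matrix (Fin n) (Fin n) ℂ)) :
    Set (Set (Matrix (Fin n) (Fin n) ℂ)) :=
  (fun C : Set S => Subtype.val '' C) ''
    @irreducibleComponents S ((zariski n).induced Subtype.val)

/-- The (Krull) dimension of `S` with its induced Zariski topology. -/
def zdim {n : ℕ} (S : Set (Matrix (Fin n) (Fin n) ℂ)) : WithBot ℕ∞ :=
  @topologicalKrullDim S ((zariski n).induced Subtype.val)

/-- `C` has codimension `c` in `V`. -/
def HasCodim {n : ℕ} (C V : Set (Matrix (Fin n) (Fin n) ℂ)) (c : ℕ) : Prop :=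
  C ⊆ V ∧ zdim C + (c : WithBot ℕ∞) = zdim V

/-- All irreducible components have the same dimension. -/
def Equidimensional {n : ℕ} (S : Set (Matrix (Fin n) (Fin n) ℂ)) : Prop :=
  ∀ C ∈ zcomponents S, ∀ D ∈ zcomponents S, zdim C = zdim D

/-- Strictly upper-triangular matrices. -/
def strictUpper (n : ℕ) : Set (Matrix (Fin n) (Fin n) ℂ) :=
  {x | ∀ i j, j ≤ i → x i j = 0}

/-- The variety of strictly upper-triangular matrices of square zero. -/
def X2 (n : ℕ) : Set (Matrix (Fin n) (Fin n) ℂ) :=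
  {x | x ∈ strictUpper n ∧ x * x = 0}

/-- The conjugation orbit of `x` under the group `GL_n`. -/
def glOrbit {n : ℕ} (x : Matrix (Fin n) (Fin n) ℂ) : Set (Matrix (Fin n) (Fin n) ℂ) :=
  {y | ∃ g : GL (Fin n) ℂ, y = (g : Matrix (Fin n) (Fin n) ℂ) * x * (g⁻¹ : GL (Fin n) ℂ)}

/-- The conjugation orbit of `x` under the group `B` of invertible upper-triangular matrices. -/
def bOrbit {n : ℕ} (x : Matrix (Fin n) (Fin n) ℂ) : Set (Matrix (Fin n) (Fin n) ℂ) :=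
  {y | ∃ b : GL (Fin n) ℂ, (b : Matrix (Fin n) (Fin n) ℂ).BlockTriangular id ∧
    y = (b : Matrix (Fin n) (Fin n) ℂ) * x * (b⁻¹ : GL (Fin n) ℂ)}

/-- The strictly upper-triangular part of the permutation matrix of `σ`. -/
def invMatrix {n : ℕ} (σ : Equiv.Perm (Fin n)) : Matrix (Fin n) (Fin n) ℂ :=
  Matrix.of fun i j => if i < j ∧ σ i = j then 1 else 0

/-- The nilpotent matrix `x` has a Jordan form whose block lengths are the row lengths of the
Young diagram with set of cells `μ` (a cell being a pair (row, column), counted from `0`):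
for all `m`, the kernel of `x ^ m` has dimension `∑ min(m, block length)`, which is the number of
cells in the first `m` columns. -/
def HasJordanType {m : ℕ} (x : Matrix (Fin m) (Fin m) ℂ) (μ : Finset (ℕ × ℕ)) : Prop :=
  IsNilpotent x ∧ ∀ k : ℕ,
    Module.finrank ℂ (LinearMap.ker (Matrix.toLin' (x ^ k))) = (μ.filter fun c => c.2 < k).card

/-- The nilpotent `GL_n`-orbit of matrices of Jordan type `μ`. -/
def nilOrbit (n : ℕ) (μ : YoungDiagram) : Set (Matrix (Fin n) (Fin n) ℂ) :=
  {x | HasJordanType x μ.cells}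

/-- Standard Young tableaux with `n` boxes and entries `1, …, n`. The entry function is `0` outside
the shape. -/
@[ext] structure StdTableau (n : ℕ) where
  shape : YoungDiagram
  entry : ℕ → ℕ → ℕ
  row_lt : ∀ i j₁ j₂, j₁ < j₂ → (i, j₂) ∈ shape.cells → entry i j₁ < entry i j₂
  col_lt : ∀ i₁ i₂ j, i₁ < i₂ → (i₂, j) ∈ shape.cells → entry i₁ j < entry i₂ j
  bij : Set.BijOn (fun c : ℕ × ℕ => entry c.1 c.2) shape.cells (Set.Icc 1 n)
  zeros : ∀ i j, (i, j) ∉ shape.cells → entry i j = 0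

/-- The boxes of `T` with entry at most `i`. -/
def StdTableau.cellsLE {n : ℕ} (T : StdTableau n) (i : ℕ) : Finset (ℕ × ℕ) :=
  T.shape.cells.filter fun c => T.entry c.1 c.2 ≤ i

/-- `T` has at most two columns. -/
def StdTableau.TwoColumn {n : ℕ} (T : StdTableau n) : Prop :=
  ∀ c ∈ T.shape.cells, c.2 < 2

/-- The strictly upper-triangular `u` such that for every `i ≤ n` the upper left `i × i` block of
`u` has Jordan type the shape formed by the boxes of `T` with entries `1, …, i`. -/
def stratum {n : ℕ} (T : StdTableau n) : Set (Matrix (Fin n) (Fin n) ℂ) :=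
  {u | u ∈ strictUpper n ∧ ∀ i (h : i ≤ n),
    HasJordanType (u.submatrix (Fin.castLE h) (Fin.castLE h)) (T.cellsLE i)}

/-- The orbital variety attached to `T`. -/
def orbitalVariety {n : ℕ} (T : StdTableau n) : Set (Matrix (Fin n) (Fin n) ℂ) :=
  zclosure (stratum T) ∩ nilOrbit n T.shape

/-- The array with rows `L`, extended by `0`. -/
def arr (L : List (List ℕ)) (i j : ℕ) : ℕ := (L.getD i []).getD j 0

/-- Construction of a tableau from the list of its rows. -/
def mkTab (n : ℕ) (L : List (List ℕ)) (hs : (L.map List.length).SortedGE)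
    (hr : ∀ c ∈ (YoungDiagram.ofRowLens (L.map List.length) hs).cells,
      ∀ j < c.2, arr L c.1 j < arr L c.1 c.2)
    (hc : ∀ c ∈ (YoungDiagram.ofRowLens (L.map List.length) hs).cells,
      ∀ i < c.1, arr L i c.2 < arr L c.1 c.2)
    (hb : (YoungDiagram.ofRowLens (L.map List.length) hs).cells.image
      (fun c => arr L c.1 c.2) = Finset.Icc 1 n)
    (hn : (YoungDiagram.ofRowLens (L.map List.length) hs).cells.card = n) : StdTableau n where
  shape := YoungDiagram.ofRowLens (L.map List.length) hs
  entry := arr L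
  row_lt i j₁ j₂ h hm := hr _ hm j₁ h
  col_lt i₁ i₂ j h hm := hc _ hm i₁ h
  bij := by
    refine ⟨fun c hm => ?_, ?_, fun v hv => ?_⟩
    · have := Finset.mem_image_of_mem (fun c : ℕ × ℕ => arr L c.1 c.2) (Finset.mem_coe.1 hm)
      rw [hb] at this
      simpa using this
    · apply Finset.injOn_of_card_image_eq
      rw [hb, hn]; simp
    · have : v ∈ Finset.Icc 1 n := by simpa using hv
      rw [← hb, Finset.mem_image] at this
      obtain ⟨c, hm, h⟩ := this
      exact ⟨c, hm, h⟩
  zeros i j h := by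
    rw [YoungDiagram.mem_cells, YoungDiagram.mem_ofRowLens] at h
    simp only [List.length_map, List.getElem_map, not_exists, not_lt] at h
    unfold arr
    by_cases hi : i < L.length
    · have := h hi
      rw [List.getD_eq_getElem _ _ hi]
      exact List.getD_eq_default _ _ this
    · rw [List.getD_eq_default L _ (not_lt.1 hi)]; simp

/-- The tableau with rows `(1,2)`, `(3,4)`, `(5)`. -/
def T₅ : StdTableau 5 := mkTab 5 [[1, 2], [3, 4], [5]]
  (by decide) (by decide) (by decide) (by decide) (by decide)

/-- The tableau with rows `(1,3)`, `(2,5)`, `(4)`. -/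
def T₅' : StdTableau 5 := mkTab 5 [[1, 3], [2, 5], [4]]
  (by decide) (by decide) (by decide) (by decide) (by decide)

/-- The tableau with rows `(1,3)`, `(2,6)`, `(4)`, `(5)`. -/
def T₆ : StdTableau 6 := mkTab 6 [[1, 3], [2, 6], [4], [5]]
  (by decide) (by decide) (by decide) (by decide) (by decide)

/-- The tableau with rows `(1,2)`, `(3,5)`, `(4)`, `(6)`. -/
def T₆' : StdTableau 6 := mkTab 6 [[1, 2], [3, 5], [4], [6]]
  (by decide) (by decide) (by decide) (by decide) (by decide)

end OrbVar

end

/-! Under conjugation by triangular matrices, every element of `X2 n` has the matrix of a set of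
disjoint arcs on `n` points, that is, of an involution, as a normal form (`exists_cfg_of_mem_X2`).
So every variety in the theorem is a finite union of orbits, and the theorem reduces to two facts
about the orbits for `n < 7`: which lie in the closure of which, and what dimension they have.

Closures. The rank of the part of a matrix in the rows from `i` and the columns up to `j` is
constant on an orbit and can only drop in the closure; for a set of arcs it is the number of arcs
inside `[i, j]`. This gives necessary inequalities. Conversely, explicit one-parameter families
degenerate an orbit by deleting an arc, by lengthening it at either end, or by making two separated
or nested arcs cross; a finite check shows that these moves reach everything the inequalities allow.
The result is `mat_mem_zclosure_iff`: orbit closures are given by the decidable order `arcLE`.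

Dimensions. For `k` arcs, parametrized families give the upper bound `k (n - k)` and the lower bound
`k (k + 1) / 2`. A proper inclusion of a relatively closed set in an irreducible one raises the
dimension by at least one. Every configuration is joined, by steps along which `arcDim` changes by
exactly one, to configurations where `arcDim` meets these bounds, above and below; hence
`zdim_rankStratum`.

Tableaux. With two columns, Jordan types of square-zero matrices are ranks, so `stratum S` is the
union of the orbits whose right end points are the entries of the second column. The noncrossing
configuration is the greatest of these, so its orbit is dense in the orbital variety
(`StdTableau.orbitalVariety_eq`). An intersection of two closures is the union of the orbits of
common lower bounds: it is irreducible exactly if there is a greatest one, and its components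
correspond to the maximal ones. What remains is a finite verification. -/

namespace OrbVar

/-! ### Irreducible components of finite unions; Krull dimension of subspaces -/

section Topology

open TopologicalSpace

variable {X : Type*} [TopologicalSpace X]

theorem isIrreducible_image_val {S : Set X} {C : Set S} :
    IsIrreducible (Subtype.val '' C) ↔ IsIrreducible C := by
  refine ⟨fun h => ⟨Set.image_nonempty.1 h.1, ?_⟩, fun h => h.image _ continuous_subtype_val.continuousOn⟩
  rintro u v hu hv ⟨x, hx, hxu⟩ ⟨y, hy, hyv⟩
  obtain ⟨u', hu', rfl⟩ := isOpen_induced_iff.1 hu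
  obtain ⟨v', hv', rfl⟩ := isOpen_induced_iff.1 hv
  obtain ⟨_, ⟨z, hz, rfl⟩, h1, h2⟩ := h.2 u' v' hu' hv' ⟨x, ⟨x, hx, rfl⟩, hxu⟩ ⟨y, ⟨y, hy, rfl⟩, hyv⟩
  exact ⟨z, hz, h1, h2⟩

theorem image_val_irreducibleComponents (S : Set X) :
    (fun C : Set S => Subtype.val '' C) '' irreducibleComponents S =
      {C | Maximal (fun D => D ⊆ S ∧ IsIrreducible D) C} := by
  ext C
  constructor
  · rintro ⟨C, hC, rfl⟩
    refine ⟨⟨by simp, isIrreducible_image_val.2 hC.1⟩, ?_⟩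
    rintro D ⟨hDS, hD⟩ hle
    have hD' : Subtype.val '' (Subtype.val ⁻¹' D : Set S) = D := by simpa using hDS
    rw [← hD'] at hle hD ⊢
    have := hC.2 (isIrreducible_image_val.1 hD) (by
      have := (Set.image_subset_image_iff Subtype.val_injective).1 hle
      exact this)
    exact Set.image_mono this
  · rintro ⟨⟨hCS, hC⟩, hmax⟩
    have hC' : Subtype.val '' (Subtype.val ⁻¹' C : Set S) = C := by simpa using hCS
    refine ⟨Subtype.val ⁻¹' C, ⟨isIrreducible_image_val.1 (by rwa [hC']), ?_⟩, hC'⟩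
    intro D hD hle
    have := hmax (y := Subtype.val '' D) ⟨by simp, isIrreducible_image_val.2 hD⟩
      (by rw [← hC']; exact Set.image_mono hle)
    intro x hx
    exact this ⟨x, hx, rfl⟩

theorem topologicalKrullDim_mono {S T : Set X} (h : S ⊆ T) :
    topologicalKrullDim S ≤ topologicalKrullDim T :=
  (Topology.IsEmbedding.inclusion h).isInducing.topologicalKrullDim_le

/-- A chain of irreducible closed subsets of `S` stays strict after taking closures in `T`, and all
its members lie in the closure of `S`; hence `T` itself can be added on top. -/
theorem topologicalKrullDim_add_one_le {S T : Set X} (hST : S ⊆ T) (hne : ¬ T ⊆ closure S)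
    (hT : IsIrreducible T) :
    topologicalKrullDim S + 1 ≤ topologicalKrullDim T := by
  have hT' : IrreducibleSpace T := Subtype.irreducibleSpace hT
  let top : IrreducibleCloseds T := ⟨Set.univ, IrreducibleSpace.isIrreducible_univ T, isClosed_univ⟩
  let f : S → T := Set.inclusion hST
  have hf : Topology.IsInducing f := (Topology.IsEmbedding.inclusion hST).isInducing
  by_cases hS : Nonempty (IrreducibleCloseds S)
  · have hTn : Nonempty (IrreducibleCloseds T) := ⟨top⟩
    unfold topologicalKrullDim
    rw [Order.krullDim_eq_iSup_length, Order.krullDim_eq_iSup_length,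
      ← WithBot.coe_one, ← WithBot.coe_add, ENat.iSup_add, WithBot.coe_le_coe, iSup_le_iff]
    intro l
    let l' := l.map (IrreducibleCloseds.map f hf.continuous)
      (IrreducibleCloseds.map_strictMono_of_isInducing hf)
    have hl : l'.last < top := by
      refine lt_of_le_of_ne (fun _ _ => trivial) fun h => hne ?_
      intro x hx
      have hx' : (⟨x, hx⟩ : T) ∈ (l'.last : IrreducibleCloseds T) := by rw [h]; trivial
      have h2 : (⟨x, hx⟩ : T) ∈ closure (f '' (l.last : Set S)) := hx'
      have h3 := image_closure_subset_closure_image (continuous_subtype_val (p := fun x => x ∈ T)) ⟨_, h2, rfl⟩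
      refine closure_mono ?_ h3
      rintro _ ⟨_, ⟨y, _, rfl⟩, rfl⟩
      exact y.2
    refine le_trans ?_ (le_iSup _ (l'.snoc top hl))
    simp [l']
  · have : topologicalKrullDim S = ⊥ := by
      have := not_nonempty_iff.1 hS
      exact Order.krullDim_eq_bot
    rw [this]; simp

/-- An irreducible set covered by finitely many closed sets lies in one of them; conversely, a dense
irreducible subset makes the whole union irreducible. -/
theorem isIrreducible_iff_maximum {ι : Type*} {D : Set ι} (hD : D.Finite) {B : ι → Set X}
    (hB : ∀ i ∈ D, IsIrreducible (B i)) :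
    IsIrreducible (⋃ i ∈ D, B i) ↔ ∃ m ∈ D, ∀ i ∈ D, B i ⊆ closure (B m) := by
  constructor
  · intro h
    have := isIrreducible_iff_sUnion_isClosed.1 h ((hD.toFinset.image fun i => closure (B i)))
      (by simp only [Finset.mem_image]; rintro _ ⟨i, _, rfl⟩; exact isClosed_closure)
      (by
        intro x hx
        simp only [Set.mem_iUnion] at hx
        obtain ⟨i, hi, hx⟩ := hx
        exact ⟨closure (B i), by simpa using ⟨i, hi, rfl⟩, subset_closure hx⟩)
    obtain ⟨t, ht, hsub⟩ := this
    simp only [Finset.mem_image, Set.Finite.mem_toFinset] at ht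
    obtain ⟨m, hm, rfl⟩ := ht
    exact ⟨m, hm, fun i hi => (Set.subset_biUnion_of_mem hi).trans hsub⟩
  · rintro ⟨m, hm, h⟩
    refine ⟨(hB m hm).nonempty.mono (Set.subset_biUnion_of_mem hm), ?_⟩
    have hsub : (⋃ i ∈ D, B i) ⊆ closure (B m) := Set.iUnion₂_subset h
    rintro u v hu hv ⟨x, hx, hxu⟩ ⟨y, hy, hyv⟩
    obtain ⟨z, hzu, hz⟩ := mem_closure_iff.1 (hsub hx) u hu hxu
    obtain ⟨w, hwv, hw⟩ := mem_closure_iff.1 (hsub hy) v hv hyv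
    obtain ⟨a, ha, hau⟩ := (hB m hm).2 u v hu hv ⟨z, hz, hzu⟩ ⟨w, hw, hwv⟩
    exact ⟨a, Set.mem_biUnion hm ha, hau⟩

/-- Each irreducible subset of the union lies in the closure of one `B i`, so the maximal ones are
the traces of the closures that are maximal among the finitely many. -/
theorem maximal_irreducible_iUnion {ι : Type*} {D : Set ι} (hD : D.Finite) {B : ι → Set X}
    (hB : ∀ i ∈ D, IsIrreducible (B i)) :
    {C | Maximal (fun E => E ⊆ (⋃ i ∈ D, B i) ∧ IsIrreducible E) C} =
      {C | ∃ m ∈ D, (∀ i ∈ D, B m ⊆ closure (B i) → B i ⊆ closure (B m)) ∧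
        C = closure (B m) ∩ ⋃ i ∈ D, B i} := by
  set Y := ⋃ i ∈ D, B i with hY
  have hBY : ∀ i ∈ D, B i ⊆ Y := fun i hi => Set.subset_biUnion_of_mem hi
  have hirr : ∀ i ∈ D, IsIrreducible (closure (B i) ∩ Y) := by
    intro i hi
    refine isIrreducible_iff_closure.1 ?_
    have : closure (closure (B i) ∩ Y) = closure (B i) := by
      refine subset_antisymm (closure_minimal Set.inter_subset_left isClosed_closure)
        (closure_mono (Set.subset_inter subset_closure (hBY i hi)))
    rw [this]
    exact isIrreducible_iff_closure.2 (hB i hi)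
  have hcov : ∀ C, C ⊆ Y → IsIrreducible C → ∃ i ∈ D, C ⊆ closure (B i) := by
    intro C hC h
    obtain ⟨t, ht, hsub⟩ := isIrreducible_iff_sUnion_isClosed.1 h
      ((hD.toFinset.image fun i => closure (B i)))
      (by simp only [Finset.mem_image]; rintro _ ⟨i, _, rfl⟩; exact isClosed_closure)
      (by
        intro x hx
        have hx := hC hx
        simp only [hY, Set.mem_iUnion] at hx
        obtain ⟨i, hi, hx⟩ := hx
        exact ⟨closure (B i), by simpa using ⟨i, hi, rfl⟩, subset_closure hx⟩)
    simp only [Finset.mem_image, Set.Finite.mem_toFinset] at ht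
    obtain ⟨m, hm, rfl⟩ := ht
    exact ⟨m, hm, hsub⟩
  ext C
  constructor
  · rintro ⟨⟨hC, hCi⟩, hmax⟩
    obtain ⟨m, hm, hsub⟩ := hcov C hC hCi
    have hCm : C = closure (B m) ∩ Y := subset_antisymm (Set.subset_inter hsub hC)
      (hmax ⟨Set.inter_subset_right, hirr m hm⟩ (Set.subset_inter hsub hC))
    refine ⟨m, hm, fun i hi h => ?_, hCm⟩
    have h1 : C ⊆ closure (B i) ∩ Y := by
      rw [hCm]
      exact Set.inter_subset_inter_left _ (closure_minimal h isClosed_closure)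
    have h2 := hmax ⟨Set.inter_subset_right, hirr i hi⟩ h1
    rw [hCm] at h2
    exact (Set.subset_inter subset_closure (hBY i hi)).trans (h2.trans Set.inter_subset_left)
  · rintro ⟨m, hm, hmax, rfl⟩
    refine ⟨⟨Set.inter_subset_right, hirr m hm⟩, ?_⟩
    rintro E ⟨hE, hEi⟩ hle
    obtain ⟨i, hi, hsub⟩ := hcov E hE hEi
    have h1 : B m ⊆ closure (B i) :=
      (Set.subset_inter subset_closure (hBY m hm)).trans (hle.trans hsub)
    exact Set.subset_inter (hsub.trans (closure_minimal (hmax i hi h1) isClosed_closure)) hE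

end Topology

end OrbVar

/-! ### Polynomial maps and the Zariski topology on matrices -/

namespace OrbVar

/-- Polynomial functions in the coordinates indexed by `ι`. -/
def IsPoly {ι : Type*} (f : (ι → ℂ) → ℂ) : Prop :=
  ∃ P : MvPolynomial ι ℂ, ∀ t, MvPolynomial.eval t P = f t

/-- Maps to a space of matrices whose entries are polynomial functions. -/
def IsPolyMap {ι m n : Type*} (φ : (ι → ℂ) → Matrix m n ℂ) : Prop :=
  ∀ i j, IsPoly fun t => φ t i j

section IsPoly

variable {ι : Type*} {f g : (ι → ℂ) → ℂ}

theorem isPoly_const (c : ℂ) : IsPoly fun _ : ι → ℂ => c := ⟨MvPolynomial.C c, by simp⟩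

theorem isPoly_coord (i : ι) : IsPoly fun t : ι → ℂ => t i := ⟨MvPolynomial.X i, by simp⟩

theorem IsPoly.add (hf : IsPoly f) (hg : IsPoly g) : IsPoly fun t => f t + g t := by
  obtain ⟨P, hP⟩ := hf
  obtain ⟨Q, hQ⟩ := hg
  exact ⟨P + Q, by simp [hP, hQ]⟩

theorem IsPoly.mul (hf : IsPoly f) (hg : IsPoly g) : IsPoly fun t => f t * g t := by
  obtain ⟨P, hP⟩ := hf
  obtain ⟨Q, hQ⟩ := hg
  exact ⟨P * Q, by simp [hP, hQ]⟩

theorem IsPoly.sum {α : Type*} (s : Finset α) {F : α → (ι → ℂ) → ℂ} (h : ∀ a ∈ s, IsPoly (F a)) :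
    IsPoly fun t => ∑ a ∈ s, F a t := by
  classical
  induction s using Finset.induction_on with
  | empty => simpa using isPoly_const 0
  | insert a s ha ih =>
    simp only [Finset.sum_insert ha]
    exact (h a (by simp)).add (ih fun b hb => h b (by simp [hb]))

theorem IsPoly.prod {α : Type*} (s : Finset α) {F : α → (ι → ℂ) → ℂ} (h : ∀ a ∈ s, IsPoly (F a)) :
    IsPoly fun t => ∏ a ∈ s, F a t := by
  classical
  induction s using Finset.induction_on with
  | empty => simpa using isPoly_const 1
  | insert a s ha ih =>
    simp only [Finset.prod_insert ha]
    exact (h a (by simp)).mul (ih fun b hb => h b (by simp [hb]))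

theorem IsPoly.ite {p : Prop} [Decidable p] (hf : IsPoly f) (hg : IsPoly g) :
    IsPoly fun t => if p then f t else g t := by
  split_ifs <;> assumption

/-- Over the infinite field `ℂ` a polynomial is determined by its values, so functions inherit the
absence of zero divisors. -/
theorem IsPoly.eq_zero_of_mul (hf : IsPoly f) (hg : IsPoly g) (h : ∀ t, f t * g t = 0) :
    (∀ t, f t = 0) ∨ ∀ t, g t = 0 := by
  obtain ⟨P, hP⟩ := hf
  obtain ⟨Q, hQ⟩ := hg
  have : P * Q = 0 := MvPolynomial.funext fun t => by simp [hP, hQ, h]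
  rcases mul_eq_zero.1 this with h | h
  · exact .inl fun t => by simp [← hP, h]
  · exact .inr fun t => by simp [← hQ, h]

theorem IsPolyMap.const {m n : Type*} (A : Matrix m n ℂ) : IsPolyMap fun _ : ι → ℂ => A :=
  fun _ _ => isPoly_const _

theorem IsPolyMap.add {m n : Type*} {φ ψ : (ι → ℂ) → Matrix m n ℂ} (hφ : IsPolyMap φ)
    (hψ : IsPolyMap ψ) : IsPolyMap fun t => φ t + ψ t :=
  fun i j => (hφ i j).add (hψ i j)

theorem IsPolyMap.smul {m n : Type*} {φ : (ι → ℂ) → Matrix m n ℂ} (hf : IsPoly f)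
    (hφ : IsPolyMap φ) : IsPolyMap fun t => f t • φ t :=
  fun i j => hf.mul (hφ i j)

theorem IsPolyMap.mul {l m n : Type*} [Fintype m] {φ : (ι → ℂ) → Matrix l m ℂ}
    {ψ : (ι → ℂ) → Matrix m n ℂ} (hφ : IsPolyMap φ) (hψ : IsPolyMap ψ) :
    IsPolyMap fun t => φ t * ψ t :=
  fun i j => IsPoly.sum Finset.univ fun k _ => (hφ i k).mul (hψ k j)

theorem IsPolyMap.det {n : Type*} [Fintype n] [DecidableEq n] {φ : (ι → ℂ) → Matrix n n ℂ}
    (hφ : IsPolyMap φ) : IsPoly fun t => (φ t).det := by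
  simp only [Matrix.det_apply']
  exact IsPoly.sum _ fun σ _ => (isPoly_const _).mul (IsPoly.prod _ fun i _ => hφ _ _)

theorem IsPolyMap.adjugate {n : Type*} [Fintype n] [DecidableEq n] {φ : (ι → ℂ) → Matrix n n ℂ}
    (hφ : IsPolyMap φ) : IsPolyMap fun t => (φ t).adjugate := by
  intro i j
  simp only [Matrix.adjugate_apply]
  refine IsPolyMap.det fun a b => ?_
  by_cases h : a = j
  · subst h
    simpa using isPoly_const _
  · simpa [Matrix.updateRow_ne h] using hφ a b

end IsPoly

/-- The value of a polynomial in the matrix entries at a matrix. -/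
noncomputable def ev {n : ℕ} (p : MvPolynomial (Fin n × Fin n) ℂ) (x : Matrix (Fin n) (Fin n) ℂ) : ℂ :=
  MvPolynomial.eval (fun q => x q.1 q.2) p

/-- Substitution of the entries of a polynomial map into a polynomial in the matrix entries. -/
theorem eval_aeval_entries {n : ℕ} {ι : Type*} (F : Fin n → Fin n → MvPolynomial ι ℂ)
    (p : MvPolynomial (Fin n × Fin n) ℂ) (t : ι → ℂ) :
    MvPolynomial.eval t (MvPolynomial.aeval (fun q : Fin n × Fin n => F q.1 q.2) p) =
      ev p (Matrix.of fun i j => MvPolynomial.eval t (F i j)) := by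
  induction p using MvPolynomial.induction_on with
  | C a => simp [ev]
  | add p q hp hq => simp_all [ev]
  | mul_X p i hp => simp_all [ev]

variable {n : ℕ} {S T : Set (Matrix (Fin n) (Fin n) ℂ)} {x y z : Matrix (Fin n) (Fin n) ℂ}

theorem IsPolyMap.comp {ι : Type*} {φ : (ι → ℂ) → Matrix (Fin n) (Fin n) ℂ} (hφ : IsPolyMap φ)
    (p : MvPolynomial (Fin n × Fin n) ℂ) : IsPoly fun t => ev p (φ t) := by
  choose F hF using hφ
  refine ⟨MvPolynomial.aeval (fun q : Fin n × Fin n => F q.1 q.2) p, fun t => ?_⟩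
  simp only [eval_aeval_entries, hF]
  rfl

theorem isPolyMap_entries : IsPolyMap fun t : Fin n × Fin n → ℂ => Matrix.of fun i j => t (i, j) :=
  fun i j => isPoly_coord (i, j)

theorem isClosed_zeros (P : Set (MvPolynomial (Fin n × Fin n) ℂ)) :
    @IsClosed _ (zariski n) {x | ∀ p ∈ P, ev p x = 0} :=
  (isClosed_zariski_iff _).2 ⟨P, rfl⟩

theorem subset_zclosure : S ⊆ zclosure S := @subset_closure _ (zariski n) S

theorem zclosure_mono (h : S ⊆ T) : zclosure S ⊆ zclosure T := @closure_mono _ (zariski n) _ _ h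

theorem zclosure_minimal (h : S ⊆ T) (hT : @IsClosed _ (zariski n) T) : zclosure S ⊆ T :=
  @closure_minimal _ (zariski n) _ _ h hT

theorem isClosed_zclosure : @IsClosed _ (zariski n) (zclosure S) :=
  @isClosed_closure _ (zariski n) _

theorem mem_zclosure_iff :
    x ∈ zclosure S ↔ ∀ p : MvPolynomial (Fin n × Fin n) ℂ, (∀ y ∈ S, ev p y = 0) → ev p x = 0 := by
  constructor
  · intro h p hp
    have := zclosure_minimal (T := {x | ∀ q ∈ ({p} : Set _), ev q x = 0}) (fun y hy q hq => by
        rw [Set.mem_singleton_iff.1 hq]; exact hp y hy) (isClosed_zeros _) h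
    exact this p rfl
  · intro h
    obtain ⟨P, hP⟩ := (isClosed_zariski_iff _).1 (isClosed_zclosure (S := S))
    rw [hP]
    exact fun p hp => h p fun y hy => by
      have : y ∈ zclosure S := subset_zclosure hy
      rw [hP] at this
      exact this p hp

/-- The hypothesis says that the vanishing ideal of `S` is prime. -/
theorem zirreducible_of_forall (hS : S.Nonempty)
    (h : ∀ p q : MvPolynomial (Fin n × Fin n) ℂ, (∀ x ∈ S, ev p x * ev q x = 0) →
      (∀ x ∈ S, ev p x = 0) ∨ ∀ x ∈ S, ev q x = 0) : ZIrreducible S := by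
  refine ⟨hS, ?_⟩
  rw [@isPreirreducible_iff_isClosed_union_isClosed _ (zariski n)]
  intro Z₁ Z₂ h₁ h₂ hsub
  by_contra hcon
  obtain ⟨P, hP⟩ := (isClosed_zariski_iff _).1 h₁
  obtain ⟨Q, hQ⟩ := (isClosed_zariski_iff _).1 h₂
  rw [not_or, Set.not_subset, Set.not_subset] at hcon
  obtain ⟨⟨x, hx, hxP⟩, y, hy, hyQ⟩ := hcon
  rw [hP] at hxP
  rw [hQ] at hyQ
  simp only [Set.mem_ofPred_eq, not_forall] at hxP hyQ
  obtain ⟨p, hp, hpx⟩ := hxP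
  obtain ⟨q, hq, hqy⟩ := hyQ
  rcases h p q (fun z hz => by
    rcases hsub hz with h | h
    · rw [hP] at h; simp [ev, h p hp]
    · rw [hQ] at h; simp [ev, h q hq]) with h | h
  · exact hpx (h x hx)
  · exact hqy (h y hy)

/-- The image of a nonempty principal open subset of an affine space is irreducible: by `key`, a
polynomial identity on the open subset holds on the whole space. -/
theorem IsPolyMap.zirreducible {ι : Type*} {φ : (ι → ℂ) → Matrix (Fin n) (Fin n) ℂ}
    (hφ : IsPolyMap φ) {f : (ι → ℂ) → ℂ} (hf : IsPoly f) (hne : ∃ t, f t ≠ 0) :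
    ZIrreducible (φ '' {t | f t ≠ 0}) := by
  obtain ⟨t₀, ht₀⟩ := hne
  have key : ∀ g : (ι → ℂ) → ℂ, IsPoly g → (∀ t, f t ≠ 0 → g t = 0) → ∀ t, g t = 0 := by
    intro g hg h
    refine (hf.eq_zero_of_mul hg fun t => ?_).resolve_left fun h => ht₀ (h t₀)
    by_cases ht : f t = 0
    · simp [ht]
    · simp [h t ht]
  refine zirreducible_of_forall ⟨_, t₀, ht₀, rfl⟩ fun p q h => ?_
  have h1 : ∀ t, ev p (φ t) * ev q (φ t) = 0 :=
    key _ ((hφ.comp p).mul (hφ.comp q)) fun t ht => h _ ⟨t, ht, rfl⟩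
  refine ((hφ.comp p).eq_zero_of_mul (hφ.comp q) h1).imp ?_ ?_ <;>
  · rintro h _ ⟨t, -, rfl⟩
    exact h t

/-- A line punctured at one point is dense in the line. -/
theorem mem_zclosure_of_line (h : ∀ t : ℂ, t ≠ 0 → y + t • z ∈ zclosure S) : y ∈ zclosure S := by
  refine mem_zclosure_iff.2 fun p hp => ?_
  have hφ : IsPolyMap fun t : Unit → ℂ => y + t () • z :=
    (IsPolyMap.const y).add (IsPolyMap.smul (isPoly_coord ()) (IsPolyMap.const z))
  have := (IsPoly.eq_zero_of_mul (isPoly_coord ()) (hφ.comp p) fun t => by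
    by_cases ht : t () = 0
    · simp [ht]
    · simp [mem_zclosure_iff.1 (h _ ht) p hp]).resolve_left fun h => by simpa using h 1
  simpa using this 0

theorem zcomponents_eq : zcomponents S = {C | Maximal (fun E => E ⊆ S ∧ ZIrreducible E) C} :=
  @image_val_irreducibleComponents _ (zariski n) S

theorem zdim_mono (h : S ⊆ T) : zdim S ≤ zdim T :=
  @topologicalKrullDim_mono _ (zariski n) _ _ h

theorem zdim_add_one_le (hST : S ⊆ T) (hne : ¬ T ⊆ zclosure S) (hT : ZIrreducible T) :
    zdim S + 1 ≤ zdim T :=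
  @topologicalKrullDim_add_one_le _ (zariski n) _ _ hST hne hT

theorem zdim_nonneg (h : ZIrreducible S) : 0 ≤ zdim S := by
  let _ := zariski n
  have : IrreducibleSpace S := Subtype.irreducibleSpace h
  have : Nonempty (TopologicalSpace.IrreducibleCloseds S) :=
    ⟨⟨Set.univ, IrreducibleSpace.isIrreducible_univ S, isClosed_univ⟩⟩
  exact Order.krullDim_nonneg

/-- By Noether normalization `A` is integral over a polynomial ring in `s` variables. Their images
in `MvPolynomial ι ℂ` are algebraically independent, so `s` is at most the transcendence degree, and
an integral extension does not raise the dimension. -/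
theorem ringKrullDim_le_of_injective_to_mvPolynomial {ι A : Type} [Finite ι] [CommRing A]
    [Algebra ℂ A] [Algebra.FiniteType ℂ A] (f : A →ₐ[ℂ] MvPolynomial ι ℂ)
    (hf : Function.Injective f) : ringKrullDim A ≤ Nat.card ι := by
  have : Nontrivial A := f.toRingHom.domain_nontrivial
  obtain ⟨s, g, hg, hint⟩ := exists_integral_inj_algHom_of_fg ℂ A
  have hs : s ≤ Nat.card ι := by
    have h1 : AlgebraicIndependent ℂ (fun i => f (g (MvPolynomial.X i))) := by
      rw [algebraicIndependent_iff_injective_aeval]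
      have : MvPolynomial.aeval (fun i => f (g (MvPolynomial.X i))) = f.comp g := by
        ext i; simp
      rw [this]
      exact hf.comp hg
    have h2 := h1.lift_cardinalMk_le_trdeg
    rw [MvPolynomial.trdeg_of_isDomain] at h2
    have : Fintype ι := Fintype.ofFinite ι
    simpa using h2
  have h1 : ringKrullDim A ≤ ringKrullDim (MvPolynomial (Fin s) ℂ) := by
    algebraize [g.toRingHom]
    refine Order.krullDim_le_of_strictMono (PrimeSpectrum.comap (algebraMap (MvPolynomial (Fin s) ℂ) A)) ?_
    intro p q hpq
    exact Ideal.IsIntegral.comap_lt_comap (R := MvPolynomial (Fin s) ℂ) hpq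
  refine h1.trans ?_
  rw [MvPolynomial.ringKrullDim_of_isNoetherianRing]
  simp only [ringKrullDim_eq_zero_of_field, Nat.card_eq_fintype_card, Fintype.card_fin, zero_add]
  exact_mod_cast hs

/-- The coordinate ring of the closure of the image embeds into the polynomial ring of the
parameters, which bounds its Krull dimension. Irreducible closed subsets give prime ideals over the
kernel `K`. -/
theorem IsPolyMap.zdim_zclosure_range_le {ι : Type} [Finite ι] {φ : (ι → ℂ) → Matrix (Fin n) (Fin n) ℂ}
    (hφ : IsPolyMap φ) : zdim (zclosure (Set.range φ)) ≤ Nat.card ι := by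
  have hφ' := hφ
  choose F hF using hφ'
  let Φ : MvPolynomial (Fin n × Fin n) ℂ →ₐ[ℂ] MvPolynomial ι ℂ :=
    MvPolynomial.aeval fun q => F q.1 q.2
  have hΦ : ∀ p t, MvPolynomial.eval t (Φ p) = ev p (φ t) := by
    intro p t
    simp only [Φ, eval_aeval_entries, hF]
    rfl
  let K := RingHom.ker Φ
  have hdim : ringKrullDim (MvPolynomial (Fin n × Fin n) ℂ ⧸ K) ≤ Nat.card ι :=
    ringKrullDim_le_of_injective_to_mvPolynomial (Ideal.kerLiftAlg Φ)
      (Ideal.kerLiftAlg_injective Φ)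
  rw [ringKrullDim_quotient] at hdim
  refine le_trans ?_ hdim
  let _ := zariski n
  let I (C : Set (zclosure (Set.range φ))) : Ideal (MvPolynomial (Fin n × Fin n) ℂ) :=
    { carrier := {p | ∀ x ∈ C, ev p x = 0}
      add_mem' := fun {p q} hp hq x hx => by
        have h1 := hp x hx
        have h2 := hq x hx
        simp only [ev] at h1 h2
        simp [ev, h1, h2]
      zero_mem' := fun x _ => by simp [ev]
      smul_mem' := fun c p hp x hx => by
        have h1 := hp x hx
        simp only [ev] at h1
        simp [ev, h1] }
  have hI : ∀ C : TopologicalSpace.IrreducibleCloseds (zclosure (Set.range φ)), (I C).IsPrime := by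
    intro C
    refine ⟨fun h => ?_, fun {p q} h => ?_⟩
    · obtain ⟨x, hx⟩ := C.isIrreducible'.nonempty
      have : (1 : MvPolynomial (Fin n × Fin n) ℂ) ∈ I C := h ▸ trivial
      simpa [ev] using this x hx
    · have hcl (p : MvPolynomial (Fin n × Fin n) ℂ) : IsClosed {x : zclosure (Set.range φ) | ev p x = 0} := by
        have := (isClosed_zeros {p}).preimage (continuous_subtype_val (p := fun x => x ∈ zclosure (Set.range φ)))
        convert this using 1
        ext; simp
      have := isPreirreducible_iff_isClosed_union_isClosed.1 C.isIrreducible'.isPreirreducible _ _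
        (hcl p) (hcl q) (fun x hx => by
          have := h x hx
          simpa [ev] using this)
      exact this.imp (fun h x hx => h hx) fun h x hx => h hx
  have hK : ∀ C : Set (zclosure (Set.range φ)), K ≤ I C := by
    rintro C p hp ⟨x, hx⟩ -
    refine mem_zclosure_iff.1 hx p ?_
    rintro _ ⟨t, rfl⟩
    have : Φ p = 0 := hp
    simp [← hΦ, this]
  have hanti : ∀ C D : TopologicalSpace.IrreducibleCloseds (zclosure (Set.range φ)), C < D → I D < I C := by
    intro C D h
    refine lt_of_le_of_ne (fun p hp x hx => hp x (h.le hx)) fun heq => h.ne (le_antisymm h.le ?_)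
    obtain ⟨Z, hZ, hCZ⟩ := isClosed_induced_iff.1 C.isClosed'
    obtain ⟨P, hP⟩ := (isClosed_zariski_iff _).1 hZ
    have hmem (x : zclosure (Set.range φ)) : x ∈ C ↔ ∀ p ∈ P, ev p x = 0 := by
      change x ∈ C.carrier ↔ _
      rw [← hCZ, hP]; rfl
    intro x hx
    refine (hmem x).2 fun p hp => ?_
    have : p ∈ I D := heq ▸ fun y hy => (hmem y).1 hy p hp
    exact this x hx
  -- Vanishing ideals reverse inclusions, so chains of closed sets are compared with chains of
  -- primes in the dual order.
  rw [← Order.krullDim_orderDual]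
  let G (C : (TopologicalSpace.IrreducibleCloseds (zclosure (Set.range φ)))ᵒᵈ) :
      PrimeSpectrum.zeroLocus (K : Set (MvPolynomial (Fin n × Fin n) ℂ)) :=
    ⟨⟨I (OrderDual.ofDual C : TopologicalSpace.IrreducibleCloseds (zclosure (Set.range φ))), hI _⟩, hK _⟩
  exact Order.krullDim_le_of_strictMono G fun C D h => hanti _ _ h

end OrbVar

/-! ### Arc configurations and normal forms under triangular conjugation -/

namespace OrbVar

/-- Two arcs without a common end point. -/
def ArcDisjoint (p q : ℕ × ℕ) : Prop := p.1 ≠ q.1 ∧ p.1 ≠ q.2 ∧ p.2 ≠ q.1 ∧ p.2 ≠ q.2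

/-- The point `i` is not an end point of an arc of `s`. -/
def free (s : List (ℕ × ℕ)) (i : ℕ) : Bool := s.all fun a => a.1 != i && a.2 != i

/-- The involutions of `{0, …, n - 1}`, as lists of arcs (with decreasing right end points). -/
def cfg : ℕ → List (List (ℕ × ℕ))
  | 0 => [[]]
  | m + 1 => cfg m ++ (cfg m).flatMap fun s =>
      ((List.range m).filter (free s)).map fun i => (i, m) :: s

/-- The `0`-`1` matrix of a set of arcs. -/
noncomputable def mat (n : ℕ) (s : List (ℕ × ℕ)) : Matrix (Fin n) (Fin n) ℂ :=
  Matrix.of fun i j => if (i.val, j.val) ∈ s then 1 else 0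

/-- Disjoint arcs on `{0, …, n - 1}`. -/
structure IsCfg (n : ℕ) (s : List (ℕ × ℕ)) : Prop where
  lt : ∀ a ∈ s, a.1 < a.2 ∧ a.2 < n
  pairwise : s.Pairwise ArcDisjoint

theorem ArcDisjoint.symm {p q : ℕ × ℕ} (h : ArcDisjoint p q) : ArcDisjoint q p :=
  ⟨h.1.symm, h.2.2.1.symm, h.2.1.symm, h.2.2.2.symm⟩

theorem free_iff {s : List (ℕ × ℕ)} {i : ℕ} : free s i ↔ ∀ a ∈ s, a.1 ≠ i ∧ a.2 ≠ i := by
  simp [free]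

theorem isCfg_of_mem {n : ℕ} : ∀ {s : List (ℕ × ℕ)}, s ∈ cfg n → IsCfg n s := by
  induction n with
  | zero => intro s hs; simp only [cfg, List.mem_singleton] at hs; subst hs; exact ⟨by simp, by simp⟩
  | succ m ih =>
    intro s hs
    simp only [cfg, List.mem_append, List.mem_flatMap, List.mem_map, List.mem_filter,
      List.mem_range] at hs
    rcases hs with hs | ⟨t, ht, i, ⟨hi, hf⟩, rfl⟩
    · exact ⟨fun a ha => ⟨((ih hs).lt a ha).1, ((ih hs).lt a ha).2.trans (Nat.lt_succ_self m)⟩,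
        (ih hs).pairwise⟩
    · refine ⟨?_, List.pairwise_cons.2 ⟨fun a ha => ?_, (ih ht).pairwise⟩⟩
      · simp only [List.mem_cons, forall_eq_or_imp]
        exact ⟨⟨hi, Nat.lt_succ_self m⟩, fun a ha =>
          ⟨((ih ht).lt a ha).1, ((ih ht).lt a ha).2.trans (Nat.lt_succ_self m)⟩⟩
      · have h1 := (ih ht).lt a ha
        have h2 := free_iff.1 hf a ha
        refine ⟨h2.1.symm, h2.2.symm, ?_, ?_⟩ <;> simp only [ne_eq] <;> omega

theorem cfg_mono {m n : ℕ} (h : m ≤ n) {s : List (ℕ × ℕ)} (hs : s ∈ cfg m) : s ∈ cfg n := by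
  induction h with
  | refl => exact hs
  | step _ ih => exact List.mem_append_left _ ih

namespace IsCfg

variable {n : ℕ} {s : List (ℕ × ℕ)} (hs : IsCfg n s)
include hs

theorem eq_or_disjoint {a b : ℕ × ℕ} (ha : a ∈ s) (hb : b ∈ s) : a = b ∨ ArcDisjoint a b := by
  by_cases h : a = b
  · exact .inl h
  · have : Std.Symm ArcDisjoint := ⟨fun _ _ h => h.symm⟩
    exact .inr (hs.pairwise.forall ha hb h)

theorem right_unique {i j k : ℕ} (h : (i, j) ∈ s) (h' : (i, k) ∈ s) : j = k := by
  rcases hs.eq_or_disjoint h h' with h | h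
  · exact (Prod.ext_iff.1 h).2
  · exact absurd rfl h.1

theorem left_unique {i j k : ℕ} (h : (i, k) ∈ s) (h' : (j, k) ∈ s) : i = j := by
  rcases hs.eq_or_disjoint h h' with h | h
  · exact (Prod.ext_iff.1 h).1
  · exact absurd rfl h.2.2.2

theorem not_left_right {i j k : ℕ} (h : (i, j) ∈ s) (h' : (j, k) ∈ s) : False := by
  rcases hs.eq_or_disjoint h h' with h'' | h''
  · have := (hs.lt _ h).1
    have := (Prod.ext_iff.1 h'').1
    simp only at *
    omega
  · exact absurd rfl h''.2.2.1

end IsCfg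

section Conj

variable {n : ℕ} {x y z : Matrix (Fin n) (Fin n) ℂ}

theorem mem_bOrbit_iff : y ∈ bOrbit x ↔
    ∃ b : Matrix (Fin n) (Fin n) ℂ, b.BlockTriangular id ∧ b.det ≠ 0 ∧ b * x = y * b := by
  constructor
  · rintro ⟨b, hb, rfl⟩
    refine ⟨b, hb, ?_, ?_⟩
    · exact ((Matrix.isUnit_iff_isUnit_det _).1 b.isUnit).ne_zero
    · simp [mul_assoc]
  · rintro ⟨b, hb, hdet, h⟩
    refine ⟨Matrix.GeneralLinearGroup.mkOfDetNeZero b hdet, hb, ?_⟩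
    have h1 : b * (((Matrix.GeneralLinearGroup.mkOfDetNeZero b hdet)⁻¹ : GL (Fin n) ℂ) :
        Matrix (Fin n) (Fin n) ℂ) = 1 := by
      have := Units.mul_inv (Matrix.GeneralLinearGroup.mkOfDetNeZero b hdet)
      exact this
    change y = b * x * _
    rw [h, mul_assoc, h1, mul_one]

theorem blockTriangular_inv_of_det {b : Matrix (Fin n) (Fin n) ℂ} (hb : b.BlockTriangular id)
    (hdet : b.det ≠ 0) : b⁻¹.BlockTriangular id := by
  have := b.invertibleOfIsUnitDet (isUnit_iff_ne_zero.2 hdet)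
  exact Matrix.blockTriangular_inv_of_blockTriangular hb

theorem mem_bOrbit_iff' : y ∈ bOrbit x ↔
    ∃ b : Matrix (Fin n) (Fin n) ℂ, b.BlockTriangular id ∧ b.det ≠ 0 ∧ y = b * x * b⁻¹ := by
  rw [mem_bOrbit_iff]
  refine exists_congr fun b => and_congr_right fun hb => and_congr_right fun hdet => ?_
  have hu := isUnit_iff_ne_zero.2 hdet
  constructor
  · intro h
    rw [h, Matrix.mul_nonsing_inv_cancel_right _ _ hu]
  · rintro rfl
    rw [Matrix.nonsing_inv_mul_cancel_right _ _ hu]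

theorem mem_bOrbit_self : x ∈ bOrbit x :=
  mem_bOrbit_iff.2 ⟨1, Matrix.blockTriangular_one, by simp, by simp⟩

theorem mem_bOrbit_symm (h : y ∈ bOrbit x) : x ∈ bOrbit y := by
  obtain ⟨b, hb, hdet, h⟩ := mem_bOrbit_iff.1 h
  have hu := isUnit_iff_ne_zero.2 hdet
  refine mem_bOrbit_iff.2 ⟨b⁻¹, blockTriangular_inv_of_det hb hdet, ?_, ?_⟩
  · simpa using hdet
  · calc b⁻¹ * y = b⁻¹ * (y * b) * b⁻¹ := by
          rw [mul_assoc, mul_assoc, Matrix.mul_nonsing_inv _ hu, mul_one]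
      _ = x * b⁻¹ := by rw [← h, Matrix.nonsing_inv_mul_cancel_left _ _ hu]

theorem mem_bOrbit_trans (h : y ∈ bOrbit x) (h' : z ∈ bOrbit y) : z ∈ bOrbit x := by
  obtain ⟨b, hb, hdet, h⟩ := mem_bOrbit_iff.1 h
  obtain ⟨c, hc, hcdet, h'⟩ := mem_bOrbit_iff.1 h'
  exact mem_bOrbit_iff.2 ⟨c * b, hc.mul hb, by simp [hdet, hcdet], by
    rw [mul_assoc, h, ← mul_assoc, h', mul_assoc]⟩

theorem bOrbit_eq (h : y ∈ bOrbit x) : bOrbit y = bOrbit x :=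
  Set.ext fun _ => ⟨mem_bOrbit_trans h, mem_bOrbit_trans (mem_bOrbit_symm h)⟩

theorem mem_strictUpper_mul {b : Matrix (Fin n) (Fin n) ℂ} (hx : x ∈ strictUpper n)
    (hb : b.BlockTriangular id) : b * x ∈ strictUpper n := by
  intro i j hij
  rw [Matrix.mul_apply]
  refine Finset.sum_eq_zero fun k _ => ?_
  rcases lt_or_ge k i with h | h
  · rw [hb h, zero_mul]
  · rw [hx k j (hij.trans h), mul_zero]

theorem mem_strictUpper_mul' {b : Matrix (Fin n) (Fin n) ℂ} (hx : x ∈ strictUpper n)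
    (hb : b.BlockTriangular id) : x * b ∈ strictUpper n := by
  intro i j hij
  rw [Matrix.mul_apply]
  refine Finset.sum_eq_zero fun k _ => ?_
  rcases lt_or_ge j k with h | h
  · rw [hb h, mul_zero]
  · rw [hx i k (h.trans hij), zero_mul]

theorem bOrbit_subset_X2 (hx : x ∈ X2 n) : bOrbit x ⊆ X2 n := by
  intro y hy
  obtain ⟨b, hb, hdet, rfl⟩ := mem_bOrbit_iff'.1 hy
  refine ⟨mem_strictUpper_mul' (mem_strictUpper_mul hx.1 hb) (blockTriangular_inv_of_det hb hdet), ?_⟩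
  have hu := isUnit_iff_ne_zero.2 hdet
  calc b * x * b⁻¹ * (b * x * b⁻¹) = b * (x * (b⁻¹ * b) * x) * b⁻¹ := by simp only [mul_assoc]
    _ = 0 := by rw [Matrix.nonsing_inv_mul _ hu, mul_one, hx.2]; simp

theorem IsCfg.mat_mem_X2 {s : List (ℕ × ℕ)} (hs : IsCfg n s) : mat n s ∈ X2 n := by
  refine ⟨fun i j hij => ?_, ?_⟩
  · simp only [mat, of_apply, ite_eq_right_iff, one_ne_zero, imp_false]
    intro h
    have h1 := (hs.lt _ h).1
    simp only at h1
    omega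
  · ext i j
    simp only [mul_apply, mat, of_apply, Matrix.zero_apply]
    refine Finset.sum_eq_zero fun k _ => ?_
    by_cases h1 : ((i : ℕ), (k : ℕ)) ∈ s
    · rw [if_neg fun h2 => hs.not_left_right h1 h2, mul_zero]
    · rw [if_neg h1, zero_mul]

end Conj

section Classification

variable {n : ℕ}

/-- Extension of a normal form from the first `m` columns to the first `m + 1` columns. -/
theorem exists_normal_column {y : Matrix (Fin n) (Fin n) ℂ} (hy : y ∈ X2 n) {m : ℕ} (hm : m < n)
    {s : List (ℕ × ℕ)} (hs : s ∈ cfg m) (h : ∀ i j : Fin n, (j : ℕ) < m → y i j = mat n s i j) :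
    ∃ t ∈ cfg (m + 1), ∃ z, y ∈ bOrbit z ∧
      ∀ i j : Fin n, (j : ℕ) < m + 1 → z i j = mat n t i j := by
  have hc := isCfg_of_mem hs
  let m' : Fin n := ⟨m, hm⟩
  let w : Fin n → ℂ := fun i => y i m'
  -- For an arc `(i, j)` the entry `v j` is `w i`, and `y` sends the `j`-th basis vector to the
  -- `i`-th. Subtracting `y *ᵥ v` thus clears column `m` at all left end points.
  let v : Fin n → ℂ := (mat n s)ᵀ *ᵥ w
  let w' : Fin n → ℂ := w - y *ᵥ v
  have hv : ∀ j : Fin n, m ≤ j → v j = 0 := by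
    intro j hj
    simp only [v, mulVec, dotProduct, transpose_apply, mat, of_apply]
    refine Finset.sum_eq_zero fun i _ => ?_
    rw [if_neg, zero_mul]
    intro h
    have := (hc.lt _ h).2
    simp only at this
    omega
  have hw : ∀ i : Fin n, m ≤ i → w i = 0 := fun i hi => hy.1 i m' hi
  have hw'm : ∀ i : Fin n, m ≤ i → w' i = 0 := by
    intro i hi
    simp only [w', Pi.sub_apply, hw i hi, mulVec, dotProduct, zero_sub, neg_eq_zero]
    refine Finset.sum_eq_zero fun k _ => ?_
    rcases lt_or_ge (k : ℕ) m with hk | hk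
    · rw [hy.1 i k (Fin.le_def.2 (hk.le.trans hi)), zero_mul]
    · rw [hv k hk, mul_zero]
  -- Since `w` is a column of `y` and `y * y = 0`, `y` kills `w'`; as `y` maps right end points to
  -- left ones, `w'` also vanishes at all right end points. So only free points remain in its
  -- support.
  have hyw : y *ᵥ w' = 0 := by
    have h1 : y *ᵥ w = 0 := by
      have : w = y *ᵥ Pi.single m' 1 := by ext i; simp [w]
      rw [this, mulVec_mulVec, hy.2, zero_mulVec]
    simp only [w', mulVec_sub, h1, mulVec_mulVec, hy.2, zero_mulVec, sub_zero]
  have hmul : ∀ u : Fin n → ℂ, (∀ j : Fin n, m ≤ j → u j = 0) → y *ᵥ u = mat n s *ᵥ u := by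
    intro u hu
    ext i
    simp only [mulVec, dotProduct]
    refine Finset.sum_congr rfl fun k _ => ?_
    rcases lt_or_ge (k : ℕ) m with hk | hk
    · rw [h i k hk]
    · rw [hu k hk, mul_zero, mul_zero]
  have hmatvec : ∀ (i j : Fin n) (u : Fin n → ℂ), ((i : ℕ), (j : ℕ)) ∈ s → (mat n s *ᵥ u) i = u j := by
    intro i j u hij
    simp only [mulVec, dotProduct]
    rw [Finset.sum_eq_single j]
    · simp [mat, hij]
    · intro k _ hk
      simp only [mat, of_apply]
      rw [if_neg fun h' => hk (Fin.ext (hc.right_unique h' hij)), zero_mul]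
    · simp
  have hleft : ∀ i j : Fin n, ((i : ℕ), (j : ℕ)) ∈ s → w' i = 0 := by
    intro i j hij
    simp only [w', Pi.sub_apply, hmul v hv]
    rw [hmatvec i j v hij]
    simp only [v, mulVec, dotProduct, transpose_apply]
    rw [Finset.sum_eq_single i]
    · simp [mat, hij]
    · intro k _ hk
      simp only [mat, of_apply]
      rw [if_neg fun h' => hk (Fin.ext (hc.left_unique h' hij)), zero_mul]
    · simp
  have hright : ∀ i j : Fin n, ((i : ℕ), (j : ℕ)) ∈ s → w' j = 0 := by
    intro i j hij
    rw [← hmatvec i j w' hij, ← hmul w' hw'm, hyw]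
    rfl
  have hfree : ∀ i : Fin n, w' i ≠ 0 → free s i := by
    intro i hi
    refine free_iff.2 fun a ha => ?_
    have h1 := hc.lt a ha
    refine ⟨fun h => hi (hleft i ⟨a.2, by omega⟩ (by rw [← h]; exact ha)),
      fun h => hi (hright ⟨a.1, by omega⟩ i (by rw [← h]; exact ha))⟩
  -- conjugation by a triangular `b` that maps the new columns to the normal form
  have main : ∀ t ∈ cfg (m + 1), ∀ b : Matrix (Fin n) (Fin n) ℂ, b.BlockTriangular id →
      b.det ≠ 0 → (∀ i j : Fin n, (j : ℕ) < m + 1 → (y * b) i j = (b * mat n t) i j) →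
      ∃ t ∈ cfg (m + 1), ∃ z, y ∈ bOrbit z ∧
        ∀ i j : Fin n, (j : ℕ) < m + 1 → z i j = mat n t i j := by
    intro t ht b hb hdet hcol
    have hu := isUnit_iff_ne_zero.2 hdet
    refine ⟨t, ht, b⁻¹ * y * b, mem_bOrbit_iff.2 ⟨b, hb, hdet, ?_⟩, fun i j hj => ?_⟩
    · rw [mul_assoc, Matrix.mul_nonsing_inv_cancel_left _ _ hu]
    · have : mat n t = b⁻¹ * (b * mat n t) := by rw [Matrix.nonsing_inv_mul_cancel_left _ _ hu]
      rw [this, mul_assoc, mul_apply, mul_apply]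
      exact Finset.sum_congr rfl fun k _ => by rw [hcol k j hj]
  have hdet_of : ∀ b : Matrix (Fin n) (Fin n) ℂ, b.BlockTriangular id → (∀ i, b i i ≠ 0) →
      b.det ≠ 0 := by
    intro b hb h
    rw [Matrix.det_of_isUpperTriangular hb]
    exact Finset.prod_ne_zero_iff.2 fun i _ => h i
  have hyv : ∀ i, ∑ k, y i k * ((1 : Matrix (Fin n) (Fin n) ℂ) k m' - v k) = w' i := by
    intro i
    simp only [mul_sub, Finset.sum_sub_distrib, w', Pi.sub_apply, mulVec, dotProduct]
    congr 1
    simp [Matrix.one_apply, w]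
  by_cases hz : w' = 0
  -- No new arc: the basis vector of index `m` is replaced by its difference with `v`, which `y`
  -- maps to `w' = 0`.
  · let b : Matrix (Fin n) (Fin n) ℂ :=
      Matrix.of fun i j => if j = m' then (1 : Matrix (Fin n) (Fin n) ℂ) i j - v i
        else (1 : Matrix (Fin n) (Fin n) ℂ) i j
    have hbt : b.BlockTriangular id := by
      intro i j hij
      have hij' : j < i := hij
      simp only [b, of_apply]
      rw [Matrix.one_apply_ne hij'.ne']
      split_ifs with h
      · rw [hv i (by rw [h] at hij'; exact (Fin.lt_def.1 hij').le), sub_zero]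
      · rfl
    refine main s (cfg_mono (Nat.le_succ m) hs) b hbt (hdet_of b hbt fun i => ?_) fun i j hj => ?_
    · simp only [b, of_apply, Matrix.one_apply_eq]
      split_ifs with h
      · rw [hv i (by rw [h]), sub_zero]; exact one_ne_zero
      · exact one_ne_zero
    · have hbmat : (b * mat n s) i j = mat n s i j := by
        rw [mul_apply, Finset.sum_eq_single i]
        · by_cases h1 : i = m'
          · have : mat n s i j = 0 := by
              simp only [mat, of_apply, ite_eq_right_iff, one_ne_zero, imp_false]
              intro h2
              have := hc.lt _ h2
              simp only [h1, m'] at this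
              omega
            simp [this]
          · simp [b, h1]
        · intro k _ hk
          simp only [b, of_apply]
          split_ifs with h1
          · have : mat n s k j = 0 := by
              simp only [mat, of_apply, ite_eq_right_iff, one_ne_zero, imp_false]
              intro h2
              have := hc.lt _ h2
              simp only [h1, m'] at this
              omega
            simp [this]
          · simp [Matrix.one_apply_ne hk.symm]
        · simp
      rw [hbmat, mul_apply]
      simp only [b, of_apply]
      by_cases h1 : j = m'
      · have hb : ∀ k, (if j = m' then (1 : Matrix (Fin n) (Fin n) ℂ) k j - v k else
            (1 : Matrix (Fin n) (Fin n) ℂ) k j) = (1 : Matrix (Fin n) (Fin n) ℂ) k m' - v k := by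
          intro k
          rw [if_pos h1, h1]
        simp only [hb]
        rw [hyv i, hz, h1]
        have : mat n s i m' = 0 := by
          simp only [mat, of_apply, ite_eq_right_iff, one_ne_zero, imp_false]
          intro h2
          have := hc.lt _ h2
          simp only [m'] at this
          omega
        rw [this]; rfl
      · have hj' : (j : ℕ) < m := by
          have : (j : ℕ) ≠ m := fun h => h1 (Fin.ext h)
          omega
        simp [h1, Matrix.one_apply, h i j hj']
  · obtain ⟨i₀, hi₀⟩ := Function.ne_iff.1 hz
    -- The last index in the support becomes the left end of the new arc: replacing the basis vector
    -- of index `a` by `w'` keeps the change of basis triangular. Column `a` stays zero because `y`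
    -- kills `w'`.
    obtain ⟨a, ha, hmax⟩ := (Finset.univ.filter fun i => w' i ≠ 0).exists_max_image id
      ⟨i₀, by simpa using hi₀⟩
    simp only [Finset.mem_filter, Finset.mem_univ, true_and, id] at ha hmax
    have ham : (a : ℕ) < m := by
      by_contra hcon
      exact ha (hw'm a (not_lt.1 hcon))
    have ham' : a ≠ m' := fun h => by rw [h] at ham; exact lt_irrefl _ ham
    let b : Matrix (Fin n) (Fin n) ℂ :=
      Matrix.of fun i j => if j = m' then (1 : Matrix (Fin n) (Fin n) ℂ) i j - v i
        else if j = a then w' i else (1 : Matrix (Fin n) (Fin n) ℂ) i j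
    have hbt : b.BlockTriangular id := by
      intro i j hij
      have hij' : j < i := hij
      simp only [b, of_apply]
      rw [Matrix.one_apply_ne hij'.ne']
      split_ifs with h h
      · rw [hv i (by rw [h] at hij'; exact (Fin.lt_def.1 hij').le), sub_zero]
      · by_contra hcon
        exact absurd (hmax i hcon) (by rw [h] at hij'; exact not_le.2 hij')
      · rfl
    have hft := hfree a ha
    have hmem : ((a : ℕ), m) :: s ∈ cfg (m + 1) := by
      simp only [cfg, List.mem_append, List.mem_flatMap, List.mem_map, List.mem_filter,
        List.mem_range]
      exact .inr ⟨s, hs, a, ⟨ham, hft⟩, rfl⟩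
    refine main _ hmem b hbt (hdet_of b hbt fun i => ?_) fun i j hj => ?_
    · simp only [b, of_apply, Matrix.one_apply_eq]
      split_ifs with h h
      · rw [hv i (by rw [h]), sub_zero]; exact one_ne_zero
      · rwa [h]
      · exact one_ne_zero
    · rw [mul_apply, mul_apply]
      by_cases h1 : j = m'
      · have h2 : ∀ k : Fin n, mat n (((a : ℕ), m) :: s) k j = if k = a then 1 else 0 := by
          intro k
          simp only [mat, of_apply, List.mem_cons, Prod.mk.injEq, h1, m', and_true]
          have : ((k : ℕ), m) ∉ s := fun h2 => by
            have := (hc.lt _ h2).2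
            simp only at this
            omega
          simp [this, Fin.ext_iff]
        simp only [h2, mul_ite, mul_one, mul_zero, Finset.sum_ite_eq', Finset.mem_univ, if_true]
        simp only [b, of_apply, h1, if_true, if_neg ham']
        exact hyv i
      · have hj' : (j : ℕ) < m := by
          have : (j : ℕ) ≠ m := fun h => h1 (Fin.ext h)
          omega
        have h2 : ∀ k : Fin n, mat n (((a : ℕ), m) :: s) k j = mat n s k j := by
          intro k
          have : (j : ℕ) ≠ m := by omega
          simp [mat, this]
        simp only [h2]
        have h3 : ∀ k : Fin n, b i k * mat n s k j =
            (1 : Matrix (Fin n) (Fin n) ℂ) i k * mat n s k j := by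
          intro k
          by_cases h4 : ((k : ℕ), (j : ℕ)) ∈ s
          · have h5 : k ≠ m' := by
              rintro rfl
              have := hc.lt _ h4
              simp only [m'] at this
              omega
            have h6 : k ≠ a := by
              rintro rfl
              exact (free_iff.1 hft _ h4).1 rfl
            simp [b, h5, h6]
          · simp [mat, h4]
        simp only [h3]
        have h4 : ∑ k, (1 : Matrix (Fin n) (Fin n) ℂ) i k * mat n s k j = y i j := by
          rw [← mul_apply, one_mul, h i j hj']
        rw [h4]
        simp only [b, of_apply, if_neg h1]
        by_cases h4 : j = a
        · simp only [if_pos h4]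
          have h5 : ∑ k, y i k * w' k = 0 := congrFun hyw i
          rw [h5, h i j hj']
          simp only [mat, of_apply]
          rw [if_neg]
          intro h6
          exact (free_iff.1 hft _ h6).2 (by rw [h4])
        · simp [if_neg h4, Matrix.one_apply]

/-- Every matrix in `X2 n` is conjugate to the matrix of an involution under the group of
triangular matrices. -/
theorem exists_cfg_of_mem_X2 {x : Matrix (Fin n) (Fin n) ℂ} (hx : x ∈ X2 n) :
    ∃ s ∈ cfg n, x ∈ bOrbit (mat n s) := by
  have key : ∀ m ≤ n, ∃ s ∈ cfg m, ∃ y, x ∈ bOrbit y ∧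
      ∀ i j : Fin n, (j : ℕ) < m → y i j = mat n s i j := by
    intro m
    induction m with
    | zero => exact fun _ => ⟨[], by simp [cfg], x, mem_bOrbit_self, by simp⟩
    | succ m ih =>
      intro hm
      obtain ⟨s, hs, y, hy, h⟩ := ih (Nat.le_of_succ_le hm)
      obtain ⟨t, ht, z, hz, h'⟩ :=
        exists_normal_column (bOrbit_subset_X2 hx (mem_bOrbit_symm hy)) hm hs h
      exact ⟨t, ht, z, mem_bOrbit_trans hz hy, h'⟩
  obtain ⟨s, hs, y, hy, h⟩ := key n le_rfl
  have : y = mat n s := by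
    ext i j
    exact h i j j.2
  exact ⟨s, hs, this ▸ hy⟩

end Classification

end OrbVar

/-! ### One-parameter degenerations of orbits -/

namespace OrbVar

set_option linter.unusedSimpArgs false

variable {n : ℕ} {x y z : Matrix (Fin n) (Fin n) ℂ}

/-- Conjugation by a fixed `b` is polynomial and preserves the orbit of `x`, hence also its closure.
-/
theorem bOrbit_subset_zclosure (h : y ∈ zclosure (bOrbit x)) : bOrbit y ⊆ zclosure (bOrbit x) := by
  intro w hw
  obtain ⟨b, hb, hdet, rfl⟩ := mem_bOrbit_iff'.1 hw
  refine mem_zclosure_iff.2 fun p hp => ?_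
  obtain ⟨q, hq⟩ := (((IsPolyMap.const b).mul isPolyMap_entries).mul (IsPolyMap.const b⁻¹)).comp p
  have hq' : ∀ v : Matrix (Fin n) (Fin n) ℂ, ev q v = ev p (b * v * b⁻¹) := fun v =>
    hq fun r => v r.1 r.2
  rw [← hq']
  refine mem_zclosure_iff.1 h q fun v hv => ?_
  rw [hq']
  exact hp _ (mem_bOrbit_trans hv (mem_bOrbit_iff'.2 ⟨b, hb, hdet, rfl⟩))

theorem zclosure_bOrbit_subset (h : y ∈ zclosure (bOrbit x)) :
    zclosure (bOrbit y) ⊆ zclosure (bOrbit x) :=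
  zclosure_minimal (bOrbit_subset_zclosure h) isClosed_zclosure

/-- A one-parameter degeneration, given by the matrix of `x` in a triangular change of basis. -/
theorem mem_zclosure_of_triangular (h : ∀ t : ℂ, t ≠ 0 → ∃ F : Matrix (Fin n) (Fin n) ℂ,
    F.BlockTriangular id ∧ (∀ i, F i i ≠ 0) ∧ x * F = F * (y + t • z)) :
    y ∈ zclosure (bOrbit x) := by
  refine mem_zclosure_of_line (z := z) fun t ht => subset_zclosure (mem_bOrbit_symm ?_)
  obtain ⟨F, hF, hd, he⟩ := h t ht
  refine mem_bOrbit_iff.2 ⟨F, hF, ?_, he.symm⟩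
  rw [Matrix.det_of_isUpperTriangular hF]
  exact Finset.prod_ne_zero_iff.2 fun i _ => hd i

/-- The rows and the columns of `N` with index in `I` are zero. -/
def ZeroAt (N : Matrix (Fin n) (Fin n) ℂ) (i : Fin n) : Prop := ∀ j, N i j = 0 ∧ N j i = 0

theorem ZeroAt.mul_single {N : Matrix (Fin n) (Fin n) ℂ} {i : Fin n} (h : ZeroAt N i) (j : Fin n)
    (c : ℂ) : N * single i j c = 0 := by
  ext a b
  simp [mul_apply, single_apply, (h a).2, ite_and]

theorem ZeroAt.single_mul {N : Matrix (Fin n) (Fin n) ℂ} {i : Fin n} (h : ZeroAt N i) (j : Fin n)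
    (c : ℂ) : single j i c * N = 0 := by
  ext a b
  simp [mul_apply, single_apply, (h b).1, ite_and]

variable {N : Matrix (Fin n) (Fin n) ℂ} {i j k l : Fin n}

theorem degenerate_remove (hij : i < j) (hj : ZeroAt N j) :
    N ∈ zclosure (bOrbit (N + single i j 1)) := by
  refine mem_zclosure_of_triangular (z := single i j 1) fun t ht =>
    ⟨1 + single j j (t - 1), ?_, ?_, ?_⟩
  · exact Matrix.blockTriangular_one.add (Matrix.blockTriangular_single le_rfl _)
  · intro a
    simp only [Matrix.add_apply, one_apply_eq, single_apply]
    split_ifs <;> simp [ht]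
  · simp [mul_add, add_mul, hj.mul_single, hj.single_mul,
      Matrix.single_mul_single_of_ne, Matrix.smul_single, hij.ne']
    ext a b
    simp only [Matrix.add_apply, single_apply]
    split_ifs <;> ring

/-- For `t ≠ 0` the entry `t` at `(i, j)` clears the entry at `(k, j)` above it by a triangular row
operation; at `t = 0` only the longer arc survives. -/
theorem degenerate_left (hki : k < i) (hij : i < j) (hi : ZeroAt N i)
    (hk : ZeroAt N k) : N + single k j 1 ∈ zclosure (bOrbit (N + single i j 1)) := by
  refine mem_zclosure_of_triangular (z := single i j 1) fun t ht =>
    ⟨1 + single i i (t⁻¹ - 1) + single k i (-t⁻¹), ?_, ?_, ?_⟩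
  · exact (Matrix.blockTriangular_one.add (Matrix.blockTriangular_single le_rfl _)).add
      (Matrix.blockTriangular_single hki.le _)
  · intro a
    simp only [Matrix.add_apply, one_apply_eq, single_apply]
    have := hki.ne
    split_ifs <;> simp [ht] <;> grind
  · have h1 := hki.trans hij
    simp [mul_add, add_mul, hi.mul_single, hi.single_mul,
      hk.mul_single, hk.single_mul, Matrix.smul_single,
      Matrix.single_mul_single_of_ne, hij.ne, hij.ne', hki.ne, hki.ne', h1.ne, h1.ne']
    ext a b
    simp only [Matrix.add_apply, single_apply]
    split_ifs <;> field_simp <;> grind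

theorem degenerate_right (hij : i < j) (hjk : j < k)  (hj : ZeroAt N j)
    (hk : ZeroAt N k) : N + single i k 1 ∈ zclosure (bOrbit (N + single i j 1)) := by
  refine mem_zclosure_of_triangular (z := single i j 1) fun t ht =>
    ⟨1 + single j j (t - 1) + single j k 1, ?_, ?_, ?_⟩
  · exact (Matrix.blockTriangular_one.add (Matrix.blockTriangular_single le_rfl _)).add
      (Matrix.blockTriangular_single hjk.le _)
  · intro a
    simp only [Matrix.add_apply, one_apply_eq, single_apply]
    have := hjk.ne
    split_ifs <;> simp [ht] <;> grind
  · have h1 := hij.trans hjk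
    simp [mul_add, add_mul, hj.mul_single, hj.single_mul,
      hk.mul_single, hk.single_mul, Matrix.smul_single,
      Matrix.single_mul_single_of_ne, hij.ne, hij.ne', hjk.ne, hjk.ne', h1.ne, h1.ne']
    ext a b
    simp only [Matrix.add_apply, single_apply]
    split_ifs <;> field_simp <;> grind

/-- The family adds `t` at `(k, l)` and `-t` at `(i, j)` to the crossing arcs `(i, k)` and `(j, l)`.
The opposite signs make the two contributions to the `(i, l)` entry of the square cancel. -/
theorem degenerate_separate (hij : i < j) (hjk : j < k) (hkl : k < l)
    (hj : ZeroAt N j) (hk : ZeroAt N k)  :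
    N + single i k 1 + single j l 1 ∈
      zclosure (bOrbit (N + single i j 1 + single k l 1)) := by
  refine mem_zclosure_of_triangular (z := single k l 1 - single i j 1) fun t ht =>
    ⟨1 + single k k (t⁻¹ - 1) + single j k 1 + single j j (-t - 1), ?_, ?_, ?_⟩
  · exact ((Matrix.blockTriangular_one.add (Matrix.blockTriangular_single le_rfl _)).add
      (Matrix.blockTriangular_single hjk.le _)).add (Matrix.blockTriangular_single le_rfl _)
  · intro a
    simp only [Matrix.add_apply, one_apply_eq, single_apply]
    have := hjk.ne
    split_ifs <;> simp [ht] <;> grind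
  · have h1 := hij.trans hjk
    have h2 := hjk.trans hkl
    have h3 := h1.trans hkl
    simp [mul_add, add_mul, hj.mul_single, hj.single_mul,
      hk.mul_single, hk.single_mul, smul_sub, mul_sub,
      Matrix.smul_single, Matrix.single_mul_single_of_ne, hij.ne, hij.ne', hjk.ne, hjk.ne', h1.ne,
      h1.ne', hkl.ne, hkl.ne', h2.ne, h2.ne', h3.ne, h3.ne']
    ext a b
    simp only [Matrix.add_apply, Matrix.sub_apply, single_apply]
    split_ifs <;> field_simp <;> grind

/-- In the rows `i, k` and the columns `l, j` the family is the block with rows `(1, 0)` and `(t,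
1)`. For `t ≠ 0` its corner entry at `(k, l)` serves as a pivot and gives the nested arcs; at `t =
0` the arcs cross. -/
theorem degenerate_nested (hik : i < k) (hkl : k < l) (hlj : l < j) (hi : ZeroAt N i)
    (hj : ZeroAt N j) (hk : ZeroAt N k) (hl : ZeroAt N l) :
    N + single i l 1 + single k j 1 ∈
      zclosure (bOrbit (N + single i j 1 + single k l 1)) := by
  refine mem_zclosure_of_triangular (z := single k l 1) fun t ht =>
    ⟨1 + single i i (-t - 1) + single k k (t⁻¹ - 1) + single i k 1 + single l j t⁻¹, ?_, ?_, ?_⟩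
  · exact (((Matrix.blockTriangular_one.add (Matrix.blockTriangular_single le_rfl _)).add
      (Matrix.blockTriangular_single le_rfl _)).add (Matrix.blockTriangular_single hik.le _)).add
      (Matrix.blockTriangular_single hlj.le _)
  · intro a
    simp only [Matrix.add_apply, one_apply_eq, single_apply]
    have := hik.ne
    have := hlj.ne
    split_ifs <;> simp [ht] <;> grind
  · have h1 := hik.trans hkl
    have h2 := hkl.trans hlj
    have h3 := h1.trans hlj
    simp [mul_add, add_mul, hi.mul_single, hj.mul_single, hi.single_mul, hj.single_mul,
      hk.mul_single, hk.single_mul, hl.mul_single, hl.single_mul,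
      Matrix.smul_single, Matrix.single_mul_single_of_ne, hik.ne, hik.ne', hkl.ne, hkl.ne', h1.ne,
      h1.ne', hlj.ne, hlj.ne', h2.ne, h2.ne', h3.ne, h3.ne']
    ext a b
    simp only [Matrix.add_apply, single_apply]
    split_ifs <;> field_simp <;> grind

end OrbVar

/-! ### The order on arc configurations and its realization by degenerations -/

namespace OrbVar

/-- The number of arcs with left end point at least `i` and right end point at most `j`. -/
def arcCount (s : List (ℕ × ℕ)) (i j : ℕ) : ℕ := s.countP fun a => Nat.ble i a.1 && Nat.ble a.2 j

/-- The order on sets of arcs given by the numbers `arcCount`; it suffices to compare them at the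
end points of arcs of the smaller set. -/
def arcLE (s t : List (ℕ × ℕ)) : Bool :=
  s.all fun a => s.all fun b => Nat.ble (arcCount s a.1 b.2) (arcCount t a.1 b.2)

/-- The number of conditions that two disjoint arcs impose on one another. -/
def arcDefect (a b : ℕ × ℕ) : ℕ :=
  if a.2 < b.1 then 2 else if b.2 < a.1 then 2
  else if a.1 < b.1 then (if a.2 < b.2 then 1 else 0) else if b.2 < a.2 then 1 else 0

/-- The dimension of the orbit of a set of arcs. -/
def arcDim (n : ℕ) : List (ℕ × ℕ) → ℕ
  | [] => 0
  | a :: s => n + a.1 - a.2 + arcDim n s - (s.map (arcDefect a)).sum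

/-- Insertion of an arc, with right end points decreasing. -/
def insertArc (a : ℕ × ℕ) : List (ℕ × ℕ) → List (ℕ × ℕ)
  | [] => [a]
  | b :: s => if b.2 < a.2 then a :: b :: s else b :: insertArc a s

/-- The elementary degenerations of a set of arcs. -/
def moves (n : ℕ) (s : List (ℕ × ℕ)) : List (List (ℕ × ℕ)) :=
  s.flatMap fun a =>
    [s.erase a] ++
    ((List.range a.1).filter (free s)).map (fun k => insertArc (k, a.2) (s.erase a)) ++
    ((List.range n).filter (fun k => decide (a.2 < k) && free s k)).map
      (fun k => insertArc (a.1, k) (s.erase a)) ++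
    (s.erase a).flatMap fun b =>
      if a.2 < b.1 then [insertArc (a.1, b.1) (insertArc (a.2, b.2) ((s.erase a).erase b))]
      else if a.1 < b.1 ∧ b.2 < a.2 then
        [insertArc (a.1, b.2) (insertArc (b.1, a.2) ((s.erase a).erase b))]
      else []

section Degenerations

variable {n : ℕ} {s r : List (ℕ × ℕ)}

theorem mem_insertArc {a p : ℕ × ℕ} : p ∈ insertArc a s ↔ p = a ∨ p ∈ s := by
  induction s with
  | nil => simp [insertArc]
  | cons b s ih =>
    simp only [insertArc]
    split_ifs <;> simp only [List.mem_cons, ih]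
    tauto

theorem mat_eq_add_single {t : List (ℕ × ℕ)} {i j : Fin n}
    (h : ∀ p, p ∈ t ↔ p = ((i : ℕ), (j : ℕ)) ∨ p ∈ r) (hr : ((i : ℕ), (j : ℕ)) ∉ r) :
    mat n t = mat n r + single i j 1 := by
  ext a b
  simp only [mat, of_apply, Matrix.add_apply, single_apply, h, Prod.mk.injEq, Fin.val_inj]
  by_cases h1 : a = i ∧ b = j
  · obtain ⟨rfl, rfl⟩ := h1
    simp [hr]
  · rw [if_neg (c := i = a ∧ j = b) (fun h2 => h1 ⟨h2.1.symm, h2.2.symm⟩), add_zero]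
    simp [h1]

theorem zeroAt_of_free {i : Fin n} (h : free r i) : ZeroAt (mat n r) i := by
  intro j
  have h' := free_iff.1 h
  simp only [mat, of_apply, ite_eq_right_iff, one_ne_zero, imp_false]
  exact ⟨fun hm => (h' _ hm).1 rfl, fun hm => (h' _ hm).2 rfl⟩

namespace IsCfg

variable (hs : IsCfg n s)
include hs

theorem nodup : s.Nodup :=
  hs.pairwise.imp fun h he => h.1 (congrArg Prod.fst he)

theorem erase (a : ℕ × ℕ) : IsCfg n (s.erase a) :=
  ⟨fun b hb => hs.lt b (List.mem_of_mem_erase hb), hs.pairwise.sublist List.erase_sublist⟩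

theorem mem_erase {a p : ℕ × ℕ} : p ∈ s.erase a ↔ p ≠ a ∧ p ∈ s := hs.nodup.mem_erase_iff

theorem free_erase {a : ℕ × ℕ} (ha : a ∈ s) : free (s.erase a) a.1 ∧ free (s.erase a) a.2 := by
  simp only [free_iff, hs.mem_erase]
  refine ⟨fun b hb => ?_, fun b hb => ?_⟩ <;>
    rcases hs.eq_or_disjoint ha hb.2 with h | h
  · exact absurd h.symm hb.1
  · exact ⟨h.1.symm, h.2.1.symm⟩
  · exact absurd h.symm hb.1
  · exact ⟨h.2.2.1.symm, h.2.2.2.symm⟩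

end IsCfg

theorem free_of_sublist {t : List (ℕ × ℕ)} {i : ℕ} (h : free s i) (hsub : ∀ p ∈ t, p ∈ s) :
    free t i :=
  free_iff.2 fun a ha => free_iff.1 h a (hsub a ha)

theorem not_mem_of_free_left {i j : ℕ} (h : free s i) : (i, j) ∉ s :=
  fun hm => (free_iff.1 h _ hm).1 rfl

theorem not_mem_of_free_right {i j : ℕ} (h : free s j) : (i, j) ∉ s :=
  fun hm => (free_iff.1 h _ hm).2 rfl

theorem mat_mem_zclosure_of_mem_moves (hs : IsCfg n s) {t : List (ℕ × ℕ)} (ht : t ∈ moves n s) :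
    mat n t ∈ zclosure (bOrbit (mat n s)) := by
  simp only [moves, List.mem_flatMap, List.mem_append, List.mem_map, List.mem_filter,
    List.mem_range, List.mem_singleton, Bool.and_eq_true, decide_eq_true_eq] at ht
  obtain ⟨a, ha, ht⟩ := ht
  have hlt := hs.lt a ha
  obtain ⟨hf1, hf2⟩ := hs.free_erase ha
  let i : Fin n := ⟨a.1, by omega⟩
  let j : Fin n := ⟨a.2, hlt.2⟩
  have hij : i < j := hlt.1
  have hr := hs.erase a
  have hs' : mat n s = mat n (s.erase a) + single i j 1 := by
    refine mat_eq_add_single (fun p => ?_) (not_mem_of_free_left hf1)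
    rw [hs.mem_erase]
    change p ∈ s ↔ p = a ∨ _
    by_cases h : p = a <;> simp [h, ha]
  have zi : ZeroAt (mat n (s.erase a)) i := zeroAt_of_free hf1
  have zj : ZeroAt (mat n (s.erase a)) j := zeroAt_of_free hf2
  have hsub : ∀ p ∈ s.erase a, p ∈ s := fun p => List.mem_of_mem_erase
  rcases ht with ((rfl | ⟨k, ⟨hk, hkf⟩, rfl⟩) | ⟨k, ⟨hk, hak, hkf⟩, rfl⟩) | ⟨b, hb, ht⟩
  · rw [hs']
    exact degenerate_remove hij zj
  · let k' : Fin n := ⟨k, by omega⟩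
    have hkf' : free (s.erase a) k := free_of_sublist hkf hsub
    have h : mat n (insertArc (k, a.2) (s.erase a)) = mat n (s.erase a) + single k' j 1 :=
      mat_eq_add_single (fun p => mem_insertArc) (not_mem_of_free_left hkf')
    rw [hs', h]
    exact degenerate_left (k := k') hk hij zi (zeroAt_of_free hkf')
  · let k' : Fin n := ⟨k, hk⟩
    have hkf' : free (s.erase a) k := free_of_sublist hkf hsub
    have h : mat n (insertArc (a.1, k) (s.erase a)) = mat n (s.erase a) + single i k' 1 :=
      mat_eq_add_single (fun p => mem_insertArc) (not_mem_of_free_right hkf')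
    rw [hs', h]
    exact degenerate_right (k := k') hij hak zj (zeroAt_of_free hkf')
  · have hltb := hr.lt b hb
    obtain ⟨hfb1, hfb2⟩ := hr.free_erase hb
    let k : Fin n := ⟨b.1, by omega⟩
    let l : Fin n := ⟨b.2, hltb.2⟩
    have hkl : k < l := hltb.1
    set q := (s.erase a).erase b with hq
    have hsubq : ∀ p ∈ q, p ∈ s.erase a := fun p => List.mem_of_mem_erase
    have hfq1 : free q a.1 := free_of_sublist hf1 hsubq
    have hfq2 : free q a.2 := free_of_sublist hf2 hsubq
    have hr' : mat n (s.erase a) = mat n q + single k l 1 := by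
      refine mat_eq_add_single (fun p => ?_) (not_mem_of_free_left hfb1)
      rw [hr.mem_erase]
      change p ∈ s.erase a ↔ p = b ∨ _
      by_cases h : p = b <;> simp [h, hb]
    rw [hs', hr', add_right_comm]
    have hdis : ArcDisjoint a b := (hs.eq_or_disjoint ha (hsub b hb)).resolve_left
      fun h => (hs.mem_erase.1 hb).1 h.symm
    split_ifs at ht with h1 h2
    · rw [List.mem_singleton.1 ht]
      have e1 : mat n (insertArc (a.2, b.2) q) = mat n q + single j l 1 :=
        mat_eq_add_single (fun p => mem_insertArc) (not_mem_of_free_left hfq2)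
      have e2 : mat n (insertArc (a.1, b.1) (insertArc (a.2, b.2) q)) =
          mat n (insertArc (a.2, b.2) q) + single i k 1 := by
        refine mat_eq_add_single (fun p => mem_insertArc) ?_
        rw [mem_insertArc, not_or]
        refine ⟨fun h => ?_, not_mem_of_free_left hfq1⟩
        have := (Prod.ext_iff.1 h).1
        simp only [i] at this
        omega
      rw [e2, e1, add_right_comm _ (single j l 1)]
      exact degenerate_separate hij (k := k) h1 hkl (zeroAt_of_free hfq2) (zeroAt_of_free hfb1)
    · rw [List.mem_singleton.1 ht]
      have e1 : mat n (insertArc (b.1, a.2) q) = mat n q + single k j 1 :=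
        mat_eq_add_single (fun p => mem_insertArc) (not_mem_of_free_left hfb1)
      have e2 : mat n (insertArc (a.1, b.2) (insertArc (b.1, a.2) q)) =
          mat n (insertArc (b.1, a.2) q) + single i l 1 := by
        refine mat_eq_add_single (fun p => mem_insertArc) ?_
        rw [mem_insertArc, not_or]
        refine ⟨fun h => ?_, not_mem_of_free_left hfq1⟩
        have := (Prod.ext_iff.1 h).1
        simp only [i] at this
        omega
      rw [e2, e1, add_right_comm _ (single k j 1)]
      exact degenerate_nested (k := k) (l := l) h2.1 hkl h2.2 (zeroAt_of_free hfq1)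
        (zeroAt_of_free hfq2) (zeroAt_of_free hfb1) (zeroAt_of_free hfb2)
    · simp at ht

/-- The drop of `arcDim` makes induction along moves terminate. -/
theorem moves_mem_cfg : ∀ n < 7, ∀ s ∈ cfg n, ∀ t ∈ moves n s,
    t ∈ cfg n ∧ arcDim n t < arcDim n s := by
  decide +kernel

/-- The combinatorial core: above every `t` strictly below `s` there is already an elementary
degeneration of `s`, so iterating the moves descends from `s` to `t`. -/
theorem exists_move_of_arcLE : ∀ n < 7, ∀ s ∈ cfg n, ∀ t ∈ cfg n, arcLE t s →
    t = s ∨ ∃ m ∈ moves n s, arcLE t m := by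
  decide +kernel

theorem mat_mem_zclosure_of_arcLE (hn : n < 7) (hs : s ∈ cfg n) {t : List (ℕ × ℕ)}
    (ht : t ∈ cfg n) (h : arcLE t s) :
    mat n t ∈ zclosure (bOrbit (mat n s)) ∧ (t = s ∨ arcDim n t < arcDim n s) := by
  induction hd : arcDim n s using Nat.strong_induction_on generalizing s with
  | _ d ih =>
    rcases exists_move_of_arcLE n hn s hs t ht h with rfl | ⟨m, hm, hle⟩
    · exact ⟨subset_zclosure mem_bOrbit_self, .inl rfl⟩
    · obtain ⟨hmc, hmd⟩ := moves_mem_cfg n hn s hs m hm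
      obtain ⟨h1, h2⟩ := ih _ (hd ▸ hmd) hmc hle rfl
      refine ⟨zclosure_bOrbit_subset (mat_mem_zclosure_of_mem_moves (isCfg_of_mem hs) hm) h1, .inr ?_⟩
      rcases h2 with rfl | h2 <;> omega

end Degenerations

/-! ### Ranks of corners as obstructions to degeneration -/

section Rank

variable {n : ℕ} {s t : List (ℕ × ℕ)} {x y : Matrix (Fin n) (Fin n) ℂ}

/-- The part of a matrix in the rows from `i` and the columns up to `j`. -/
noncomputable def cut (i j : ℕ) (x : Matrix (Fin n) (Fin n) ℂ) : Matrix (Fin n) (Fin n) ℂ :=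
  Matrix.of fun a b => if i ≤ a ∧ (b : ℕ) ≤ j then x a b else 0

theorem cut_eq (i j : ℕ) (x : Matrix (Fin n) (Fin n) ℂ) :
    cut i j x = diagonal (fun a : Fin n => if i ≤ a then 1 else 0) * x *
      diagonal (fun b : Fin n => if (b : ℕ) ≤ j then 1 else 0) := by
  ext a b
  simp [cut, diagonal_mul, mul_diagonal, ite_and]
  split_ifs <;> rfl

/-- A triangular matrix maps rows from `i` on to rows from `i` on, and likewise for the columns up
to `j`. So the corner of a conjugate is a product with the corner of `x` as a factor. -/
theorem rank_cut_le (h : y ∈ bOrbit x) (i j : ℕ) : (cut i j y).rank ≤ (cut i j x).rank := by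
  obtain ⟨b, hb, hdet, rfl⟩ := mem_bOrbit_iff'.1 h
  have hb' := blockTriangular_inv_of_det hb hdet
  set P : Matrix (Fin n) (Fin n) ℂ := diagonal (fun a : Fin n => if i ≤ a then 1 else 0) with hP
  set Q : Matrix (Fin n) (Fin n) ℂ := diagonal (fun b : Fin n => if (b : ℕ) ≤ j then 1 else 0) with hQ
  have h1 : P * b = P * b * P := by
    ext a c
    simp only [hP, diagonal_mul, mul_diagonal]
    split_ifs with h h' <;> simp
    exact hb (show c < a from Fin.lt_def.2 (by omega))
  have h2 : b⁻¹ * Q = Q * b⁻¹ * Q := by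
    ext a c
    simp only [hQ, diagonal_mul, mul_diagonal]
    split_ifs with h h' <;> simp
    exact hb' (show c < a from Fin.lt_def.2 (by omega))
  have : cut i j (b * x * b⁻¹) = P * b * cut i j x * (b⁻¹ * Q) := by
    rw [cut_eq, cut_eq, ← hP, ← hQ]
    calc P * (b * x * b⁻¹) * Q = (P * b) * x * (b⁻¹ * Q) := by simp only [mul_assoc]
      _ = (P * b * P) * x * (Q * b⁻¹ * Q) := by rw [← h1, ← h2]
      _ = _ := by simp only [mul_assoc]
  rw [this]
  exact (rank_mul_le_left _ _).trans (rank_mul_le_right _ _)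

theorem rank_mat_le (s : List (ℕ × ℕ)) : (mat n s).rank ≤ s.length := by
  classical
  refine (rank_le_card_of_support_subset _
    (Finset.univ.filter fun i : Fin n => (i : ℕ) ∈ s.map Prod.fst) ?_).trans ?_
  · intro i hi
    simp only [Function.mem_support] at hi
    obtain ⟨j, hj⟩ := Function.ne_iff.1 hi
    have : ((i : ℕ), (j : ℕ)) ∈ s := by
      by_contra hcon
      exact hj (by simp [Matrix.row, mat, hcon])
    simp only [Finset.coe_filter, Finset.mem_univ, true_and]
    exact List.mem_map.2 ⟨_, this, rfl⟩
  · have h1 : (Finset.univ.filter fun i : Fin n => (i : ℕ) ∈ s.map Prod.fst).card ≤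
        (s.map Prod.fst).toFinset.card :=
      Finset.card_le_card_of_injOn Fin.val (fun i hi => by simpa using hi) (Fin.val_injective.injOn)
    exact h1.trans ((List.toFinset_card_le _).trans (by simp))

theorem rank_cut_mat_le (s : List (ℕ × ℕ)) (i j : ℕ) : (cut i j (mat n s)).rank ≤ arcCount s i j := by
  have : cut i j (mat n s) = mat n (s.filter fun a => Nat.ble i a.1 && Nat.ble a.2 j) := by
    ext a b
    simp [cut, mat, ite_and]
    split_ifs <;> simp_all
  rw [this, arcCount, List.countP_eq_length_filter]
  exact rank_mat_le _

theorem IsCfg.submatrix_eq_one (hs : IsCfg n s) {l : List (ℕ × ℕ)} (hl : l.Sublist s)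
    {f g : Fin l.length → Fin n} (hf : ∀ k, (f k : ℕ) = l[k].1) (hg : ∀ k, (g k : ℕ) = l[k].2) :
    (mat n s).submatrix f g = 1 := by
  ext k k'
  have hnd : l.Nodup := hs.nodup.sublist hl
  have hmem : ∀ k : Fin l.length, l[k] ∈ s := fun k => hl.subset (List.getElem_mem _)
  simp only [submatrix_apply, mat, of_apply, hf, hg, one_apply]
  congr 1
  refine propext ⟨fun h => ?_, ?_⟩
  · have h1 := hs.right_unique (hmem k) h
    have h2 := hs.left_unique h (hmem k')
    have h3 : l[k] = l[k'] := Prod.ext h2 h1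
    exact Fin.ext ((List.Nodup.getElem_inj_iff hnd).1 h3)
  · rintro rfl
    exact hmem k

/-- The arcs of `t` inside `[i, j]` select a minor, with their left ends as rows and right ends as
columns, that equals `1` at `mat n t`. If `s` had fewer arcs there, the corner rank would force this
minor to vanish on the orbit of `mat n s` and thus on its closure. -/
theorem arcCount_le_of_mem_zclosure (ht : IsCfg n t)
    (h : mat n t ∈ zclosure (bOrbit (mat n s))) (i j : ℕ) : arcCount t i j ≤ arcCount s i j := by
  by_contra! hcon
  set l := t.filter fun a => Nat.ble i a.1 && Nat.ble a.2 j with hl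
  have hll : arcCount t i j = l.length := List.countP_eq_length_filter
  have hsub : l.Sublist t := List.filter_sublist
  have hmem : ∀ k : Fin l.length, l[k] ∈ t ∧ i ≤ l[k].1 ∧ l[k].2 ≤ j := by
    intro k
    have : l[k] ∈ l := List.getElem_mem _
    have := List.mem_filter.1 this
    simpa using this
  have hlt : ∀ k : Fin l.length, l[k].1 < n ∧ l[k].2 < n := fun k => by
    have := ht.lt _ (hmem k).1
    omega
  let f : Fin l.length → Fin n := fun k => ⟨l[k].1, (hlt k).1⟩
  let g : Fin l.length → Fin n := fun k => ⟨l[k].2, (hlt k).2⟩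
  have hp : IsPolyMap fun u : Fin n × Fin n → ℂ => (Matrix.of fun k k' => u (f k, g k')) :=
    fun k k' => isPoly_coord _
  obtain ⟨p, hp⟩ := hp.det
  have hev : ∀ x : Matrix (Fin n) (Fin n) ℂ, ev p x = (x.submatrix f g).det := fun x =>
    hp fun q => x q.1 q.2
  have h0 := mem_zclosure_iff.1 h p fun y hy => by
    rw [hev]
    by_contra hne
    have h1 := rank_of_det_ne_zero hne
    have h2 : y.submatrix f g = (cut i j y).submatrix f g := by
      ext k k'
      exact (if_pos (⟨(hmem k).2.1, (hmem k').2.2⟩ : i ≤ (f k : ℕ) ∧ (g k' : ℕ) ≤ j)).symm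
    rw [h2] at h1
    have h3 := rank_submatrix_le (cut i j y) f g
    have h4 := rank_cut_le hy i j
    have h5 := rank_cut_mat_le (n := n) s i j
    simp only [Fintype.card_fin] at h1
    omega
  rw [hev, ht.submatrix_eq_one hsub (fun _ => rfl) (fun _ => rfl), det_one] at h0
  exact one_ne_zero h0

theorem IsCfg.rank_mat (hs : IsCfg n s) : (mat n s).rank = s.length := by
  refine le_antisymm (rank_mat_le s) ?_
  have hlt : ∀ k : Fin s.length, s[k].1 < n ∧ s[k].2 < n := fun k => by
    have := hs.lt _ (List.getElem_mem k.2)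
    simp only [Fin.getElem_fin]
    omega
  have h := rank_submatrix_le (mat n s) (fun k => ⟨s[k].1, (hlt k).1⟩) (fun k => ⟨s[k].2, (hlt k).2⟩)
  rwa [hs.submatrix_eq_one (List.Sublist.refl s) (fun _ => rfl) (fun _ => rfl), rank_one,
    Fintype.card_fin] at h

/-- Necessity comes from minors, for every `n`; sufficiency from the moves, which is where `n < 7`
enters. -/
theorem mat_mem_zclosure_iff (hn : n < 7) (hs : s ∈ cfg n) (ht : t ∈ cfg n) :
    mat n t ∈ zclosure (bOrbit (mat n s)) ↔ arcLE t s := by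
  refine ⟨fun h => ?_, fun h => (mat_mem_zclosure_of_arcLE hn hs ht h).1⟩
  simp only [arcLE, List.all_eq_true, Nat.ble_eq]
  exact fun a _ b _ => arcCount_le_of_mem_zclosure (isCfg_of_mem ht) h _ _

theorem isClosed_X2 : @IsClosed _ (zariski n) (X2 n) := by
  let A : Set (MvPolynomial (Fin n × Fin n) ℂ) := {p | ∀ x ∈ X2 n, ev p x = 0}
  convert isClosed_zeros A using 1
  refine subset_antisymm (fun x hx p hp => hp x hx) fun x hx => ⟨fun i j hij => ?_, ?_⟩
  · obtain ⟨p, hp⟩ : IsPoly fun u : Fin n × Fin n → ℂ => u (i, j) := isPoly_coord _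
    have hev : ∀ x : Matrix (Fin n) (Fin n) ℂ, ev p x = x i j := fun x => hp fun q => x q.1 q.2
    rw [← hev x]
    exact hx p fun y hy => by rw [hev]; exact hy.1 i j hij
  · ext i j
    obtain ⟨p, hp⟩ := isPolyMap_entries.mul (isPolyMap_entries (n := n)) i j
    have hev : ∀ x : Matrix (Fin n) (Fin n) ℂ, ev p x = (x * x) i j := fun x => hp fun q => x q.1 q.2
    rw [← hev x]
    exact hx p fun y hy => by rw [hev, hy.2]; rfl

theorem zclosure_bOrbit_subset_X2 (hx : x ∈ X2 n) : zclosure (bOrbit x) ⊆ X2 n :=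
  zclosure_minimal (bOrbit_subset_X2 hx) isClosed_X2

theorem arcLE_antisymm (hn : n < 7) (hs : s ∈ cfg n) (ht : t ∈ cfg n) (h : arcLE s t)
    (h' : arcLE t s) : s = t := by
  rcases (mat_mem_zclosure_of_arcLE hn hs ht h').2 with h1 | h1
  · exact h1.symm
  · rcases (mat_mem_zclosure_of_arcLE hn ht hs h).2 with h2 | h2
    · exact h2
    · omega

theorem bOrbit_mat_inj (hn : n < 7) (hs : s ∈ cfg n) (ht : t ∈ cfg n) :
    bOrbit (mat n s) = bOrbit (mat n t) ↔ s = t := by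
  refine ⟨fun h => ?_, fun h => h ▸ rfl⟩
  refine arcLE_antisymm hn hs ht ?_ ?_
  · rw [← mat_mem_zclosure_iff hn ht hs, ← h]
    exact subset_zclosure mem_bOrbit_self
  · rw [← mat_mem_zclosure_iff hn hs ht, h]
    exact subset_zclosure mem_bOrbit_self

end Rank

end OrbVar

/-! ### Irreducibility of orbits and explicit bounds for their dimension -/

namespace OrbVar

section Irreducible

variable {n : ℕ} {s : List (ℕ × ℕ)}

/-- The left end points of the arcs of `s`. -/
def IsLeft (s : List (ℕ × ℕ)) (i : Fin n) : Prop := (i : ℕ) ∈ s.map Prod.fst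

instance : DecidablePred (IsLeft (n := n) s) := fun i =>
  inferInstanceAs (Decidable ((i : ℕ) ∈ s.map Prod.fst))

theorem isLeft_of_mem {i j : ℕ} (hi : i < n) (h : (i, j) ∈ s) : IsLeft s (⟨i, hi⟩ : Fin n) :=
  List.mem_map.2 ⟨_, h, rfl⟩

theorem IsCfg.not_isLeft (hs : IsCfg n s) {i : ℕ} {j : Fin n} (h : (i, (j : ℕ)) ∈ s) :
    ¬ IsLeft s j := by
  intro hj
  obtain ⟨⟨_, k⟩, hk, rfl⟩ := List.mem_map.1 hj
  exact hs.not_left_right h hk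

/-- Rescaling the basis vectors at left end points multiplies `mat n s` by a scalar, since no left
end point is a right one. This absorbs the determinant when the adjugate replaces the inverse. -/
theorem IsCfg.smul_mat_mem_bOrbit (hs : IsCfg n s) {c : ℂ} (hc : c ≠ 0) :
    c • mat n s ∈ bOrbit (mat n s) := by
  refine mem_bOrbit_iff.2 ⟨diagonal fun i => if IsLeft s i then c else 1,
    Matrix.blockTriangular_diagonal _, ?_, ?_⟩
  · rw [det_diagonal]
    refine Finset.prod_ne_zero_iff.2 fun i _ => ?_
    split_ifs
    exacts [hc, one_ne_zero]
  · ext i j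
    rw [diagonal_mul, mul_diagonal]
    by_cases h : ((i : ℕ), (j : ℕ)) ∈ s
    · rw [if_pos (isLeft_of_mem i.2 h), if_neg (hs.not_isLeft h)]
      simp
    · simp [mat, h]

theorem IsCfg.zirreducible_bOrbit (hs : IsCfg n s) : ZIrreducible (bOrbit (mat n s)) := by
  let b : (Option (Fin n × Fin n) → ℂ) → Matrix (Fin n) (Fin n) ℂ := fun t =>
    Matrix.of fun i j => if i ≤ j then t (some (i, j)) else 0
  have hb : IsPolyMap b := fun i j => (isPoly_coord _).ite (isPoly_const 0)
  have hbt : ∀ t, (b t).BlockTriangular id := by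
    intro t i j hij
    have hij' : j < i := hij
    simp [b, not_le.2 hij']
  -- The adjugate keeps the parametrization polynomial. The extra coordinate `t none` can be set to
  -- the inverse of the determinant, and any other nonzero value only rescales the result within the
  -- orbit.
  let φ : (Option (Fin n × Fin n) → ℂ) → Matrix (Fin n) (Fin n) ℂ := fun t =>
    t none • (b t * mat n s * (b t).adjugate)
  have hφ : IsPolyMap φ :=
    IsPolyMap.smul (isPoly_coord none) ((hb.mul (IsPolyMap.const _)).mul hb.adjugate)
  let f : (Option (Fin n × Fin n) → ℂ) → ℂ := fun t => t none * (b t).det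
  have hf : IsPoly f := (isPoly_coord none).mul hb.det
  convert hφ.zirreducible hf ?_ using 1
  · ext y
    constructor
    · intro hy
      obtain ⟨c, hc, hdet, rfl⟩ := mem_bOrbit_iff'.1 hy
      let t : Option (Fin n × Fin n) → ℂ := fun o => o.elim c.det⁻¹ fun p => c p.1 p.2
      have hbc : b t = c := by
        ext i j
        simp only [b, of_apply, t, Option.elim_some]
        split_ifs with h
        · rfl
        · exact (hc (not_le.1 h)).symm
      refine ⟨t, ?_, ?_⟩
      · simp only [Set.mem_ofPred_eq, f, hbc]
        simpa [t] using hdet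
      · simp only [φ, hbc]
        rw [Matrix.inv_def, Ring.inverse_eq_inv', Matrix.mul_smul]
        rfl
    · rintro ⟨t, ht, rfl⟩
      simp only [Set.mem_ofPred_eq, f, mul_ne_zero_iff] at ht
      refine mem_bOrbit_trans (hs.smul_mat_mem_bOrbit (c := t none * (b t).det)
        (mul_ne_zero ht.1 ht.2)) (mem_bOrbit_iff.2 ⟨b t, hbt t, ht.2, ?_⟩)
      simp only [φ, Matrix.smul_mul, mul_assoc, Matrix.adjugate_mul, Matrix.mul_smul, smul_smul,
        mul_one]
  · refine ⟨fun o => o.elim 1 fun p => (1 : Matrix (Fin n) (Fin n) ℂ) p.1 p.2, ?_⟩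
    have : b (fun o => o.elim 1 fun p => (1 : Matrix (Fin n) (Fin n) ℂ) p.1 p.2) = 1 := by
      ext i j
      simp only [b, of_apply, Option.elim_some]
      split_ifs with h
      · rfl
      · rw [one_apply_ne (not_le.1 h).ne']
    simp [f, this]

end Irreducible

section UpperBound

variable {n : ℕ} {s : List (ℕ × ℕ)}

theorem IsCfg.card_isLeft (hs : IsCfg n s) : Fintype.card {i : Fin n // IsLeft s i} = s.length := by
  rw [Fintype.card_subtype]
  have hnd : (s.map Prod.fst).Nodup := by
    refine List.pairwise_map.2 (hs.pairwise.imp fun h => h.1)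
  rw [← List.length_map (as := s) Prod.fst, ← List.toFinset_card_of_nodup hnd]
  refine Finset.card_bij (fun i _ => (i : ℕ)) (fun i hi => ?_) (fun _ _ _ _ => Fin.ext)
    fun i hi => ?_
  · exact List.mem_toFinset.2 (Finset.mem_filter.1 hi).2
  · obtain ⟨a, ha, rfl⟩ := List.mem_map.1 (List.mem_toFinset.1 hi)
    have := hs.lt a ha
    exact ⟨⟨a.1, by omega⟩, Finset.mem_filter.2 ⟨Finset.mem_univ _, List.mem_map.2 ⟨a, ha, rfl⟩⟩, rfl⟩

/-- The orbit of `mat n s` lies in the image of an affine space of dimension `k * (n - k)`, where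
`k` is the number of arcs: a matrix of the orbit is determined by its rows with index in `IsLeft s`
and by the basis of its column space that is reduced with respect to these rows. -/
theorem IsCfg.zdim_zclosure_bOrbit_le (hs : IsCfg n s) :
    zdim (zclosure (bOrbit (mat n s))) ≤ ((s.length * (n - s.length) : ℕ) : WithBot ℕ∞) := by
  let ι := {i : Fin n // IsLeft s i} × {i : Fin n // ¬ IsLeft s i}
  have hι : Nat.card ι = s.length * (n - s.length) := by
    rw [Nat.card_prod, Nat.card_eq_fintype_card, Nat.card_eq_fintype_card,
      Fintype.card_subtype_compl, hs.card_isLeft, Fintype.card_fin]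
  -- Each pair of a left end point `i` and another point `a` needs only one parameter: by
  -- triangularity it is used in `Q` if `a < i` and in `Y` if `i < a`.
  let Q : (ι → ℂ) → Matrix (Fin n) (Fin n) ℂ := fun t => Matrix.of fun a i =>
    if h : IsLeft s i ∧ ¬ IsLeft s a ∧ a < i then t (⟨i, h.1⟩, ⟨a, h.2.1⟩) else 0
  let Y : (ι → ℂ) → Matrix (Fin n) (Fin n) ℂ := fun t => Matrix.of fun i a =>
    if h : IsLeft s i ∧ ¬ IsLeft s a ∧ i < a then t (⟨i, h.1⟩, ⟨a, h.2.1⟩) else 0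
  have hQ : IsPolyMap Q := by
    intro a i
    by_cases h : IsLeft s i ∧ ¬ IsLeft s a ∧ a < i
    · simpa only [Q, of_apply, dif_pos h] using isPoly_coord _
    · simpa only [Q, of_apply, dif_neg h] using isPoly_const _
  have hY : IsPolyMap Y := by
    intro i a
    by_cases h : IsLeft s i ∧ ¬ IsLeft s a ∧ i < a
    · simpa only [Y, of_apply, dif_pos h] using isPoly_coord _
    · simpa only [Y, of_apply, dif_neg h] using isPoly_const _
  let P : Matrix (Fin n) (Fin n) ℂ := diagonal fun i => if IsLeft s i then 1 else 0
  let φ : (ι → ℂ) → Matrix (Fin n) (Fin n) ℂ := fun t =>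
    (P + Q t) * (Y t + (-1 : ℂ) • (Y t * Q t))
  have hφ : IsPolyMap φ := ((IsPolyMap.const P).add hQ).mul
    (hY.add (IsPolyMap.smul (isPoly_const _) (hY.mul hQ)))
  rw [← hι]
  refine (zdim_mono (zclosure_mono ?_)).trans hφ.zdim_zclosure_range_le
  intro x hx
  have hx2 := bOrbit_subset_X2 hs.mat_mem_X2 hx
  obtain ⟨b, hb, hdet, hxb⟩ := mem_bOrbit_iff'.1 hx
  have hu := isUnit_iff_ne_zero.2 hdet
  have hPP : P * P = P := by simp [P]
  have hPN : P * mat n s = mat n s := by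
    ext i j
    rw [diagonal_mul]
    by_cases h : ((i : ℕ), (j : ℕ)) ∈ s
    · rw [if_pos (isLeft_of_mem i.2 h), one_mul]
    · simp [mat, h]
  have hNP : mat n s * P = 0 := by
    ext i j
    rw [mul_diagonal]
    by_cases h : ((i : ℕ), (j : ℕ)) ∈ s
    · rw [if_neg (hs.not_isLeft h), mul_zero]; rfl
    · simp [mat, h]
  have hPt : P.BlockTriangular id := Matrix.blockTriangular_diagonal _
  -- `M` is the block of `b` at the left end points, extended by the identity; dividing by it
  -- normalizes the basis of the column space of `x`.
  set M : Matrix (Fin n) (Fin n) ℂ := P * b * P + (1 - P) with hM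
  have hMt : M.BlockTriangular id :=
    ((hPt.mul hb).mul hPt).add (Matrix.blockTriangular_one.sub hPt)
  have hMdet : M.det ≠ 0 := by
    rw [Matrix.det_of_isUpperTriangular hMt]
    rw [Matrix.det_of_isUpperTriangular hb] at hdet
    refine Finset.prod_ne_zero_iff.2 fun i hi => ?_
    have := Finset.prod_ne_zero_iff.1 hdet i hi
    simp only [hM, P, Matrix.add_apply, mul_diagonal, diagonal_mul, Matrix.sub_apply, one_apply_eq,
      diagonal_apply_eq]
    split_ifs <;> simp [this]
  have hMu := isUnit_iff_ne_zero.2 hMdet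
  have hPM : P * M = P * b * P := by
    rw [hM, mul_add, mul_sub, mul_one, hPP, sub_self, add_zero, ← mul_assoc, ← mul_assoc, hPP]
  have hMP : M * P = P * b * P := by
    rw [hM, add_mul, sub_mul, one_mul, hPP, sub_self, add_zero, mul_assoc, hPP]
  have hcomm : M⁻¹ * P = P * M⁻¹ := by
    calc M⁻¹ * P = M⁻¹ * (P * M) * M⁻¹ := by
          rw [mul_assoc, mul_assoc, Matrix.mul_nonsing_inv _ hMu, mul_one]
      _ = P * M⁻¹ := by rw [hPM, ← hMP, Matrix.nonsing_inv_mul_cancel_left _ _ hMu]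
  -- The nonzero columns of `U` form the basis of the column space of `x` that is the identity in
  -- the rows of left end points. Hence `U * x = x`, and `x * U = 0` because `x` has square zero.
  set U : Matrix (Fin n) (Fin n) ℂ := b * P * M⁻¹ with hU
  have hUt : U.BlockTriangular id := (hb.mul hPt).mul (blockTriangular_inv_of_det hMt hMdet)
  have hPU : P * U = P := by
    rw [hU, ← mul_assoc, ← mul_assoc, ← hPM, Matrix.mul_nonsing_inv_cancel_right _ _ hMu]
  have hUP : U * P = U := by rw [hU, mul_assoc, hcomm, ← mul_assoc, mul_assoc b, hPP]
  have hUx : U * x = x := by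
    calc U * x = b * (P * M⁻¹) * (b * mat n s * b⁻¹) := by rw [hU, hxb, mul_assoc b P]
      _ = b * (M⁻¹ * P) * (b * (P * mat n s) * b⁻¹) := by rw [hcomm, hPN]
      _ = b * (M⁻¹ * (P * b * P)) * mat n s * b⁻¹ := by simp only [mul_assoc]
      _ = b * (P * mat n s) * b⁻¹ := by
        rw [← hMP, Matrix.nonsing_inv_mul_cancel_left _ _ hMu, mul_assoc b P]
      _ = x := by rw [hPN, hxb]
  have hxU : x * U = 0 := by
    calc x * U = b * mat n s * (b⁻¹ * (b * P)) * M⁻¹ := by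
          rw [hU, hxb]; simp only [mul_assoc]
      _ = b * (mat n s * P) * M⁻¹ := by
        rw [Matrix.nonsing_inv_mul_cancel_left _ _ hu]; simp only [mul_assoc]
      _ = 0 := by rw [hNP]; simp
  let t : ι → ℂ := fun p => if p.2.1 < p.1.1 then U p.2.1 p.1.1 else x p.1.1 p.2.1
  have hQt : Q t = U - P := by
    ext a i
    simp only [Q, of_apply, Matrix.sub_apply]
    split_ifs with h
    · have : P a i = 0 := diagonal_apply_ne _ h.2.2.ne
      simp [t, h.2.2, this]
    · by_cases hi : IsLeft s i
      · by_cases ha : IsLeft s a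
        · have h1 : (P * U) a i = U a i := by rw [diagonal_mul, if_pos ha, one_mul]
          rw [← h1, hPU, sub_self]
        · have hia : i < a := lt_of_le_of_ne (not_lt.1 fun h' => h ⟨hi, ha, h'⟩)
            fun h' => ha (h' ▸ hi)
          rw [hUt hia, show P a i = 0 from diagonal_apply_ne _ hia.ne', sub_zero]
      · have h1 : U a i = 0 := by rw [← hUP, mul_diagonal, if_neg hi, mul_zero]
        have h2 : P a i = 0 := by
          by_cases hai : a = i
          · rw [hai, show P i i = _ from diagonal_apply_eq _ _, if_neg hi]
          · exact diagonal_apply_ne _ hai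
        rw [h1, h2, sub_zero]
  have hYt : Y t = P * x * (1 - P) := by
    have h1 : (1 - P) = diagonal fun i => if IsLeft s i then 0 else 1 := by
      rw [← diagonal_one, diagonal_sub]
      congr 1
      ext i
      split_ifs <;> simp
    ext i a
    rw [h1, mul_diagonal, diagonal_mul]
    simp only [Y, of_apply]
    by_cases hi : IsLeft s i
    · by_cases ha : IsLeft s a
      · rw [dif_neg fun h => h.2.1 ha, if_pos ha, mul_zero]
      · rw [if_pos hi, if_neg ha, one_mul, mul_one]
        by_cases hia : i < a
        · rw [dif_pos ⟨hi, ha, hia⟩]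
          simp only [t]
          rw [if_neg (not_lt.2 hia.le)]
        · rw [dif_neg fun h => hia h.2.2, hx2.1 i a (not_lt.1 hia)]
    · rw [dif_neg fun h => hi h.1, if_neg hi, zero_mul, zero_mul]
  refine ⟨t, ?_⟩
  -- From `x * U = 0`, the columns of `P * x` at left end points are determined by `U` and the other
  -- columns, and `x = U * (P * x)`; so `Q` and `Y` recover `x`.
  have hPxPU : P * x * P * U = P * x * P := by rw [mul_assoc _ P U, hPU]
  have hYU : P * x * (1 - P) * U = -(P * x * P) := by
    rw [mul_sub, mul_one, sub_mul, mul_assoc P x U, hxU, mul_zero, hPxPU, zero_sub]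
  have hYP : P * x * (1 - P) * P = 0 := by
    rw [mul_assoc _ (1 - P) P, sub_mul, one_mul, hPP, sub_self, mul_zero]
  change (P + Q t) * (Y t + (-1 : ℂ) • (Y t * Q t)) = x
  rw [hQt, hYt, mul_sub _ U P, hYU, hYP, sub_zero, neg_one_smul, neg_neg, add_sub_cancel, mul_sub,
    mul_one, sub_add_cancel, ← mul_assoc, hUP, hUx]

end UpperBound

section LowerBound

variable {n : ℕ} {s : List (ℕ × ℕ)}

/-- A triangular `b` that differs from the identity only between left end points satisfies `mat n s
* b = mat n s`, so `b * mat n s` lies in the orbit. Each position freed in `b` shows up as one entry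
of this product, and so raises the dimension by at least one. -/
theorem IsCfg.card_le_zdim_bOrbit (hs : IsCfg n s) (E : Finset (Fin n × Fin n))
    (hE : ∀ p ∈ E, p.1 ≤ p.2 ∧ IsLeft s p.1 ∧ IsLeft s p.2) :
    (E.card : WithBot ℕ∞) ≤ zdim (bOrbit (mat n s)) := by
  let b : Finset (Fin n × Fin n) → (Fin n × Fin n → ℂ) → Matrix (Fin n) (Fin n) ℂ := fun E t =>
    Matrix.of fun i j => if (i, j) ∈ E then t (i, j) else (1 : Matrix (Fin n) (Fin n) ℂ) i j
  have hb : ∀ E, IsPolyMap (b E) := fun E i j => (isPoly_coord _).ite (isPoly_const _)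
  have hb1 : ∀ E, b E (fun p => (1 : Matrix (Fin n) (Fin n) ℂ) p.1 p.2) = 1 := by
    intro E
    ext i j
    simp [b]
  let S : Finset (Fin n × Fin n) → Set (Matrix (Fin n) (Fin n) ℂ) := fun E =>
    (fun t => b E t * mat n s) '' {t | (b E t).det ≠ 0}
  have hS : ∀ E, ZIrreducible (S E) := fun E =>
    ((hb E).mul (IsPolyMap.const _)).zirreducible (hb E).det
      ⟨fun p => (1 : Matrix (Fin n) (Fin n) ℂ) p.1 p.2, by rw [hb1]; simp⟩
  have hSsub : S E ⊆ bOrbit (mat n s) := by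
    rintro _ ⟨t, ht, rfl⟩
    refine mem_bOrbit_iff.2 ⟨b E t, fun i j hij => ?_, ht, ?_⟩
    · have hij' : j < i := hij
      simp only [b, of_apply]
      rw [if_neg fun h => not_le.2 hij' (hE _ h).1, one_apply_ne hij'.ne']
    · have hN : mat n s * b E t = mat n s := by
        ext i j
        rw [mul_apply]
        trans ∑ k, mat n s i k * (1 : Matrix (Fin n) (Fin n) ℂ) k j
        · refine Finset.sum_congr rfl fun k _ => ?_
          by_cases h : ((i : ℕ), (k : ℕ)) ∈ s
          · simp only [b, of_apply]
            rw [if_neg fun h' => hs.not_isLeft h (hE _ h').2.1]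
          · simp [mat, h]
        · rw [← mul_apply, mul_one]
      simp only [mul_assoc, hN]
  refine le_trans ?_ (zdim_mono hSsub)
  clear hSsub
  induction E using Finset.induction_on with
  | empty => simpa using zdim_nonneg (hS ∅)
  | insert e E he ih =>
    refine le_trans ?_ (zdim_add_one_le (S := S E) ?_ ?_ (hS (insert e E)))
    · rw [Finset.card_insert_of_notMem he, Nat.cast_add, Nat.cast_one]
      gcongr
      exact ih fun p hp => hE p (Finset.mem_insert_of_mem hp)
    · rintro _ ⟨t, ht, rfl⟩
      have : b (insert e E) (fun p => b E t p.1 p.2) = b E t := by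
        ext i j
        simp only [b, of_apply, Finset.mem_insert]
        split_ifs <;> simp_all
      refine ⟨fun p => b E t p.1 p.2, ?_, ?_⟩
      · simp only [Set.mem_ofPred_eq, this]
        exact ht
      · simp only [this]
    · obtain ⟨hle, h1, h2⟩ := hE e (Finset.mem_insert_self _ _)
      obtain ⟨⟨i, j⟩, hij, hi : i = e.2⟩ := List.mem_map.1 h2
      subst hi
      have hj := (hs.lt _ hij).2
      have hent : ∀ E t, (b E t * mat n s) e.1 ⟨j, hj⟩ = b E t e.1 e.2 := by
        intro E t
        rw [mul_apply, Finset.sum_eq_single e.2]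
        · simp [mat, hij]
        · intro k _ hk
          simp only [mat, of_apply]
          rw [if_neg fun h => hk (Fin.ext (hs.left_unique h hij)), mul_zero]
        · simp
      intro hcon
      -- Adding `1` to the identity at `e` leaves `b` invertible: the entry becomes `2` on the
      -- diagonal and `1` off it. Its `e` entry now differs from that of the identity, while all
      -- matrices of the smaller family agree with the identity there.
      let t : Fin n × Fin n → ℂ := fun p =>
        if p = e then (1 : Matrix (Fin n) (Fin n) ℂ) p.1 p.2 + 1
        else (1 : Matrix (Fin n) (Fin n) ℂ) p.1 p.2
      have hbt : ∀ i j, b (insert e E) t i j =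
          (if (i, j) = e then 1 else 0) + (1 : Matrix (Fin n) (Fin n) ℂ) i j := by
        intro i j
        simp only [b, of_apply, t, Finset.mem_insert]
        split_ifs <;> simp_all [add_comm]
      have hmem : b (insert e E) t * mat n s ∈ S (insert e E) := by
        refine ⟨t, ?_, rfl⟩
        rw [Set.mem_ofPred_eq, Matrix.det_of_isUpperTriangular]
        · refine Finset.prod_ne_zero_iff.2 fun i _ => ?_
          rw [hbt, one_apply_eq]
          split_ifs <;> norm_num
        · intro i j hij
          have hij' : j < i := hij
          rw [hbt, one_apply_ne hij'.ne', if_neg, add_zero]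
          rintro rfl
          exact not_le.2 hij' hle
      obtain ⟨p, hp⟩ := (isPoly_coord (e.1, (⟨j, hj⟩ : Fin n))).add
        (isPoly_const (-(1 : Matrix (Fin n) (Fin n) ℂ) e.1 e.2))
      have hev : ∀ x : Matrix (Fin n) (Fin n) ℂ,
          ev p x = x e.1 ⟨j, hj⟩ + -(1 : Matrix (Fin n) (Fin n) ℂ) e.1 e.2 := fun x =>
        hp fun q => x q.1 q.2
      have := mem_zclosure_iff.1 (hcon hmem) p (by
        rintro _ ⟨t, -, rfl⟩
        rw [hev]
        simp only [hent]
        simp [b, he])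
      rw [hev, hent, hbt] at this
      simp at this

theorem IsCfg.triangle_le_zdim_bOrbit (hs : IsCfg n s) :
    (((Finset.univ.filter fun p : Fin s.length × Fin s.length => p.1 ≤ p.2).card : ℕ) :
      WithBot ℕ∞) ≤ zdim (bOrbit (mat n s)) := by
  let I : Finset (Fin n) := Finset.univ.filter (IsLeft s)
  have hI : I.card = s.length := by rw [← Fintype.card_subtype, hs.card_isLeft]
  let f := I.orderEmbOfFin hI
  have hf : ∀ k, IsLeft s (f k) := fun k => by
    exact (Finset.mem_filter.1 (I.orderEmbOfFin_mem hI k)).2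
  rw [← Finset.card_map (f.toEmbedding.prodMap f.toEmbedding)]
  refine hs.card_le_zdim_bOrbit _ fun p hp => ?_
  simp only [Finset.mem_map, Finset.mem_filter, Finset.mem_univ, true_and] at hp
  obtain ⟨q, hq, rfl⟩ := hp
  exact ⟨f.monotone hq, hf _, hf _⟩

end LowerBound

end OrbVar

/-! ### The dimension of rank strata -/

namespace OrbVar

variable {n : ℕ} {s t : List (ℕ × ℕ)}

theorem rank_of_mem_bOrbit {x y : Matrix (Fin n) (Fin n) ℂ} (h : y ∈ bOrbit x) :
    y.rank = x.rank := by
  obtain ⟨b, -, hdet, rfl⟩ := mem_bOrbit_iff'.1 h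
  rw [rank_mul_eq_left_of_det_ne_zero _ _ (by simpa using hdet),
    rank_mul_eq_right_of_det_ne_zero _ _ hdet]

theorem rank_of_mem_bOrbit_mat {x : Matrix (Fin n) (Fin n) ℂ} (hs : s ∈ cfg n)
    (h : x ∈ bOrbit (mat n s)) : x.rank = s.length := by
  rw [rank_of_mem_bOrbit h, (isCfg_of_mem hs).rank_mat]

theorem ZIrreducible.of_subset_zclosure {S T : Set (Matrix (Fin n) (Fin n) ℂ)}
    (hS : ZIrreducible S) (h : S ⊆ T) (h' : T ⊆ zclosure S) : ZIrreducible T := by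
  let _ := zariski n
  have : closure T = closure S :=
    subset_antisymm (closure_minimal h' isClosed_closure) (closure_mono h)
  exact isIrreducible_iff_closure.1 (this ▸ isIrreducible_iff_closure.2 hS)

/-- The matrices of maximal rank in the closure of the orbit of `mat n s`. -/
def rankStratum (n : ℕ) (s : List (ℕ × ℕ)) : Set (Matrix (Fin n) (Fin n) ℂ) :=
  zclosure (bOrbit (mat n s)) ∩ {x | x.rank = s.length}

theorem bOrbit_subset_rankStratum (hs : s ∈ cfg n) : bOrbit (mat n s) ⊆ rankStratum n s :=
  fun _ hx => ⟨subset_zclosure hx, rank_of_mem_bOrbit_mat hs hx⟩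

theorem zirreducible_rankStratum (hs : s ∈ cfg n) : ZIrreducible (rankStratum n s) :=
  (isCfg_of_mem hs).zirreducible_bOrbit.of_subset_zclosure (bOrbit_subset_rankStratum hs)
    Set.inter_subset_left

/-- Distinct orbits are disjoint, so strict growth of dimension is applied to rank strata: these are
nested when the numbers of arcs agree, and each contains its orbit as a dense subset. -/
theorem zdim_rankStratum_add_one_le (hn : n < 7) (hs : s ∈ cfg n) (ht : t ∈ cfg n)
    (hlen : t.length = s.length) (hle : arcLE t s) (hne : t ≠ s) :
    zdim (rankStratum n t) + 1 ≤ zdim (rankStratum n s) := by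
  refine zdim_add_one_le ?_ (fun h => hne ?_) (zirreducible_rankStratum hs)
  · refine Set.inter_subset_inter
      (zclosure_bOrbit_subset ((mat_mem_zclosure_iff hn hs ht).2 hle)) fun x hx => ?_
    rw [Set.mem_ofPred_eq, ← hlen]
    exact hx
  · refine arcLE_antisymm hn ht hs hle ((mat_mem_zclosure_iff hn ht hs).1 ?_)
    exact zclosure_minimal Set.inter_subset_left isClosed_zclosure
      (h (bOrbit_subset_rankStratum hs mem_bOrbit_self))

/-- Rank-preserving moves that lower `arcDim` by one lead down to configurations where the lower
bound `k (k + 1) / 2` for `k` arcs already suffices. -/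
theorem arcDim_lower : ∀ n < 7, ∀ s ∈ cfg n, s.length < 4 ∧
    (2 * arcDim n s ≤ s.length * (s.length + 1) ∨
      ∃ t ∈ moves n s, t.length = s.length ∧ arcDim n s = arcDim n t + 1) := by
  decide +kernel

/-- Dually, rank-preserving steps upwards that raise `arcDim` by one end where the upper bound `k (n
- k)` suffices. -/
theorem arcDim_upper : ∀ n < 7, ∀ s ∈ cfg n, s.length * (n - s.length) ≤ arcDim n s ∨
    ∃ t ∈ cfg n, t.length = s.length ∧ arcDim n t = arcDim n s + 1 ∧ arcLE s t := by
  decide +kernel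

theorem arcDim_le_sq : ∀ n < 7, ∀ s ∈ cfg n, arcDim n s ≤ n * n := by
  decide +kernel

theorem triangle_card : ∀ k < 4, k * (k + 1) ≤
    2 * (Finset.univ.filter fun p : Fin k × Fin k => p.1 ≤ p.2).card := by
  decide +kernel

theorem arcDim_le_zdim (hn : n < 7) (hs : s ∈ cfg n) :
    (arcDim n s : WithBot ℕ∞) ≤ zdim (rankStratum n s) := by
  induction hd : arcDim n s using Nat.strong_induction_on generalizing s with
  | _ d ih =>
    obtain ⟨hk, h | ⟨t, ht, hlen, h⟩⟩ := arcDim_lower n hn s hs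
    · refine le_trans ?_ ((isCfg_of_mem hs).triangle_le_zdim_bOrbit.trans
        (zdim_mono (bOrbit_subset_rankStratum hs)))
      have := triangle_card _ hk
      have h2 : d ≤ (Finset.univ.filter fun p : Fin s.length × Fin s.length => p.1 ≤ p.2).card := by
        omega
      exact_mod_cast h2
    · have htc := (moves_mem_cfg n hn s hs t ht).1
      have hle := (mat_mem_zclosure_iff hn hs htc).1
        (mat_mem_zclosure_of_mem_moves (isCfg_of_mem hs) ht)
      have h1 := ih _ (by omega) htc rfl
      have h2 := zdim_rankStratum_add_one_le hn hs htc hlen hle (by rintro rfl; omega)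
      refine le_trans ?_ h2
      rw [← hd, h, Nat.cast_add, Nat.cast_one]
      gcongr

theorem zdim_le_arcDim (hn : n < 7) (hs : s ∈ cfg n) :
    zdim (rankStratum n s) ≤ (arcDim n s : WithBot ℕ∞) := by
  -- Only a crude bound is needed, so that the induction upwards terminates.
  have hmax : ∀ s ∈ cfg n, arcDim n s ≤ n * n := arcDim_le_sq n hn
  induction hd : n * n - arcDim n s using Nat.strong_induction_on generalizing s with
  | _ d ih =>
    rcases arcDim_upper n hn s hs with h | ⟨t, ht, hlen, h, hle⟩
    · refine (zdim_mono Set.inter_subset_left).trans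
        ((isCfg_of_mem hs).zdim_zclosure_bOrbit_le.trans ?_)
      exact_mod_cast h
    · have h1 := hmax t ht
      have h2 := ih _ (by omega) ht rfl
      have h3 := zdim_rankStratum_add_one_le hn ht hs hlen.symm hle (by rintro rfl; omega)
      have h4 := h3.trans h2
      rw [h, Nat.cast_add, Nat.cast_one] at h4
      exact ENat.WithBot.add_le_add_one_right_iff.1 h4

/-- The dimension of the orbit of the matrix of an involution. -/
theorem zdim_rankStratum (hn : n < 7) (hs : s ∈ cfg n) :
    zdim (rankStratum n s) = (arcDim n s : WithBot ℕ∞) :=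
  le_antisymm (zdim_le_arcDim hn hs) (arcDim_le_zdim hn hs)

end OrbVar

/-! ### Corner blocks, Jordan types and two-column tableaux -/

namespace OrbVar

section Blocks

variable {n i : ℕ} {x y : Matrix (Fin n) (Fin n) ℂ}

theorem blockTriangular_of_mem_strictUpper (hx : x ∈ strictUpper n) : x.BlockTriangular id :=
  fun a b h => hx a b (le_of_lt h)

/-- The first `i` columns of a triangular matrix vanish below row `i`, so the remaining indices
contribute nothing to the corner of the product. -/
theorem submatrix_castLE_mul (h : i ≤ n) (hy : y.BlockTriangular id) :
    (x * y).submatrix (Fin.castLE h) (Fin.castLE h) =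
      x.submatrix (Fin.castLE h) (Fin.castLE h) * y.submatrix (Fin.castLE h) (Fin.castLE h) := by
  ext a c
  rw [submatrix_apply, mul_apply, mul_apply]
  symm
  refine Finset.sum_of_injOn (Fin.castLE h) (Fin.castLE_injective h).injOn (by simp) ?_
    (by simp)
  intro k _ hk
  rw [hy (i := k), mul_zero]
  by_contra hle
  rw [id, id, not_lt] at hle
  refine hk ⟨⟨k, lt_of_le_of_lt (Fin.le_def.1 hle) c.2⟩, by simp, rfl⟩

theorem submatrix_castLE_mem_bOrbit (h : i ≤ n) (hx : x.BlockTriangular id)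
    (hy : y ∈ bOrbit x) :
    y.submatrix (Fin.castLE h) (Fin.castLE h) ∈
      bOrbit (x.submatrix (Fin.castLE h) (Fin.castLE h)) := by
  obtain ⟨b, hb, hdet, he⟩ := mem_bOrbit_iff.1 hy
  refine mem_bOrbit_iff.2 ⟨b.submatrix (Fin.castLE h) (Fin.castLE h), fun a c hac => hb hac, ?_, ?_⟩
  · have h1 := submatrix_castLE_mul (x := b) h (blockTriangular_inv_of_det hb hdet)
    rw [mul_nonsing_inv _ (isUnit_iff_ne_zero.2 hdet),
      submatrix_one _ (Fin.castLE_injective h)] at h1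
    intro h0
    have := congrArg det h1
    rw [det_mul, h0, det_one, zero_mul] at this
    exact one_ne_zero this
  · rw [← submatrix_castLE_mul h hx, he, submatrix_castLE_mul h hb]

theorem IsCfg.rank_submatrix_castLE {s : List (ℕ × ℕ)} (hs : IsCfg n s) (h : i ≤ n) :
    ((mat n s).submatrix (Fin.castLE h) (Fin.castLE h)).rank =
      s.countP fun a => Nat.blt a.2 i := by
  have h1 : (mat n s).submatrix (Fin.castLE h) (Fin.castLE h) =
      mat i (s.filter fun a => Nat.blt a.2 i) := by
    ext a c
    simp [mat]
  have h2 : IsCfg i (s.filter fun a => Nat.blt a.2 i) :=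
    ⟨fun a ha => ⟨(hs.lt a (List.mem_of_mem_filter ha)).1, by
      simpa using (List.mem_filter.1 ha).2⟩, hs.pairwise.filter _⟩
  rw [h1, h2.rank_mat, List.countP_eq_length_filter]

end Blocks

/-- The Jordan type of a matrix whose square vanishes is determined by the rank. -/
theorem hasJordanType_iff {m : ℕ} {x : Matrix (Fin m) (Fin m) ℂ} {μ : Finset (ℕ × ℕ)}
    (hμ : μ.card = m) (h2 : ∀ c ∈ μ, c.2 < 2) :
    HasJordanType x μ ↔ x * x = 0 ∧ x.rank = (μ.filter fun c => c.2 = 1).card := by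
  have hker : Module.finrank ℂ (LinearMap.ker (Matrix.toLin' x)) + x.rank = m := by
    have := LinearMap.finrank_range_add_finrank_ker (Matrix.toLin' x)
    rw [Module.finrank_fin_fun] at this
    rw [Matrix.rank_eq_finrank_range_toLin x (Pi.basisFun ℂ _) (Pi.basisFun ℂ _),
      Matrix.toLin_eq_toLin', add_comm]
    exact this
  -- The first column counts the kernel, so the second column counts the rank.
  have hsplit : (μ.filter fun c => c.2 < 1).card + (μ.filter fun c => c.2 = 1).card = m := by
    rw [← hμ, ← Finset.card_filter_add_card_filter_not (s := μ) (fun c => c.2 < 1)]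
    congr 2
    refine Finset.filter_congr fun c hc => ?_
    have := h2 c hc
    omega
  have hfull : ∀ k, 2 ≤ k → (μ.filter fun c => c.2 < k).card = m := fun k hk => by
    rw [Finset.filter_true_of_mem fun c hc => (h2 c hc).trans_le hk, hμ]
  constructor
  · rintro ⟨-, h⟩
    have h1 := h 1
    have h2 := h 2
    rw [pow_one] at h1
    refine ⟨?_, by omega⟩
    rw [hfull 2 le_rfl] at h2
    have htop : LinearMap.ker (Matrix.toLin' (x ^ 2)) = ⊤ :=
      Submodule.eq_top_of_finrank_eq (by rw [h2, Module.finrank_fin_fun])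
    rw [LinearMap.ker_eq_top, LinearEquiv.map_eq_zero_iff, pow_two] at htop
    exact htop
  · rintro ⟨h0, hr⟩
    refine ⟨⟨2, by rw [pow_two, h0]⟩, fun k => ?_⟩
    rcases k with _ | _ | k
    · simp
    · rw [zero_add, pow_one]
      omega
    · rw [hfull _ (by omega), pow_add x k 2, pow_two, h0, mul_zero, map_zero, LinearMap.ker_zero,
        finrank_top, Module.finrank_fin_fun]

namespace StdTableau

variable {n : ℕ} (S : StdTableau n)

/-- The entries of the second column, diminished by one. -/
def word : List ℕ :=
  (List.range n).filter fun v => decide (∃ c ∈ S.shape.cells, c.2 = 1 ∧ S.entry c.1 c.2 = v + 1)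

variable {S} {i : ℕ}

theorem mem_word {v : ℕ} : v ∈ S.word ↔
    ∃ c ∈ S.shape.cells, c.2 = 1 ∧ S.entry c.1 c.2 = v + 1 := by
  rw [word, List.mem_filter, decide_eq_true_iff, List.mem_range, and_iff_right_iff_imp]
  rintro ⟨c, hc, -, h⟩
  have : S.entry c.1 c.2 ≤ n := (S.bij.mapsTo hc).2
  omega

theorem nodup_word : S.word.Nodup := List.nodup_range.filter _

theorem word_mem_sublists : S.word ∈ (List.range n).sublists :=
  List.mem_sublists.2 List.filter_sublist

theorem mem_cellsLE {c : ℕ × ℕ} :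
    c ∈ S.cellsLE i ↔ c ∈ S.shape.cells ∧ S.entry c.1 c.2 ≤ i := by
  simp only [cellsLE, Finset.mem_filter]

theorem cellsLE_self : S.cellsLE n = S.shape.cells := by
  ext c
  rw [mem_cellsLE, and_iff_left_iff_imp]
  exact fun hc => (S.bij.mapsTo hc).2

theorem card_cellsLE (h : i ≤ n) : (S.cellsLE i).card = i := by
  have : (S.cellsLE i).card = (Finset.Icc 1 i).card := by
    refine Finset.card_nbij (fun c => S.entry c.1 c.2) (fun c hc => ?_) (fun c hc d hd he => ?_)
      fun v hv => ?_
    · have hc := mem_cellsLE.1 hc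
      exact Finset.mem_coe.2 (Finset.mem_Icc.2 ⟨(S.bij.mapsTo hc.1).1, hc.2⟩)
    · exact S.bij.injOn (mem_cellsLE.1 hc).1 (mem_cellsLE.1 hd).1 he
    · have hv := Finset.mem_Icc.1 (Finset.mem_coe.1 hv)
      obtain ⟨c, hc, he⟩ := S.bij.surjOn ⟨hv.1, hv.2.trans h⟩
      exact ⟨c, Finset.mem_coe.2 (mem_cellsLE.2 ⟨hc, le_of_eq_of_le he hv.2⟩), he⟩
  simpa using this

theorem card_cellsLE_filter : ((S.cellsLE i).filter fun c => c.2 = 1).card =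
    S.word.countP fun v => Nat.blt v i := by
  rw [List.countP_eq_length_filter, ← List.toFinset_card_of_nodup (nodup_word.filter _)]
  refine Finset.card_nbij (fun c => S.entry c.1 c.2 - 1) (fun c hc => ?_) (fun c hc d hd he => ?_)
    fun v hv => ?_
  · obtain ⟨hc, h1⟩ := Finset.mem_filter.1 (Finset.mem_coe.1 hc)
    obtain ⟨hc, hi⟩ := mem_cellsLE.1 hc
    have h0 := (S.bij.mapsTo hc).1
    simp only [Finset.mem_coe, List.mem_toFinset, List.mem_filter, mem_word] at h0 ⊢
    exact ⟨⟨c, hc, h1, by omega⟩, by simp; omega⟩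
  · have hc := (mem_cellsLE.1 (Finset.mem_filter.1 (Finset.mem_coe.1 hc)).1).1
    have hd := (mem_cellsLE.1 (Finset.mem_filter.1 (Finset.mem_coe.1 hd)).1).1
    have h0 := (S.bij.mapsTo hc).1
    have h1 := (S.bij.mapsTo hd).1
    refine S.bij.injOn hc hd ?_
    simp only at h0 h1 he ⊢
    omega
  · simp only [Finset.mem_coe, List.mem_toFinset, List.mem_filter, mem_word] at hv
    obtain ⟨⟨c, hc, h1, he⟩, hi⟩ := hv
    refine ⟨c, ?_, by simp [he]⟩
    simp only [Nat.blt_eq] at hi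
    exact Finset.mem_coe.2 (Finset.mem_filter.2 ⟨mem_cellsLE.2 ⟨hc, by omega⟩, h1⟩)

theorem length_word : S.word.length = (S.shape.cells.filter fun c => c.2 = 1).card := by
  rw [← cellsLE_self, card_cellsLE_filter, List.countP_eq_length.2]
  intro v hv
  simpa using List.mem_range.1 (List.mem_of_mem_filter hv)

/-- Every box in the second column has a left neighbour with a smaller entry, and these neighbours
are distinct. -/
theorem ballot (h : i ≤ n) : 2 * S.word.countP (fun v => Nat.blt v i) ≤ i := by
  rw [← card_cellsLE_filter]
  conv_rhs => rw [← card_cellsLE (S := S) h]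
  have h1 : ((S.cellsLE i).filter fun c => c.2 = 1).card ≤
      ((S.cellsLE i).filter fun c => ¬ c.2 = 1).card := by
    refine Finset.card_le_card_of_injOn (fun c => (c.1, 0)) (fun c hc => ?_)
      fun c hc d hd he => ?_
    · obtain ⟨hc, h1⟩ := Finset.mem_filter.1 (Finset.mem_coe.1 hc)
      obtain ⟨hc, hi⟩ := mem_cellsLE.1 hc
      have hc' : (c.1, c.2) ∈ S.shape.cells := hc
      have h0 : (c.1, 0) ∈ S.shape.cells := S.shape.up_left_mem le_rfl (Nat.zero_le _) hc'
      refine Finset.mem_coe.2 (Finset.mem_filter.2 ⟨mem_cellsLE.2 ⟨h0, ?_⟩, by simp⟩)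
      exact (S.row_lt c.1 0 c.2 (by omega) hc').le.trans hi
    · have h1 := (Finset.mem_filter.1 (Finset.mem_coe.1 hc)).2
      have h2 := (Finset.mem_filter.1 (Finset.mem_coe.1 hd)).2
      exact Prod.ext (Prod.ext_iff.1 he).1 (h1.trans h2.symm)
  have := Finset.card_filter_add_card_filter_not (s := S.cellsLE i) (fun c => c.2 = 1)
  omega

/-- This recovers the row of an entry from its column and the prefix counts, which is why the second
column determines a two-column tableau. -/
theorem card_column {c : ℕ × ℕ} (hc : c ∈ S.shape.cells) :
    ((S.cellsLE (S.entry c.1 c.2)).filter fun d => d.2 = c.2).card = c.1 + 1 := by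
  rw [← Finset.card_range (c.1 + 1)]
  have hc' : (c.1, c.2) ∈ S.shape.cells := hc
  refine Finset.card_nbij Prod.fst (fun d hd => ?_) (fun d hd e he h => ?_) fun r hr => ?_
  · obtain ⟨hd, h1⟩ := Finset.mem_filter.1 (Finset.mem_coe.1 hd)
    obtain ⟨hd, hi⟩ := mem_cellsLE.1 hd
    by_contra hlt
    simp only [Finset.coe_range, Set.mem_Iio, not_lt] at hlt
    have := S.col_lt c.1 d.1 d.2 (by omega) hd
    rw [h1] at hi this
    omega
  · have h1 := (Finset.mem_filter.1 (Finset.mem_coe.1 hd)).2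
    have h2 := (Finset.mem_filter.1 (Finset.mem_coe.1 he)).2
    exact Prod.ext h (h1.trans h2.symm)
  · have hr : r ≤ c.1 := by simpa [Nat.lt_succ_iff] using hr
    refine ⟨(r, c.2), Finset.mem_coe.2 (Finset.mem_filter.2 ⟨mem_cellsLE.2
      ⟨S.shape.up_left_mem hr le_rfl hc', ?_⟩, rfl⟩), rfl⟩
    rcases hr.eq_or_lt with rfl | hr
    · exact le_rfl
    · exact (S.col_lt r c.1 c.2 hr hc').le

variable {S' : StdTableau n}

theorem cellsLE_filter_congr (hS : S.TwoColumn) (hS' : S'.TwoColumn) (h : S.word = S'.word)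
    (hi : i ≤ n) {j : ℕ} (hj : j < 2) :
    ((S.cellsLE i).filter fun d => d.2 = j).card =
      ((S'.cellsLE i).filter fun d => d.2 = j).card := by
  have key : ∀ {S : StdTableau n}, S.TwoColumn → ((S.cellsLE i).filter fun d => d.2 = 0).card +
      S.word.countP (fun v => Nat.blt v i) = i := fun {S} hS => by
    rw [← card_cellsLE_filter]
    conv_rhs => rw [← card_cellsLE (S := S) hi,
      ← Finset.card_filter_add_card_filter_not (s := S.cellsLE i) (fun c => c.2 = 0)]
    congr 2
    refine Finset.filter_congr fun c hc => ?_
    have := hS c (mem_cellsLE.1 hc).1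
    omega
  interval_cases j
  · have h1 := key hS
    have h2 := key hS'
    rw [h] at h1
    omega
  · rw [card_cellsLE_filter, card_cellsLE_filter, h]

theorem mem_cells_of_word_eq (hS : S.TwoColumn) (hS' : S'.TwoColumn) (h : S.word = S'.word)
    {c : ℕ × ℕ} (hc : c ∈ S.shape.cells) :
    c ∈ S'.shape.cells ∧ S'.entry c.1 c.2 = S.entry c.1 c.2 := by
  have hv := S.bij.mapsTo hc
  obtain ⟨d, hd, he⟩ := S'.bij.surjOn hv
  simp only at hv he
  have h2 : c.2 = 1 ↔ d.2 = 1 := by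
    have hw : S.entry c.1 c.2 - 1 ∈ S.word ↔ S.entry c.1 c.2 - 1 ∈ S'.word := by rw [h]
    have hv1 : S.entry c.1 c.2 - 1 + 1 = S.entry c.1 c.2 := Nat.sub_add_cancel hv.1
    rw [mem_word, mem_word, hv1] at hw
    constructor
    · intro h1
      obtain ⟨d', hd', h1', he'⟩ := hw.1 ⟨c, hc, h1, rfl⟩
      rwa [S'.bij.injOn hd hd' (he.trans he'.symm)]
    · intro h1
      obtain ⟨c', hc', h1', he'⟩ := hw.2 ⟨d, hd, h1, he⟩
      rwa [S.bij.injOn hc hc' he'.symm]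
  have hc2 := hS c hc
  have hd2 := hS' d hd
  have hcd : c.2 = d.2 := by omega
  have h1 := card_column hc
  have h3 := card_column hd
  rw [he, ← hcd, ← cellsLE_filter_congr hS hS' h hv.2 hc2, h1] at h3
  obtain rfl : c = d := Prod.ext (by omega) hcd
  exact ⟨hd, he⟩

/-- A tableau with two columns is determined by its second column. -/
theorem word_inj (hS : S.TwoColumn) (hS' : S'.TwoColumn) : S.word = S'.word ↔ S = S' := by
  refine ⟨fun h => ?_, fun h => h ▸ rfl⟩
  have hcells : ∀ c, c ∈ S.shape.cells ↔ c ∈ S'.shape.cells := fun c =>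
    ⟨fun hc => (mem_cells_of_word_eq hS hS' h hc).1,
      fun hc => (mem_cells_of_word_eq hS' hS h.symm hc).1⟩
  refine StdTableau.ext (YoungDiagram.ext (Finset.ext hcells)) ?_
  funext r j
  by_cases hc : (r, j) ∈ S.shape.cells
  · exact (mem_cells_of_word_eq hS hS' h hc).2.symm
  · rw [S.zeros _ _ hc, S'.zeros _ _ (mt (hcells _).2 hc)]

end StdTableau

/-- The noncrossing involution with the given right end points. -/
def topArcs (J : List ℕ) : List (ℕ × ℕ) :=
  J.foldl (fun s j => match (List.range j).reverse.find? (free s) with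
    | some i => (i, j) :: s
    | none => s) []

/-- The prefix counts of `J`, as a set of right end points, agree with those of `s`. -/
def rightsMatch (n : ℕ) (s : List (ℕ × ℕ)) (J : List ℕ) : Bool :=
  (List.range (n + 1)).all fun i =>
    (s.countP fun a => Nat.blt a.2 i).beq (J.countP fun v => Nat.blt v i)

/-- The prefixes of `J`, as a set of positions, contain at most half of the positions. -/
def isBallot (n : ℕ) (J : List ℕ) : Bool :=
  (List.range (n + 1)).all fun i => Nat.ble (2 * J.countP fun v => Nat.blt v i) i

/-- The ballot condition lets every right end point find a free point on its left. Joining it to the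
nearest one gives the greatest configuration with these right end points. -/
theorem topArcs_spec : ∀ n < 7, ∀ J ∈ (List.range n).sublists, isBallot n J →
    topArcs J ∈ cfg n ∧ (topArcs J).length = J.length ∧ rightsMatch n (topArcs J) J ∧
      ∀ t ∈ cfg n, rightsMatch n t J → arcLE t (topArcs J) := by
  decide +kernel

namespace StdTableau

variable {n : ℕ} {S : StdTableau n}

theorem isBallot_word : isBallot n S.word := by
  rw [isBallot, List.all_eq_true]
  intro i hi
  simpa using ballot (S := S) (Nat.le_of_lt_succ (List.mem_range.1 hi))

theorem mem_nilOrbit_iff (hS : S.TwoColumn) {x : Matrix (Fin n) (Fin n) ℂ} :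
    x ∈ nilOrbit n S.shape ↔ x * x = 0 ∧ x.rank = S.word.length := by
  rw [nilOrbit, Set.mem_ofPred_eq, hasJordanType_iff _ hS, length_word]
  rw [← cellsLE_self, card_cellsLE le_rfl]

/-- The rank of the upper left `i × i` block is invariant under triangular conjugation, and for `mat
n s` it counts the arcs ending before `i`. The Jordan types of the blocks thus prescribe the right
end points. -/
theorem mem_stratum_iff (hS : S.TwoColumn) {x : Matrix (Fin n) (Fin n) ℂ} :
    x ∈ stratum S ↔ ∃ s ∈ cfg n, rightsMatch n s S.word ∧ x ∈ bOrbit (mat n s) := by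
  have hJ : ∀ i (h : i ≤ n) (y : Matrix (Fin i) (Fin i) ℂ), HasJordanType y (S.cellsLE i) ↔
      y * y = 0 ∧ y.rank = S.word.countP fun v => Nat.blt v i := fun i h y => by
    rw [hasJordanType_iff (card_cellsLE h) fun c hc => hS c (mem_cellsLE.1 hc).1,
      card_cellsLE_filter]
  have hrank : ∀ s ∈ cfg n, x ∈ bOrbit (mat n s) → ∀ i (h : i ≤ n),
      (x.submatrix (Fin.castLE h) (Fin.castLE h)).rank = s.countP fun a => Nat.blt a.2 i :=
    fun s hs hx i h => by
      rw [rank_of_mem_bOrbit (submatrix_castLE_mem_bOrbit h (blockTriangular_of_mem_strictUpper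
        (isCfg_of_mem hs).mat_mem_X2.1) hx), (isCfg_of_mem hs).rank_submatrix_castLE h]
  constructor
  · rintro ⟨hu, h⟩
    have h0 : x * x = 0 := by
      have := ((hJ n le_rfl _).1 (h n le_rfl)).1
      simpa using this
    obtain ⟨s, hs, hx⟩ := exists_cfg_of_mem_X2 (⟨hu, h0⟩ : x ∈ X2 n)
    refine ⟨s, hs, ?_, hx⟩
    rw [rightsMatch, List.all_eq_true]
    intro i hi
    have hi := Nat.le_of_lt_succ (List.mem_range.1 hi)
    rw [Nat.beq_eq, ← hrank s hs hx i hi]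
    exact ((hJ i hi _).1 (h i hi)).2
  · rintro ⟨s, hs, hm, hx⟩
    obtain ⟨hu, h0⟩ := bOrbit_subset_X2 (isCfg_of_mem hs).mat_mem_X2 hx
    refine ⟨hu, fun i hi => (hJ i hi _).2 ⟨?_, ?_⟩⟩
    · rw [← submatrix_castLE_mul hi (blockTriangular_of_mem_strictUpper hu), h0]
      rfl
    · rw [hrank s hs hx i hi]
      simpa using List.all_eq_true.1 hm i (List.mem_range.2 (Nat.lt_succ_of_le hi))

theorem topArcs_word_mem_cfg (hn : n < 7) : topArcs S.word ∈ cfg n :=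
  (topArcs_spec n hn _ word_mem_sublists isBallot_word).1

theorem length_topArcs_word (hn : n < 7) : (topArcs S.word).length = S.word.length :=
  (topArcs_spec n hn _ word_mem_sublists isBallot_word).2.1

theorem zclosure_inter_nilOrbit (hS : S.TwoColumn) {s : List (ℕ × ℕ)} (hs : s ∈ cfg n)
    (hl : s.length = S.word.length) :
    zclosure (bOrbit (mat n s)) ∩ nilOrbit n S.shape = rankStratum n s := by
  ext x
  rw [Set.mem_inter_iff, mem_nilOrbit_iff hS, rankStratum, Set.mem_inter_iff, Set.mem_ofPred_eq, hl]
  refine and_congr_right fun hx => and_iff_right ?_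
  exact (zclosure_bOrbit_subset_X2 (isCfg_of_mem hs).mat_mem_X2 hx).2

/-- The dense orbit of an orbital variety. -/
theorem orbitalVariety_eq (hn : n < 7) (hS : S.TwoColumn) :
    orbitalVariety S = rankStratum n (topArcs S.word) := by
  obtain ⟨h1, h2, h3, h4⟩ := topArcs_spec n hn _ word_mem_sublists (isBallot_word (S := S))
  rw [← zclosure_inter_nilOrbit hS h1 h2, orbitalVariety]
  -- The noncrossing orbit lies in the stratum, and every other orbit of the stratum lies below it;
  -- so both have the same closure.
  congr 1
  refine subset_antisymm (zclosure_minimal (fun x hx => ?_) isClosed_zclosure)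
    (zclosure_mono fun x hx => (mem_stratum_iff hS).2 ⟨_, h1, h3, hx⟩)
  obtain ⟨t, ht, hm, hx⟩ := (mem_stratum_iff hS).1 hx
  exact zclosure_bOrbit_subset ((mat_mem_zclosure_iff hn h1 ht).2 (h4 t ht hm))
    (subset_zclosure hx)

end StdTableau

end OrbVar

/-! ### Intersections as unions of orbits -/

namespace OrbVar

section Unions

variable {n : ℕ} {s t m : List (ℕ × ℕ)} {D : List (List (ℕ × ℕ))}

theorem bOrbit_mat_subset_zclosure_iff (hn : n < 7) (hs : s ∈ cfg n) (ht : t ∈ cfg n) :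
    bOrbit (mat n t) ⊆ zclosure (bOrbit (mat n s)) ↔ arcLE t s :=
  ⟨fun h => (mat_mem_zclosure_iff hn hs ht).1 (h mem_bOrbit_self),
    fun h => bOrbit_subset_zclosure ((mat_mem_zclosure_iff hn hs ht).2 h)⟩

/-- The union of the orbits of a list of involutions. -/
def orbitUnion (n : ℕ) (D : List (List (ℕ × ℕ))) : Set (Matrix (Fin n) (Fin n) ℂ) :=
  ⋃ t ∈ {t | t ∈ D}, bOrbit (mat n t)

theorem mem_orbitUnion {x : Matrix (Fin n) (Fin n) ℂ} :
    x ∈ orbitUnion n D ↔ ∃ t ∈ D, x ∈ bOrbit (mat n t) := by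
  simp [orbitUnion]

theorem zirreducible_orbitUnion (hn : n < 7) (hD : ∀ t ∈ D, t ∈ cfg n) :
    ZIrreducible (orbitUnion n D) ↔ ∃ m ∈ D, ∀ t ∈ D, arcLE t m := by
  refine (@isIrreducible_iff_maximum _ (zariski n) _ _ (List.finite_toSet D) _
    fun t ht => (isCfg_of_mem (hD t ht)).zirreducible_bOrbit).trans ?_
  exact exists_congr fun m => and_congr_right fun hm => forall₂_congr fun t ht =>
    bOrbit_mat_subset_zclosure_iff hn (hD m hm) (hD t ht)

theorem zcomponents_orbitUnion (hn : n < 7) (hD : ∀ t ∈ D, t ∈ cfg n) :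
    zcomponents (orbitUnion n D) = {C | ∃ m ∈ D, (∀ t ∈ D, arcLE m t → arcLE t m) ∧
      C = zclosure (bOrbit (mat n m)) ∩ orbitUnion n D} := by
  rw [zcomponents_eq]
  refine (@maximal_irreducible_iUnion _ (zariski n) _ _ (List.finite_toSet D) _
    fun t ht => (isCfg_of_mem (hD t ht)).zirreducible_bOrbit).trans ?_
  ext C
  refine exists_congr fun m => and_congr_right fun hm => and_congr_left' <|
    forall₂_congr fun t ht => ?_
  exact imp_congr (bOrbit_mat_subset_zclosure_iff hn (hD t ht) (hD m hm))
    (bOrbit_mat_subset_zclosure_iff hn (hD m hm) (hD t ht))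

/-- The common lower bounds of two involutions. -/
def lower (n : ℕ) (s t : List (ℕ × ℕ)) : List (List (ℕ × ℕ)) :=
  (cfg n).filter fun r => arcLE r s && arcLE r t

/-- The common lower bounds of two involutions with the same number of arcs as the first. -/
def lowerEq (n : ℕ) (s t : List (ℕ × ℕ)) : List (List (ℕ × ℕ)) :=
  (cfg n).filter fun r => r.length.beq s.length && (arcLE r s && arcLE r t)

theorem mem_lower {r : List (ℕ × ℕ)} : r ∈ lower n s t ↔ r ∈ cfg n ∧ arcLE r s ∧ arcLE r t := by
  rw [lower, List.mem_filter, Bool.and_eq_true]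

theorem mem_lowerEq {r : List (ℕ × ℕ)} : r ∈ lowerEq n s t ↔
    r ∈ cfg n ∧ r.length = s.length ∧ arcLE r s ∧ arcLE r t := by
  rw [lowerEq, List.mem_filter, Bool.and_eq_true, Bool.and_eq_true, Nat.beq_eq]

theorem mem_zclosure_bOrbit_mat_iff (hn : n < 7) (hs : s ∈ cfg n) (ht : t ∈ cfg n)
    {x : Matrix (Fin n) (Fin n) ℂ} (hx : x ∈ bOrbit (mat n t)) :
    x ∈ zclosure (bOrbit (mat n s)) ↔ arcLE t s := by
  rw [← bOrbit_mat_subset_zclosure_iff hn hs ht, ← bOrbit_eq hx]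
  exact ⟨bOrbit_subset_zclosure, fun h => h mem_bOrbit_self⟩

theorem zclosure_bOrbit_inter (hn : n < 7) (hs : s ∈ cfg n) (ht : t ∈ cfg n) :
    zclosure (bOrbit (mat n s)) ∩ zclosure (bOrbit (mat n t)) = orbitUnion n (lower n s t) := by
  ext x
  rw [mem_orbitUnion]
  constructor
  · rintro ⟨h1, h2⟩
    obtain ⟨r, hr, hx⟩ := exists_cfg_of_mem_X2
      (zclosure_bOrbit_subset_X2 (isCfg_of_mem hs).mat_mem_X2 h1)
    exact ⟨r, mem_lower.2 ⟨hr, (mem_zclosure_bOrbit_mat_iff hn hs hr hx).1 h1,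
      (mem_zclosure_bOrbit_mat_iff hn ht hr hx).1 h2⟩, hx⟩
  · rintro ⟨r, hr, hx⟩
    obtain ⟨hr, h1, h2⟩ := mem_lower.1 hr
    exact ⟨(mem_zclosure_bOrbit_mat_iff hn hs hr hx).2 h1,
      (mem_zclosure_bOrbit_mat_iff hn ht hr hx).2 h2⟩

theorem rankStratum_inter (hn : n < 7) (hs : s ∈ cfg n) (ht : t ∈ cfg n)
    (hl : s.length = t.length) :
    rankStratum n s ∩ rankStratum n t = orbitUnion n (lowerEq n s t) := by
  ext x
  have h := Set.ext_iff.1 (zclosure_bOrbit_inter hn hs ht) x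
  rw [mem_orbitUnion] at h ⊢
  constructor
  · rintro ⟨⟨h1, h3⟩, h2, -⟩
    obtain ⟨r, hr, hx⟩ := h.1 ⟨h1, h2⟩
    rw [mem_lower] at hr
    exact ⟨r, mem_lowerEq.2 ⟨hr.1, (rank_of_mem_bOrbit_mat hr.1 hx).symm.trans h3, hr.2⟩, hx⟩
  · rintro ⟨r, hr, hx⟩
    rw [mem_lowerEq] at hr
    have h3 := (rank_of_mem_bOrbit_mat hr.1 hx).trans hr.2.1
    obtain ⟨h1, h2⟩ := h.2 ⟨r, mem_lower.2 ⟨hr.1, hr.2.2⟩, hx⟩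
    exact ⟨⟨h1, h3⟩, h2, h3.trans hl⟩

/-- The maximal elements of a list of involutions. -/
def maxs (D : List (List (ℕ × ℕ))) : List (List (ℕ × ℕ)) :=
  D.filter fun m => D.all fun t => !arcLE m t || arcLE t m

theorem mem_maxs : m ∈ maxs D ↔ m ∈ D ∧ ∀ t ∈ D, arcLE m t → arcLE t m := by
  rw [maxs, List.mem_filter, List.all_eq_true]
  refine and_congr_right fun _ => forall₂_congr fun t _ => ?_
  cases arcLE m t <;> simp

theorem rankStratum_subset (hn : n < 7) (hs : s ∈ cfg n) (hm : m ∈ cfg n)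
    (hl : m.length = s.length) (hle : arcLE m s) : rankStratum n m ⊆ rankStratum n s :=
  fun _ hx => ⟨zclosure_bOrbit_subset ((mat_mem_zclosure_iff hn hs hm).2 hle) hx.1, hx.2.trans hl⟩

theorem rankStratum_inj (hn : n < 7) (hs : s ∈ cfg n) (ht : t ∈ cfg n) :
    rankStratum n s = rankStratum n t ↔ s = t := by
  refine ⟨fun h => arcLE_antisymm hn hs ht ?_ ?_, fun h => h ▸ rfl⟩
  · rw [← mat_mem_zclosure_iff hn ht hs]
    exact (h ▸ bOrbit_subset_rankStratum hs mem_bOrbit_self : mat n s ∈ rankStratum n t).1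
  · rw [← mat_mem_zclosure_iff hn hs ht]
    exact (h ▸ bOrbit_subset_rankStratum ht mem_bOrbit_self : mat n t ∈ rankStratum n s).1

/-- A component is the trace on the intersection of the closure of a maximal orbit; as that orbit
has the full number of arcs, the trace is its whole rank stratum. -/
theorem zcomponents_rankStratum_inter (hn : n < 7) (hs : s ∈ cfg n) (ht : t ∈ cfg n)
    (hl : s.length = t.length) :
    zcomponents (rankStratum n s ∩ rankStratum n t) =
      {C | ∃ m ∈ maxs (lowerEq n s t), C = rankStratum n m} := by
  have h := rankStratum_inter hn hs ht hl
  rw [h, zcomponents_orbitUnion hn fun r hr => (mem_lowerEq.1 hr).1, ← h]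
  ext C
  refine exists_congr fun m => ?_
  rw [mem_maxs, ← and_assoc]
  refine and_congr_right fun hm => ?_
  obtain ⟨hm, hml, h1, h2⟩ := mem_lowerEq.1 hm.1
  suffices zclosure (bOrbit (mat n m)) ∩ (rankStratum n s ∩ rankStratum n t) = rankStratum n m by
    rw [this]
  refine subset_antisymm (fun x hx => ⟨hx.1, hx.2.1.2.trans hml.symm⟩) fun x hx => ⟨hx.1, ?_, ?_⟩
  · exact rankStratum_subset hn hs hm hml h1 hx
  · exact rankStratum_subset hn ht hm (hml.trans hl) h2 hx

theorem zirreducible_rankStratum_inter (hn : n < 7) (hs : s ∈ cfg n) (ht : t ∈ cfg n)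
    (hl : s.length = t.length) :
    ZIrreducible (rankStratum n s ∩ rankStratum n t) ↔
      ∃ m ∈ lowerEq n s t, ∀ r ∈ lowerEq n s t, arcLE r m := by
  rw [rankStratum_inter hn hs ht hl,
    zirreducible_orbitUnion hn fun r hr => (mem_lowerEq.1 hr).1]

theorem equidimensional_rankStratum_inter (hn : n < 7) (hs : s ∈ cfg n) (ht : t ∈ cfg n)
    (hl : s.length = t.length) :
    Equidimensional (rankStratum n s ∩ rankStratum n t) ↔
      ∀ m ∈ maxs (lowerEq n s t), ∀ r ∈ maxs (lowerEq n s t), arcDim n m = arcDim n r := by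
  have hc : ∀ m ∈ maxs (lowerEq n s t), m ∈ cfg n := fun m hm =>
    (mem_lowerEq.1 (mem_maxs.1 hm).1).1
  rw [Equidimensional, zcomponents_rankStratum_inter hn hs ht hl]
  constructor
  · intro h m hm r hr
    have := h _ ⟨m, hm, rfl⟩ _ ⟨r, hr, rfl⟩
    rw [zdim_rankStratum hn (hc m hm), zdim_rankStratum hn (hc r hr)] at this
    exact_mod_cast this
  · rintro h _ ⟨m, hm, rfl⟩ _ ⟨r, hr, rfl⟩
    rw [zdim_rankStratum hn (hc m hm), zdim_rankStratum hn (hc r hr), h m hm r hr]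

theorem hasCodim_rankStratum (hn : n < 7) (hs : s ∈ cfg n) (hm : m ∈ cfg n)
    (hl : m.length = s.length) (hle : arcLE m s) {c : ℕ} (hc : arcDim n m + c = arcDim n s) :
    HasCodim (rankStratum n m) (rankStratum n s) c := by
  refine ⟨rankStratum_subset hn hs hm hl hle, ?_⟩
  rw [zdim_rankStratum hn hs, zdim_rankStratum hn hm, ← hc, Nat.cast_add]

theorem exists_cfg_bOrbit_eq {x : Matrix (Fin n) (Fin n) ℂ} (hx : x ∈ X2 n) :
    ∃ s ∈ cfg n, bOrbit x = bOrbit (mat n s) := by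
  obtain ⟨s, hs, h⟩ := exists_cfg_of_mem_X2 hx
  exact ⟨s, hs, bOrbit_eq h⟩

theorem rank_of_mem_glOrbit {x y : Matrix (Fin n) (Fin n) ℂ} (h : y ∈ glOrbit x) :
    y.rank = x.rank := by
  obtain ⟨g, rfl⟩ := h
  rw [rank_mul_eq_left_of_isUnit_det _ _ ((isUnit_iff_isUnit_det _).1 (g⁻¹).isUnit),
    rank_mul_eq_right_of_isUnit_det _ _ ((isUnit_iff_isUnit_det _).1 g.isUnit)]

theorem invMatrix_eq_mat {σ : Equiv.Perm (Fin n)}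
    (h : ∀ i j : Fin n, i < j ∧ σ i = j ↔ (i.val, j.val) ∈ s) : invMatrix σ = mat n s := by
  ext i j
  simp only [invMatrix, mat, of_apply, h]

end Unions

/-! ### Finite verifications for at most six points -/

theorem exists_max_lower_of_length_eq : ∀ n < 5, ∀ s ∈ cfg n, ∀ t ∈ cfg n,
    s.length = t.length → ∃ m ∈ lower n s t, ∀ r ∈ lower n s t, arcLE r m := by
  decide +kernel

theorem exists_max_lower : ∀ n < 4, ∀ s ∈ cfg n, ∀ t ∈ cfg n,
    ∃ m ∈ lower n s t, ∀ r ∈ lower n s t, arcLE r m := by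
  decide +kernel

theorem not_exists_max_lower_iff : ∀ s ∈ cfg 4, ∀ t ∈ cfg 4,
    (¬ ∃ m ∈ lower 4 s t, ∀ r ∈ lower 4 s t, arcLE r m) ↔
      ((s = [(1, 2)] ∧ t = [(2, 3), (0, 1)] ∨ s = [(2, 3), (0, 1)] ∧ t = [(1, 2)]) ∨
        (s = [(1, 2)] ∧ t = [(1, 3), (0, 2)] ∨ s = [(1, 3), (0, 2)] ∧ t = [(1, 2)])) := by
  decide +kernel

/-- The possible second columns of the standard tableaux with `n` boxes and two columns. -/
def words (n : ℕ) : List (List ℕ) := (List.range n).sublists.filter (isBallot n)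

theorem StdTableau.word_mem_words {n : ℕ} {S : StdTableau n} : S.word ∈ words n :=
  List.mem_filter.2 ⟨word_mem_sublists, isBallot_word⟩

theorem not_exists_max_lowerEq_iff : ∀ J ∈ words 5, ∀ K ∈ words 5, J.length = K.length →
    ((¬ ∃ m ∈ lowerEq 5 (topArcs J) (topArcs K), ∀ r ∈ lowerEq 5 (topArcs J) (topArcs K),
      arcLE r m) ↔ J = [1, 3] ∧ K = [2, 4] ∨ J = [2, 4] ∧ K = [1, 3]) := by
  decide +kernel

theorem arcDim_maxs_eq : ∀ n < 6, ∀ J ∈ words n, ∀ K ∈ words n, J.length = K.length →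
    ∀ m ∈ maxs (lowerEq n (topArcs J) (topArcs K)),
      ∀ r ∈ maxs (lowerEq n (topArcs J) (topArcs K)), arcDim n m = arcDim n r := by
  decide +kernel

theorem not_arcDim_maxs_eq_iff : ∀ J ∈ words 6, ∀ K ∈ words 6, J.length = K.length →
    ((¬ ∀ m ∈ maxs (lowerEq 6 (topArcs J) (topArcs K)),
      ∀ r ∈ maxs (lowerEq 6 (topArcs J) (topArcs K)), arcDim 6 m = arcDim 6 r) ↔
      J = [2, 5] ∧ K = [1, 4] ∨ J = [1, 4] ∧ K = [2, 5]) := by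
  decide +kernel

section Transfer

variable {n : ℕ}

theorem zirreducible_zclosure_inter_iff (hn : n < 7) {x y : Matrix (Fin n) (Fin n) ℂ}
    {s t : List (ℕ × ℕ)} (hs : s ∈ cfg n) (ht : t ∈ cfg n) (hx : bOrbit x = bOrbit (mat n s))
    (hy : bOrbit y = bOrbit (mat n t)) :
    ZIrreducible (zclosure (bOrbit x) ∩ zclosure (bOrbit y)) ↔
      ∃ m ∈ lower n s t, ∀ r ∈ lower n s t, arcLE r m := by
  rw [hx, hy, zclosure_bOrbit_inter hn hs ht,
    zirreducible_orbitUnion hn fun r hr => (mem_lower.1 hr).1]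

variable {S S' : StdTableau n}

theorem StdTableau.length_word_eq (h : S.shape = S'.shape) : S.word.length = S'.word.length := by
  rw [length_word, length_word, h]

theorem length_topArcs_eq (hn : n < 7) (h : S.shape = S'.shape) :
    (topArcs S.word).length = (topArcs S'.word).length := by
  rw [StdTableau.length_topArcs_word hn, StdTableau.length_topArcs_word hn,
    StdTableau.length_word_eq h]

theorem zirreducible_orbitalVariety_inter (hn : n < 7) (hS : S.TwoColumn) (hS' : S'.TwoColumn)
    (h : S.shape = S'.shape) :
    ZIrreducible (orbitalVariety S ∩ orbitalVariety S') ↔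
      ∃ m ∈ lowerEq n (topArcs S.word) (topArcs S'.word),
        ∀ r ∈ lowerEq n (topArcs S.word) (topArcs S'.word), arcLE r m := by
  rw [StdTableau.orbitalVariety_eq hn hS, StdTableau.orbitalVariety_eq hn hS']
  exact zirreducible_rankStratum_inter hn (StdTableau.topArcs_word_mem_cfg hn)
    (StdTableau.topArcs_word_mem_cfg hn) (length_topArcs_eq hn h)

theorem equidimensional_orbitalVariety_inter (hn : n < 7) (hS : S.TwoColumn)
    (hS' : S'.TwoColumn) (h : S.shape = S'.shape) :
    Equidimensional (orbitalVariety S ∩ orbitalVariety S') ↔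
      ∀ m ∈ maxs (lowerEq n (topArcs S.word) (topArcs S'.word)),
        ∀ r ∈ maxs (lowerEq n (topArcs S.word) (topArcs S'.word)),
          arcDim n m = arcDim n r := by
  rw [StdTableau.orbitalVariety_eq hn hS, StdTableau.orbitalVariety_eq hn hS']
  exact equidimensional_rankStratum_inter hn (StdTableau.topArcs_word_mem_cfg hn)
    (StdTableau.topArcs_word_mem_cfg hn) (length_topArcs_eq hn h)

end Transfer

/-! ### The exceptional pairs and their components -/

theorem twoColumn_T₅ : T₅.TwoColumn := by unfold StdTableau.TwoColumn; decide +kernel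
theorem twoColumn_T₅' : T₅'.TwoColumn := by unfold StdTableau.TwoColumn; decide +kernel
theorem twoColumn_T₆ : T₆.TwoColumn := by unfold StdTableau.TwoColumn; decide +kernel
theorem twoColumn_T₆' : T₆'.TwoColumn := by unfold StdTableau.TwoColumn; decide +kernel

theorem word_T₅ : T₅.word = [1, 3] := by decide +kernel
theorem word_T₅' : T₅'.word = [2, 4] := by decide +kernel
theorem word_T₆ : T₆.word = [2, 5] := by decide +kernel
theorem word_T₆' : T₆'.word = [1, 4] := by decide +kernel

theorem orbitalVariety_T₅ : orbitalVariety T₅ = rankStratum 5 [(2, 3), (0, 1)] := by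
  rw [StdTableau.orbitalVariety_eq (by norm_num) twoColumn_T₅, word_T₅]
  rfl

theorem orbitalVariety_T₅' : orbitalVariety T₅' = rankStratum 5 [(3, 4), (1, 2)] := by
  rw [StdTableau.orbitalVariety_eq (by norm_num) twoColumn_T₅', word_T₅']
  rfl

theorem orbitalVariety_T₆ : orbitalVariety T₆ = rankStratum 6 [(4, 5), (1, 2)] := by
  rw [StdTableau.orbitalVariety_eq (by norm_num) twoColumn_T₆, word_T₆]
  rfl

theorem orbitalVariety_T₆' : orbitalVariety T₆' = rankStratum 6 [(3, 4), (0, 1)] := by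
  rw [StdTableau.orbitalVariety_eq (by norm_num) twoColumn_T₆', word_T₆']
  rfl

theorem maxs_five : maxs (lowerEq 5 [(2, 3), (0, 1)] [(3, 4), (1, 2)]) =
    [[(1, 4), (0, 2)], [(2, 4), (0, 3)], [(0, 4), (1, 3)]] := by
  decide +kernel

theorem maxs_six : maxs (lowerEq 6 [(4, 5), (1, 2)] [(3, 4), (0, 1)]) =
    [[(3, 5), (0, 2)], [(0, 5), (1, 4)]] := by
  decide +kernel

theorem zcomponents_five : zcomponents (orbitalVariety T₅ ∩ orbitalVariety T₅') =
    {rankStratum 5 [(1, 4), (0, 2)], rankStratum 5 [(2, 4), (0, 3)],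
      rankStratum 5 [(0, 4), (1, 3)]} := by
  rw [orbitalVariety_T₅, orbitalVariety_T₅', zcomponents_rankStratum_inter
    (s := [(2, 3), (0, 1)]) (t := [(3, 4), (1, 2)]) (by norm_num) (by decide +kernel)
    (by decide +kernel) rfl, maxs_five]
  ext C
  simp

theorem zcomponents_six : zcomponents (orbitalVariety T₆ ∩ orbitalVariety T₆') =
    {rankStratum 6 [(3, 5), (0, 2)], rankStratum 6 [(0, 5), (1, 4)]} := by
  rw [orbitalVariety_T₆, orbitalVariety_T₆', zcomponents_rankStratum_inter
    (s := [(4, 5), (1, 2)]) (t := [(3, 4), (0, 1)]) (by norm_num) (by decide +kernel)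
    (by decide +kernel) rfl, maxs_six]
  ext C
  simp

theorem rankStratum_five {σ : Equiv.Perm (Fin 5)} {s : List (ℕ × ℕ)}
    (h : ∀ i j : Fin 5, i < j ∧ σ i = j ↔ (i.val, j.val) ∈ s) (hs : s ∈ cfg 5)
    (hl : s.length = 2) :
    zclosure (bOrbit (invMatrix σ)) ∩ nilOrbit 5 T₅.shape = rankStratum 5 s := by
  rw [invMatrix_eq_mat h, StdTableau.zclosure_inter_nilOrbit twoColumn_T₅ hs]
  rw [hl, word_T₅]
  rfl

theorem rankStratum_six {σ : Equiv.Perm (Fin 6)} {s : List (ℕ × ℕ)}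
    (h : ∀ i j : Fin 6, i < j ∧ σ i = j ↔ (i.val, j.val) ∈ s) (hs : s ∈ cfg 6)
    (hl : s.length = 2) :
    zclosure (bOrbit (invMatrix σ)) ∩ nilOrbit 6 T₆.shape = rankStratum 6 s := by
  rw [invMatrix_eq_mat h, StdTableau.zclosure_inter_nilOrbit twoColumn_T₆ hs]
  rw [hl, word_T₆]
  rfl

/-- The dimensions of a component of the intersection for five boxes. -/
theorem component_five {m : List (ℕ × ℕ)} (hm : m ∈ cfg 5) (hl : m.length = 2)
    (h : arcLE m [(2, 3), (0, 1)]) (h' : arcLE m [(3, 4), (1, 2)]) (hd : arcDim 5 m = 4) :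
    zdim (rankStratum 5 m) = 4 ∧ HasCodim (rankStratum 5 m) (orbitalVariety T₅) 2 ∧
      HasCodim (rankStratum 5 m) (orbitalVariety T₅') 2 := by
  rw [zdim_rankStratum (by norm_num) hm, hd, orbitalVariety_T₅, orbitalVariety_T₅']
  exact ⟨rfl, hasCodim_rankStratum (s := [(2, 3), (0, 1)]) (by norm_num) (by decide +kernel) hm hl h
      (by rw [hd]; rfl),
    hasCodim_rankStratum (s := [(3, 4), (1, 2)]) (by norm_num) (by decide +kernel) hm hl h'
      (by rw [hd]; rfl)⟩

/-- The dimensions of a component of the intersection for six boxes. -/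
theorem component_six {m : List (ℕ × ℕ)} (hm : m ∈ cfg 6) (hl : m.length = 2)
    (h : arcLE m [(4, 5), (1, 2)]) (h' : arcLE m [(3, 4), (0, 1)]) {d c : ℕ}
    (hd : arcDim 6 m = d) (hc : d + c = 8) :
    zdim (rankStratum 6 m) = d ∧ HasCodim (rankStratum 6 m) (orbitalVariety T₆) c ∧
      HasCodim (rankStratum 6 m) (orbitalVariety T₆') c := by
  rw [zdim_rankStratum (by norm_num) hm, hd, orbitalVariety_T₆, orbitalVariety_T₆']
  exact ⟨rfl, hasCodim_rankStratum (s := [(4, 5), (1, 2)]) (by norm_num) (by decide +kernel) hm hl h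
      -- `8 = 2 * (6 - 2)` is the dimension of both orbital varieties, given by two noncrossing arcs
      -- on six points.
      (by rw [hd, hc]; rfl),
    hasCodim_rankStratum (s := [(3, 4), (0, 1)]) (by norm_num) (by decide +kernel) hm hl h'
      (by rw [hd, hc]; rfl)⟩

theorem submatrix_mem_glOrbit {n : ℕ} (σ : Equiv.Perm (Fin n)) (x : Matrix (Fin n) (Fin n) ℂ) :
    x.submatrix σ σ ∈ glOrbit x := by
  have h : ∀ τ : Equiv.Perm (Fin n), τ.toPEquiv.toMatrix *
      (τ.symm.toPEquiv.toMatrix : Matrix (Fin n) (Fin n) ℂ) = 1 := fun τ => by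
    rw [PEquiv.toMatrix_toPEquiv_mul]
    ext i j
    simp [PEquiv.toMatrix_apply, one_apply]
  refine ⟨⟨σ.toPEquiv.toMatrix, σ.symm.toPEquiv.toMatrix, h σ, h σ.symm⟩, ?_⟩
  rw [Units.inv_mk, PEquiv.toMatrix_toPEquiv_mul, PEquiv.mul_toMatrix_toPEquiv]
  rfl

theorem mat_mem_glOrbit_five :
    mat 5 [(3, 4), (1, 2)] ∈ glOrbit (mat 5 [(2, 3), (0, 1)]) := by
  -- Shifting all points by one carries one set of arcs to the other, so a permutation matrix
  -- conjugates them.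
  convert submatrix_mem_glOrbit (finRotate 5).symm (mat 5 [(2, 3), (0, 1)]) using 1
  have h : ∀ i j : Fin 5, (i.val, j.val) ∈ [(3, 4), (1, 2)] ↔
      (((finRotate 5).symm i).val, ((finRotate 5).symm j).val) ∈ [(2, 3), (0, 1)] := by
    decide +kernel
  ext i j
  simp only [mat, submatrix_apply, of_apply, h]

/-- Orbits with reducible intersection of the closures. -/
theorem exists_reducible_five : ∃ x ∈ X2 5, ∃ y ∈ X2 5, y ∈ glOrbit x ∧
    ¬ ZIrreducible (zclosure (bOrbit x) ∩ zclosure (bOrbit y)) := by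
  have h1 : [(2, 3), (0, 1)] ∈ cfg 5 := by decide +kernel
  have h2 : [(3, 4), (1, 2)] ∈ cfg 5 := by decide +kernel
  -- The witnesses are representatives of the dense orbits of the orbital varieties of `T₅` and
  -- `T₅'`.
  refine ⟨_, (isCfg_of_mem h1).mat_mem_X2, _, (isCfg_of_mem h2).mat_mem_X2,
    mat_mem_glOrbit_five, ?_⟩
  rw [zirreducible_zclosure_inter_iff (by norm_num) h1 h2 rfl rfl]
  decide +kernel

theorem not_zirreducible_iff_four {x y : Matrix (Fin 4) (Fin 4) ℂ} (hx : x ∈ X2 4)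
    (hy : y ∈ X2 4) :
    ¬ ZIrreducible (zclosure (bOrbit x) ∩ zclosure (bOrbit y)) ↔
      ({bOrbit x, bOrbit y} : Set (Set (Matrix (Fin 4) (Fin 4) ℂ))) =
          {bOrbit (invMatrix (Equiv.swap 1 2)),
            bOrbit (invMatrix (Equiv.swap 0 1 * Equiv.swap 2 3))} ∨
      ({bOrbit x, bOrbit y} : Set (Set (Matrix (Fin 4) (Fin 4) ℂ))) =
          {bOrbit (invMatrix (Equiv.swap 1 2)),
            bOrbit (invMatrix (Equiv.swap 0 2 * Equiv.swap 1 3))} := by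
  obtain ⟨s, hs, hx⟩ := exists_cfg_bOrbit_eq hx
  obtain ⟨t, ht, hy⟩ := exists_cfg_bOrbit_eq hy
  have h4 : 4 < 7 := by norm_num
  have h1 : [(1, 2)] ∈ cfg 4 := by decide +kernel
  have h2 : [(2, 3), (0, 1)] ∈ cfg 4 := by decide +kernel
  have h3 : [(1, 3), (0, 2)] ∈ cfg 4 := by decide +kernel
  rw [zirreducible_zclosure_inter_iff h4 hs ht hx hy, not_exists_max_lower_iff s hs t ht,
    invMatrix_eq_mat (s := [(1, 2)]) (by decide +kernel),
    invMatrix_eq_mat (s := [(2, 3), (0, 1)]) (by decide +kernel),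
    invMatrix_eq_mat (s := [(1, 3), (0, 2)]) (by decide +kernel), hx, hy,
    Set.pair_eq_pair_iff, Set.pair_eq_pair_iff, bOrbit_mat_inj h4 hs h1, bOrbit_mat_inj h4 hs h2,
    bOrbit_mat_inj h4 hs h3, bOrbit_mat_inj h4 ht h1, bOrbit_mat_inj h4 ht h2,
    bOrbit_mat_inj h4 ht h3]

end OrbVar

theorem mainTheorem3 :
    -- `n ≤ 4`: closures of `B`-orbits in `X2 n`
    ((∀ n ≤ 4, ∀ x ∈ OrbVar.X2 n, ∀ y ∈ OrbVar.X2 n, y ∈ OrbVar.glOrbit x →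
        OrbVar.ZIrreducible
          (OrbVar.zclosure (OrbVar.bOrbit x) ∩ OrbVar.zclosure (OrbVar.bOrbit y))) ∧
      (∀ n ≤ 3, ∀ x ∈ OrbVar.X2 n, ∀ y ∈ OrbVar.X2 n,
        OrbVar.ZIrreducible
          (OrbVar.zclosure (OrbVar.bOrbit x) ∩ OrbVar.zclosure (OrbVar.bOrbit y))) ∧
      (∀ x ∈ OrbVar.X2 4, ∀ y ∈ OrbVar.X2 4,
        (¬ OrbVar.ZIrreducible
          (OrbVar.zclosure (OrbVar.bOrbit x) ∩ OrbVar.zclosure (OrbVar.bOrbit y)) ↔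
        ({OrbVar.bOrbit x, OrbVar.bOrbit y} : Set (Set (Matrix (Fin 4) (Fin 4) ℂ))) =
            {OrbVar.bOrbit (OrbVar.invMatrix (Equiv.swap 1 2)),
              OrbVar.bOrbit (OrbVar.invMatrix (Equiv.swap 0 1 * Equiv.swap 2 3))} ∨
        ({OrbVar.bOrbit x, OrbVar.bOrbit y} : Set (Set (Matrix (Fin 4) (Fin 4) ℂ))) =
            {OrbVar.bOrbit (OrbVar.invMatrix (Equiv.swap 1 2)),
              OrbVar.bOrbit (OrbVar.invMatrix (Equiv.swap 0 2 * Equiv.swap 1 3))}))) ∧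
    -- `n = 5`
    ((∃ x ∈ OrbVar.X2 5, ∃ y ∈ OrbVar.X2 5, y ∈ OrbVar.glOrbit x ∧
        ¬ OrbVar.ZIrreducible
          (OrbVar.zclosure (OrbVar.bOrbit x) ∩ OrbVar.zclosure (OrbVar.bOrbit y))) ∧
      (∀ S S' : OrbVar.StdTableau 5, S.TwoColumn → S'.TwoColumn → S.shape = S'.shape →
        (¬ OrbVar.ZIrreducible (OrbVar.orbitalVariety S ∩ OrbVar.orbitalVariety S') ↔
          (S = OrbVar.T₅ ∧ S' = OrbVar.T₅') ∨ (S = OrbVar.T₅' ∧ S' = OrbVar.T₅))) ∧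
      OrbVar.zcomponents (OrbVar.orbitalVariety OrbVar.T₅ ∩ OrbVar.orbitalVariety OrbVar.T₅') =
        {OrbVar.zclosure (OrbVar.bOrbit (OrbVar.invMatrix (Equiv.swap 0 2 * Equiv.swap 1 4))) ∩
            OrbVar.nilOrbit 5 OrbVar.T₅.shape,
          OrbVar.zclosure (OrbVar.bOrbit (OrbVar.invMatrix (Equiv.swap 0 3 * Equiv.swap 2 4))) ∩
            OrbVar.nilOrbit 5 OrbVar.T₅.shape,
          OrbVar.zclosure (OrbVar.bOrbit (OrbVar.invMatrix (Equiv.swap 0 4 * Equiv.swap 1 3))) ∩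
            OrbVar.nilOrbit 5 OrbVar.T₅.shape} ∧
      (OrbVar.zcomponents
        (OrbVar.orbitalVariety OrbVar.T₅ ∩ OrbVar.orbitalVariety OrbVar.T₅')).ncard = 3 ∧
      (∀ C ∈ OrbVar.zcomponents
          (OrbVar.orbitalVariety OrbVar.T₅ ∩ OrbVar.orbitalVariety OrbVar.T₅'),
        OrbVar.zdim C = 4 ∧ OrbVar.HasCodim C (OrbVar.orbitalVariety OrbVar.T₅) 2 ∧
          OrbVar.HasCodim C (OrbVar.orbitalVariety OrbVar.T₅') 2)) ∧
    -- `n = 6`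
    ((∀ n ≤ 5, ∀ S S' : OrbVar.StdTableau n, S.TwoColumn → S'.TwoColumn →
        S.shape = S'.shape →
        OrbVar.Equidimensional (OrbVar.orbitalVariety S ∩ OrbVar.orbitalVariety S')) ∧
      (∀ S S' : OrbVar.StdTableau 6, S.TwoColumn → S'.TwoColumn → S.shape = S'.shape →
        (¬ OrbVar.Equidimensional (OrbVar.orbitalVariety S ∩ OrbVar.orbitalVariety S') ↔
          (S = OrbVar.T₆ ∧ S' = OrbVar.T₆') ∨ (S = OrbVar.T₆' ∧ S' = OrbVar.T₆))) ∧
      (∃ C D : Set (Matrix (Fin 6) (Fin 6) ℂ),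
        C = OrbVar.zclosure
              (OrbVar.bOrbit (OrbVar.invMatrix (Equiv.swap 0 2 * Equiv.swap 3 5))) ∩
            OrbVar.nilOrbit 6 OrbVar.T₆.shape ∧
        D = OrbVar.zclosure
              (OrbVar.bOrbit (OrbVar.invMatrix (Equiv.swap 0 5 * Equiv.swap 1 4))) ∩
            OrbVar.nilOrbit 6 OrbVar.T₆.shape ∧
        OrbVar.zcomponents
          (OrbVar.orbitalVariety OrbVar.T₆ ∩ OrbVar.orbitalVariety OrbVar.T₆') = {C, D} ∧
        OrbVar.zdim C = 6 ∧ OrbVar.HasCodim C (OrbVar.orbitalVariety OrbVar.T₆) 2 ∧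
        OrbVar.HasCodim C (OrbVar.orbitalVariety OrbVar.T₆') 2 ∧
        OrbVar.zdim D = 4 ∧ OrbVar.HasCodim D (OrbVar.orbitalVariety OrbVar.T₆) 4 ∧
        OrbVar.HasCodim D (OrbVar.orbitalVariety OrbVar.T₆') 4)) := by
  refine ⟨⟨fun n hn x hx y hy hxy => ?_, fun n hn x hx y hy => ?_, fun x hx y hy =>
      OrbVar.not_zirreducible_iff_four hx hy⟩, ⟨?_, ?_, ?_, ?_, ?_⟩, ?_, ?_, ?_⟩
  · obtain ⟨s, hs, hbx⟩ := OrbVar.exists_cfg_bOrbit_eq hx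
    obtain ⟨t, ht, hby⟩ := OrbVar.exists_cfg_bOrbit_eq hy
    rw [OrbVar.zirreducible_zclosure_inter_iff (by omega) hs ht hbx hby]
    refine OrbVar.exists_max_lower_of_length_eq n (by omega) s hs t ht ?_
    -- Conjugate matrices have equal rank, so the two normal forms have equally many arcs.
    rw [← OrbVar.rank_of_mem_bOrbit_mat hs (hbx ▸ OrbVar.mem_bOrbit_self),
      ← OrbVar.rank_of_mem_bOrbit_mat ht (hby ▸ OrbVar.mem_bOrbit_self),
      OrbVar.rank_of_mem_glOrbit hxy]
  · obtain ⟨s, hs, hbx⟩ := OrbVar.exists_cfg_bOrbit_eq hx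
    obtain ⟨t, ht, hby⟩ := OrbVar.exists_cfg_bOrbit_eq hy
    rw [OrbVar.zirreducible_zclosure_inter_iff (by omega) hs ht hbx hby]
    exact OrbVar.exists_max_lower n (by omega) s hs t ht
  · exact OrbVar.exists_reducible_five
  · intro S S' hS hS' h
    rw [OrbVar.zirreducible_orbitalVariety_inter (by norm_num) hS hS' h,
      OrbVar.not_exists_max_lowerEq_iff _ OrbVar.StdTableau.word_mem_words _
        OrbVar.StdTableau.word_mem_words (OrbVar.StdTableau.length_word_eq h),
      ← OrbVar.word_T₅, ← OrbVar.word_T₅',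
      OrbVar.StdTableau.word_inj hS OrbVar.twoColumn_T₅,
      OrbVar.StdTableau.word_inj hS OrbVar.twoColumn_T₅',
      OrbVar.StdTableau.word_inj hS' OrbVar.twoColumn_T₅,
      OrbVar.StdTableau.word_inj hS' OrbVar.twoColumn_T₅']
  · rw [OrbVar.zcomponents_five,
      OrbVar.rankStratum_five (s := [(1, 4), (0, 2)]) (by decide +kernel) (by decide +kernel) rfl,
      OrbVar.rankStratum_five (s := [(2, 4), (0, 3)]) (by decide +kernel) (by decide +kernel) rfl,
      OrbVar.rankStratum_five (s := [(0, 4), (1, 3)]) (by decide +kernel) (by decide +kernel) rfl]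
  · have h : ∀ s ∈ OrbVar.cfg 5, ∀ t ∈ OrbVar.cfg 5, s ≠ t →
        OrbVar.rankStratum 5 s ≠ OrbVar.rankStratum 5 t := fun s hs t ht hne he =>
      hne ((OrbVar.rankStratum_inj (by norm_num) hs ht).1 he)
    rw [OrbVar.zcomponents_five]
    exact Set.ncard_eq_three.2 ⟨_, _, _,
      h _ (by decide +kernel) _ (by decide +kernel) (by decide),
      h _ (by decide +kernel) _ (by decide +kernel) (by decide),
      h _ (by decide +kernel) _ (by decide +kernel) (by decide), rfl⟩
  · rw [OrbVar.zcomponents_five]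
    rintro C (rfl | rfl | rfl)
    · exact OrbVar.component_five (m := [(1, 4), (0, 2)]) (by decide +kernel) rfl
        (by decide +kernel) (by decide +kernel) (by decide +kernel)
    · exact OrbVar.component_five (m := [(2, 4), (0, 3)]) (by decide +kernel) rfl
        (by decide +kernel) (by decide +kernel) (by decide +kernel)
    · exact OrbVar.component_five (m := [(0, 4), (1, 3)]) (by decide +kernel) rfl
        (by decide +kernel) (by decide +kernel) (by decide +kernel)
  · intro n hn S S' hS hS' h
    rw [OrbVar.equidimensional_orbitalVariety_inter (by omega) hS hS' h]
    exact OrbVar.arcDim_maxs_eq n (by omega) _ OrbVar.StdTableau.word_mem_words _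
      OrbVar.StdTableau.word_mem_words (OrbVar.StdTableau.length_word_eq h)
  · intro S S' hS hS' h
    rw [OrbVar.equidimensional_orbitalVariety_inter (by norm_num) hS hS' h,
      OrbVar.not_arcDim_maxs_eq_iff _ OrbVar.StdTableau.word_mem_words _
        OrbVar.StdTableau.word_mem_words (OrbVar.StdTableau.length_word_eq h),
      ← OrbVar.word_T₆, ← OrbVar.word_T₆',
      OrbVar.StdTableau.word_inj hS OrbVar.twoColumn_T₆,
      OrbVar.StdTableau.word_inj hS OrbVar.twoColumn_T₆',
      OrbVar.StdTableau.word_inj hS' OrbVar.twoColumn_T₆,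
      OrbVar.StdTableau.word_inj hS' OrbVar.twoColumn_T₆']
  · obtain ⟨h1, h2, h3⟩ := OrbVar.component_six (m := [(3, 5), (0, 2)]) (d := 6) (c := 2)
      (by decide +kernel) rfl (by decide +kernel) (by decide +kernel) (by decide +kernel) rfl
    obtain ⟨h4, h5, h6⟩ := OrbVar.component_six (m := [(0, 5), (1, 4)]) (d := 4) (c := 4)
      (by decide +kernel) rfl (by decide +kernel) (by decide +kernel) (by decide +kernel) rfl
    refine ⟨_, _, rfl, rfl, ?_⟩
    rw [OrbVar.rankStratum_six (s := [(3, 5), (0, 2)]) (by decide +kernel) (by decide +kernel) rfl,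
      OrbVar.rankStratum_six (s := [(0, 5), (1, 4)]) (by decide +kernel) (by decide +kernel) rfl]
    exact ⟨OrbVar.zcomponents_six, h1, h2, h3, h4, h5, h6⟩
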